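/- Let $\mathcal E$ be an elementary topos (finite limits, cartesian closed, with a subobject classifier $\Omega$). A \emph{space} means a localic space in $\mathcal E$: spaces and maps form the opposite of the category of internal frames in $\mathcal E$ and internal frame homomorphisms. An object $X$ of $\mathcal E$ is identified with the \emph{discrete} space whose frame is $\Omega^X$; $1$ is the discrete space on the terminal object, and $0$ is the empty space, whose frame has one element. For an internal Boolean algebra $A$, the \emph{Stone} space $\operatorname{Spec} A$ is the space of prime filters of $A$: maps $W\to\operatorname{Spec}A$ correspond, naturally in $W$, to lattice homomorphisms from $A$ to the frame of opens of $W$. An \emph{exponential} $Y^X$ is taken in the category of spaces: it is a space with an evaluation map $Y^X\times X\to Y$ through which every map $W\times X\to Y$ factors by a unique map $W\to Y^X$. A \emph{subspace} of $L$ is a map into $L$ whose inverse image frame homomorphism is an epimorphism in $\mathcal E$; subspaces are ordered by factorization. For an open $U$ of $L$, the open subspace of $U$ has the opens $\{a\mid a\wedge U=a\}$, with inverse image $a\mapsto a\wedge U$, and its closed complement has the opens $\{a\mid a\vee U=a\}$, with inverse image $a\mapsto a\vee U$. A truth value is a subobject $\varphi$ of $1$ in $\mathcal E$; as a discrete space,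 it is isomorphic to the open subspace of $1$ that it determines. \begin{enumerate} \item Let $X$ be discrete, and let $\varphi$ be the image of $X$ in $1$. Then the exponential $0^X$ exists, and it is the closed complement in $1$ of the open subspace given by $\varphi$. It is Stone: $0^X=\operatorname{Spec}B$, where $B$ is the Boolean algebra freely generated by $\emptyset$ subject to one relation $1\le 0$ for each $x\in X$. This $B$ is the quotient of $2=\{0,1\}$ by the congruence $\{(0,0),(1,1)\}\cup\varphi\times\{(0,1),(1,0)\}$; that is, $0$ and $1$ jointly cover $B$, and $0=1$ holds in $B$ at a stage $I$ if and only if $I\to 1$ factors through $\varphi$. \item If $X$ is discrete, then $0^{0^X}$ exists and is the discrete space on the image $\varphi$ of $X$ in $1$. \item If $X=\operatorname{Spec}A$ is Stone, then $0^X$ exists and is discrete, on the subobject $\{\emptyset\mid 0=1\text{ in }A\}$ of $1$. \item In particular, for every truth value $\varphi$, $0^{0^\varphi}\cong\varphi$: double negation holds for the spatial exponential. \item For every space $L$ and every open $U$ of $L$, the open subspace of $U$ and its closed complement have join $L$ and meet the empty subspace, in the order of subspaces of $L$. In particular $\varphi\vee 0^\varphi=1$ among the subspaces of $1$, for every truth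 value $\varphi$. \end{enumerate} -/

import Mathlib

open CategoryTheory Limits MonoidalCategory CartesianMonoidalCategory

universe v u

set_option linter.unusedSectionVars false

namespace PointFree

section Lattices

variable {E : Type u} [Category.{v} E]

/-- An internal bounded distributive lattice: an object with lattice operations on its generalized
elements, natural in the stage of definition. (By the Yoneda lemma this is the same as an object
`A` with morphisms `⊤, ⊥ : 1 ⟶ A` and `⊓, ⊔ : A × A ⟶ A` that satisfy the lattice equations.) -/
structure InternalLattice (E : Type u) [Category.{v} E] where
  obj : E
  top : ∀ I : E, I ⟶ obj
  bot : ∀ I : E, I ⟶ obj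
  inf : ∀ {I : E}, (I ⟶ obj) → (I ⟶ obj) → (I ⟶ obj)
  sup : ∀ {I : E}, (I ⟶ obj) → (I ⟶ obj) → (I ⟶ obj)
  comp_top : ∀ {I J : E} (u : J ⟶ I), u ≫ top I = top J
  comp_bot : ∀ {I J : E} (u : J ⟶ I), u ≫ bot I = bot J
  comp_inf : ∀ {I J : E} (u : J ⟶ I) (a b : I ⟶ obj), u ≫ inf a b = inf (u ≫ a) (u ≫ b)
  comp_sup : ∀ {I J : E} (u : J ⟶ I) (a b : I ⟶ obj), u ≫ sup a b = sup (u ≫ a) (u ≫ b)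
  inf_comm : ∀ {I : E} (a b : I ⟶ obj), inf a b = inf b a
  sup_comm : ∀ {I : E} (a b : I ⟶ obj), sup a b = sup b a
  inf_assoc : ∀ {I : E} (a b c : I ⟶ obj), inf (inf a b) c = inf a (inf b c)
  sup_assoc : ∀ {I : E} (a b c : I ⟶ obj), sup (sup a b) c = sup a (sup b c)
  inf_sup_self : ∀ {I : E} (a b : I ⟶ obj), inf a (sup a b) = a
  sup_inf_self : ∀ {I : E} (a b : I ⟶ obj), sup a (inf a b) = a
  inf_sup_left : ∀ {I : E} (a b c : I ⟶ obj), inf a (sup b c) = sup (inf a b) (inf a c)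
  inf_top : ∀ {I : E} (a : I ⟶ obj), inf a (top I) = a
  sup_bot : ∀ {I : E} (a : I ⟶ obj), sup a (bot I) = a

namespace InternalLattice

/-- The internal order, on generalized elements: `a ≤ b` iff `a ⊓ b = a`. -/
def le (A : InternalLattice E) {I : E} (a b : I ⟶ A.obj) : Prop := A.inf a b = a

/-- `s` is the internal join of the family `a : J ⟶ A` indexed by the fibres of `f : J ⟶ I`:
`s i = ⋁ {a j | f j = i}`, in the sense of generalized elements (at all stages `K` over `I`). -/
def IsJoin (A : InternalLattice E) {I J : E} (f : J ⟶ I) (a : J ⟶ A.obj) (s : I ⟶ A.obj) : Prop :=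
  ∀ ⦃K : E⦄ (u : K ⟶ I) (b : K ⟶ A.obj), A.le (u ≫ s) b ↔
    ∀ ⦃T : E⦄ (p : T ⟶ K) (q : T ⟶ J), p ≫ u = q ≫ f → A.le (q ≫ a) (p ≫ b)

/-- An internal lattice is an internal frame if all internal families have joins, and binary
meets distribute over them. -/
structure IsFrame (A : InternalLattice E) : Prop where
  exists_join : ∀ {I J : E} (f : J ⟶ I) (a : J ⟶ A.obj), ∃ s : I ⟶ A.obj, A.IsJoin f a s
  inf_join : ∀ {I J : E} (f : J ⟶ I) (a : J ⟶ A.obj) (s c : I ⟶ A.obj), A.IsJoin f a s →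
    A.IsJoin f (A.inf (f ≫ c) a) (A.inf c s)

/-- An internal Boolean algebra: every generalized element has a complement. -/
def IsBoolean (A : InternalLattice E) : Prop :=
  ∀ {I : E} (a : I ⟶ A.obj), ∃ b : I ⟶ A.obj, A.inf a b = A.bot I ∧ A.sup a b = A.top I

/-- Homomorphisms of internal bounded lattices. -/
@[ext]
structure Hom (A B : InternalLattice E) where
  map : A.obj ⟶ B.obj
  top_map : ∀ I : E, A.top I ≫ map = B.top I
  bot_map : ∀ I : E, A.bot I ≫ map = B.bot I
  inf_map : ∀ {I : E} (a b : I ⟶ A.obj), A.inf a b ≫ map = B.inf (a ≫ map) (b ≫ map)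
  sup_map : ∀ {I : E} (a b : I ⟶ A.obj), A.sup a b ≫ map = B.sup (a ≫ map) (b ≫ map)

/-- The generalized elements of an internal lattice at stage `I`, as an external lattice. -/
def El (A : InternalLattice E) (I : E) : Type v := I ⟶ A.obj

instance (A : InternalLattice E) (I : E) : DistribLattice (A.El I) :=
  letI _L : Lattice (A.El I) :=
    @Lattice.mk' (A.El I) ⟨fun a b => A.sup a b⟩ ⟨fun a b => A.inf a b⟩ A.sup_comm A.sup_assoc
      A.inf_comm A.inf_assoc A.sup_inf_self A.inf_sup_self
  DistribLattice.ofInfSupLe fun a b c => le_of_eq (A.inf_sup_left a b c)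

section Order

variable (A : InternalLattice E) {I J : E}

lemma le_iff (a b : I ⟶ A.obj) : A.le a b ↔ (show A.El I from a) ≤ (show A.El I from b) :=
  inf_eq_left (a := (show A.El I from a)) (b := (show A.El I from b))

lemma le_refl (a : I ⟶ A.obj) : A.le a a := (A.le_iff _ _).2 (_root_.le_refl _)

variable {A}

lemma le.trans {a b c : I ⟶ A.obj} (h : A.le a b) (k : A.le b c) : A.le a c :=
  (A.le_iff _ _).2 (((A.le_iff _ _).1 h).trans ((A.le_iff _ _).1 k))

lemma le.antisymm {a b : I ⟶ A.obj} (h : A.le a b) (k : A.le b a) : a = b :=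
  _root_.le_antisymm (α := A.El I) ((A.le_iff _ _).1 h) ((A.le_iff _ _).1 k)

lemma le.comp {a b : I ⟶ A.obj} (h : A.le a b) (u : J ⟶ I) : A.le (u ≫ a) (u ≫ b) := by
  unfold le at *; rw [← A.comp_inf, h]

lemma le_meet_iff {a b c : I ⟶ A.obj} : A.le c (A.inf a b) ↔ A.le c a ∧ A.le c b := by
  simp only [le_iff]
  exact _root_.le_inf_iff (α := A.El I)

lemma join_le_iff {a b c : I ⟶ A.obj} : A.le (A.sup a b) c ↔ A.le a c ∧ A.le b c := by
  simp only [le_iff]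
  exact _root_.sup_le_iff (α := A.El I)

lemma le_top (a : I ⟶ A.obj) : A.le a (A.top I) := A.inf_top a

lemma bot_le (a : I ⟶ A.obj) : A.le (A.bot I) a := by
  have h : A.le (A.bot I) (A.sup a (A.bot I)) := (join_le_iff.1 (A.le_refl _)).2
  rwa [A.sup_bot] at h

lemma sup_eq_iff_le {a b : I ⟶ A.obj} : A.sup a b = a ↔ A.le b a := by
  rw [le_iff]
  exact _root_.sup_eq_left (α := A.El I)

variable (A)

lemma sup_inf_distrib (a b c : I ⟶ A.obj) : A.sup (A.inf a b) c = A.inf (A.sup a c) (A.sup b c) :=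
  sup_inf_right (α := A.El I) a b c

lemma sup_sup_distrib (a b c : I ⟶ A.obj) : A.sup (A.sup a b) c = A.sup (A.sup a c) (A.sup b c) :=
  sup_sup_distrib_right (α := A.El I) a b c

lemma inf_inf_distrib (a b c : I ⟶ A.obj) : A.inf (A.inf a b) c = A.inf (A.inf a c) (A.inf b c) :=
  inf_inf_distrib_right (α := A.El I) a b c

lemma inf_sup_distrib (a b c : I ⟶ A.obj) : A.inf (A.sup a b) c = A.sup (A.inf a c) (A.inf b c) :=
  inf_sup_right (α := A.El I) a b c

/-- Binary meets distribute over internal joins if there is a (stable) Heyting implication. -/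
lemma inf_join_of_imp (himp : ∀ {K : E} (y z : K ⟶ A.obj), ∃ w : K ⟶ A.obj,
      ∀ {T : E} (p : T ⟶ K) (x : T ⟶ A.obj),
        A.le x (p ≫ w) ↔ A.le (A.inf x (p ≫ y)) (p ≫ z))
    {I J : E} (f : J ⟶ I) (a : J ⟶ A.obj) (s c : I ⟶ A.obj) (hs : A.IsJoin f a s) :
    A.IsJoin f (A.inf (f ≫ c) a) (A.inf c s) := by
  intro K u b
  obtain ⟨w, hw⟩ := himp (u ≫ c) b
  have h1 := hw (𝟙 K) (u ≫ s)
  simp only [Category.id_comp] at h1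
  rw [A.comp_inf, A.inf_comm, ← h1, hs]
  refine forall_congr' fun T => forall_congr' fun p => forall_congr' fun q =>
    forall_congr' fun hpq => ?_
  rw [hw, A.comp_inf, A.inf_comm (q ≫ a), ← Category.assoc p, ← Category.assoc q, hpq]

end Order

/-- Homomorphisms are monotone. -/
lemma Hom.mono {A B : InternalLattice E} (h : Hom A B) {I : E} {a b : I ⟶ A.obj}
    (k : A.le a b) : B.le (a ≫ h.map) (b ≫ h.map) := by
  unfold le at *; rw [← h.inf_map, k]

end InternalLattice

/-- A localic space in `E`, given by its internal frame of opens. -/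
structure LocalicSpace (E : Type u) [Category.{v} E] where
  opens : InternalLattice E
  isFrame : opens.IsFrame

/-- A map of localic spaces `X ⟶ Y` is an internal frame homomorphism `inv` from the opens of `Y`
to those of `X`. -/
@[ext]
structure LocalicSpace.Map (X Y : LocalicSpace E) where
  inv : InternalLattice.Hom Y.opens X.opens
  map_join : ∀ {I J : E} (f : J ⟶ I) (a : J ⟶ Y.opens.obj) (s : I ⟶ Y.opens.obj),
    Y.opens.IsJoin f a s → X.opens.IsJoin f (a ≫ inv.map) (s ≫ inv.map)

instance : Category (LocalicSpace E) where
  Hom X Y := LocalicSpace.Map X Y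
  id X :=
    { inv := ⟨𝟙 _, by simp, by simp, by simp, by simp⟩
      map_join := by intro I J f a s h; simpa using h }
  comp {X Y Z} f g :=
    { inv := ⟨g.inv.map ≫ f.inv.map,
        by intro I; rw [← Category.assoc, g.inv.top_map, f.inv.top_map],
        by intro I; rw [← Category.assoc, g.inv.bot_map, f.inv.bot_map],
        by intro I a b
           rw [← Category.assoc, g.inv.inf_map, f.inv.inf_map, Category.assoc, Category.assoc],
        by intro I a b
           rw [← Category.assoc, g.inv.sup_map, f.inv.sup_map, Category.assoc, Category.assoc]⟩
      map_join := by
        intro I J k a s h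
        simpa using f.map_join k _ _ (g.map_join k _ _ h) }
  id_comp f := by
    apply LocalicSpace.Map.ext; apply InternalLattice.Hom.ext; exact Category.comp_id _
  comp_id f := by
    apply LocalicSpace.Map.ext; apply InternalLattice.Hom.ext; exact Category.id_comp _
  assoc f g h := by
    apply LocalicSpace.Map.ext; apply InternalLattice.Hom.ext; exact (Category.assoc _ _ _).symm

/-- `S` is the spectrum of `A`, the space of prime filters of `A`: its points at each stage `W`
(the maps `W ⟶ S`) are the prime filters of `A` over `W`, that is, the lattice homomorphisms from
`A` to the opens of `W`, naturally in `W`. -/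
def IsSpec (A : InternalLattice E) (S : LocalicSpace E) : Prop :=
  ∃ η : InternalLattice.Hom A S.opens, ∀ (W : LocalicSpace E) (h : InternalLattice.Hom A W.opens),
    ∃! g : W ⟶ S, η.map ≫ g.inv.map = h.map

end Lattices

section Exponentials

variable {C : Type u} [Category.{v} C]

/-- A map `W × X ⟶ Y`, given by its action on generalized points. -/
@[ext]
structure TwoVarMap (W X Y : C) where
  app : ∀ ⦃T : C⦄, (T ⟶ W) → (T ⟶ X) → (T ⟶ Y)
  natural : ∀ ⦃T T' : C⦄ (t : T' ⟶ T) (w : T ⟶ W) (x : T ⟶ X),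
    app (t ≫ w) (t ≫ x) = t ≫ app w x

/-- For any product cone on `W` and `X`, the maps `W × X ⟶ Y` in the sense of `TwoVarMap` are the
morphisms from the vertex of the cone. -/
def TwoVarMap.equivOfIsLimit {W X : C} (c : BinaryFan W X) (hc : IsLimit c) (Y : C) :
    TwoVarMap W X Y ≃ (c.pt ⟶ Y) where
  toFun g := g.app c.fst c.snd
  invFun k :=
    { app := fun _ w x => hc.lift (BinaryFan.mk w x) ≫ k
      natural := by
        intro T T' t w x
        rw [← Category.assoc]
        congr 1
        apply BinaryFan.IsLimit.hom_ext hc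
        · rw [Category.assoc]; erw [hc.fac, hc.fac]; rfl
        · rw [Category.assoc]; erw [hc.fac, hc.fac]; rfl }
  left_inv g := by
    ext T w x
    change hc.lift (BinaryFan.mk w x) ≫ g.app c.fst c.snd = g.app w x
    refine (g.natural (hc.lift (BinaryFan.mk w x)) c.fst c.snd).symm.trans ?_
    congr 1
    · exact hc.fac _ ⟨WalkingPair.left⟩
    · exact hc.fac _ ⟨WalkingPair.right⟩
  right_inv k := by
    have : hc.lift (BinaryFan.mk c.fst c.snd) = 𝟙 _ := by
      apply BinaryFan.IsLimit.hom_ext hc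
      · erw [hc.fac, Category.id_comp]; rfl
      · erw [hc.fac, Category.id_comp]; rfl
    change hc.lift (BinaryFan.mk c.fst c.snd) ≫ k = k
    rw [this, Category.id_comp]

/-- `Z` is the exponential `Y ^ X`: there is an evaluation map `Z × X ⟶ Y` through which every
map `W × X ⟶ Y` factors, by a unique `W ⟶ Z`. -/
def IsExponential (X Y Z : C) : Prop :=
  ∃ ev : TwoVarMap Z X Y, ∀ (W : C) (g : TwoVarMap W X Y),
    ∃! h : W ⟶ Z, ∀ ⦃T : C⦄ (w : T ⟶ W) (x : T ⟶ X), g.app w x = ev.app (w ≫ h) x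

end Exponentials

section Spaces

variable {E : Type u} [Category.{v} E]

/-- A subspace of `L`: a map into `L` whose inverse image homomorphism is internally surjective. -/
structure Subspace (L : LocalicSpace E) where
  space : LocalicSpace E
  incl : space ⟶ L
  epi : Epi incl.inv.map

/-- Subspaces are ordered by factorization of their inclusions. -/
instance (L : LocalicSpace E) : Preorder (Subspace L) where
  le S T := ∃ k : S.space ⟶ T.space, k ≫ T.incl = S.incl
  le_refl S := ⟨𝟙 _, Category.id_comp _⟩
  le_trans S T U := by
    rintro ⟨k, hk⟩ ⟨l, hl⟩
    exact ⟨k ≫ l, by rw [Category.assoc, hl, hk]⟩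

/-- The whole space as a subspace. -/
def Subspace.whole (L : LocalicSpace E) : Subspace L := ⟨L, 𝟙 L, inferInstanceAs (Epi (𝟙 L.opens.obj))⟩

end Spaces


section Retracts

variable {E : Type u} [Category.{v} E]

namespace InternalLattice

/-- The lattice structure on a retract `Q` of `A` that is the fixed part of an idempotent
endomorphism `r ≫ ι` of `A` which preserves binary meets and joins. -/
def retract (A : InternalLattice E) {Q : E} (ι : Q ⟶ A.obj) (r : A.obj ⟶ Q) (hr : ι ≫ r = 𝟙 Q)
    (hinf : ∀ {I : E} (a b : I ⟶ A.obj),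
      A.inf a b ≫ r ≫ ι = A.inf (a ≫ r ≫ ι) (b ≫ r ≫ ι))
    (hsup : ∀ {I : E} (a b : I ⟶ A.obj),
      A.sup a b ≫ r ≫ ι = A.sup (a ≫ r ≫ ι) (b ≫ r ≫ ι)) : InternalLattice E :=
  have hid : ∀ {I : E} (q : I ⟶ Q), q ≫ ι ≫ r = q := fun q => by rw [hr, Category.comp_id]
  have hi : ∀ {I : E} (a b : I ⟶ Q), A.inf (a ≫ ι) (b ≫ ι) ≫ r ≫ ι = A.inf (a ≫ ι) (b ≫ ι) :=
    fun a b => by rw [hinf]; simp only [Category.assoc, reassoc_of% hr]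
  have hs : ∀ {I : E} (a b : I ⟶ Q), A.sup (a ≫ ι) (b ≫ ι) ≫ r ≫ ι = A.sup (a ≫ ι) (b ≫ ι) :=
    fun a b => by rw [hsup]; simp only [Category.assoc, reassoc_of% hr]
  { obj := Q
    top := fun I => A.top I ≫ r
    bot := fun I => A.bot I ≫ r
    inf := fun a b => A.inf (a ≫ ι) (b ≫ ι) ≫ r
    sup := fun a b => A.sup (a ≫ ι) (b ≫ ι) ≫ r
    comp_top := fun u => by rw [← Category.assoc, A.comp_top]
    comp_bot := fun u => by rw [← Category.assoc, A.comp_bot]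
    comp_inf := fun u a b => by rw [← Category.assoc, A.comp_inf, Category.assoc, Category.assoc]
    comp_sup := fun u a b => by rw [← Category.assoc, A.comp_sup, Category.assoc, Category.assoc]
    inf_comm := fun a b => by rw [A.inf_comm]
    sup_comm := fun a b => by rw [A.sup_comm]
    inf_assoc := fun a b c => by simp only [Category.assoc, hi, A.inf_assoc]
    sup_assoc := fun a b c => by simp only [Category.assoc, hs, A.sup_assoc]
    inf_sup_self := fun a b => by
      simp only [Category.assoc, hs, A.inf_sup_self, hid]
    sup_inf_self := fun a b => by
      simp only [Category.assoc, hi, A.sup_inf_self, hid]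
    inf_sup_left := fun a b c => by
      simp only [Category.assoc, hs, hi, A.inf_sup_left]
    inf_top := fun {I} a => by
      have h : A.inf (a ≫ ι) (A.top I ≫ r ≫ ι) = A.inf (a ≫ ι) (A.top I) ≫ r ≫ ι := by
        rw [hinf]; simp only [Category.assoc, reassoc_of% hr]
      simp only [Category.assoc]
      rw [h, A.inf_top]
      simp only [Category.assoc, hid]
    sup_bot := fun {I} a => by
      have h : A.sup (a ≫ ι) (A.bot I ≫ r ≫ ι) = A.sup (a ≫ ι) (A.bot I) ≫ r ≫ ι := by
        rw [hsup]; simp only [Category.assoc, reassoc_of% hr]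
      simp only [Category.assoc]
      rw [h, A.sup_bot]
      simp only [Category.assoc, hid] }

section

variable {A : InternalLattice E} {Q : E} {ι : Q ⟶ A.obj} {r : A.obj ⟶ Q} {hr : ι ≫ r = 𝟙 Q}
    {hinf : ∀ {I : E} (a b : I ⟶ A.obj),
      A.inf a b ≫ r ≫ ι = A.inf (a ≫ r ≫ ι) (b ≫ r ≫ ι)}
    {hsup : ∀ {I : E} (a b : I ⟶ A.obj),
      A.sup a b ≫ r ≫ ι = A.sup (a ≫ r ≫ ι) (b ≫ r ≫ ι)}

lemma retract_le_iff {I : E} (a b : I ⟶ Q) :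
    (A.retract ι r hr hinf hsup).le a b ↔ A.le (a ≫ ι) (b ≫ ι) := by
  have hi : A.inf (a ≫ ι) (b ≫ ι) ≫ r ≫ ι = A.inf (a ≫ ι) (b ≫ ι) := by
    rw [hinf]; simp only [Category.assoc, reassoc_of% hr]
  change A.inf (a ≫ ι) (b ≫ ι) ≫ r = a ↔ A.inf (a ≫ ι) (b ≫ ι) = a ≫ ι
  constructor
  · intro h
    rw [← hi, ← Category.assoc, h]
  · intro h
    rw [h, Category.assoc, hr, Category.comp_id]

/-- The retraction is a lattice homomorphism. -/
def retractHom (A : InternalLattice E) {Q : E} (ι : Q ⟶ A.obj) (r : A.obj ⟶ Q) (hr : ι ≫ r = 𝟙 Q)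
    (hinf : ∀ {I : E} (a b : I ⟶ A.obj),
      A.inf a b ≫ r ≫ ι = A.inf (a ≫ r ≫ ι) (b ≫ r ≫ ι))
    (hsup : ∀ {I : E} (a b : I ⟶ A.obj),
      A.sup a b ≫ r ≫ ι = A.sup (a ≫ r ≫ ι) (b ≫ r ≫ ι)) :
    Hom A (A.retract ι r hr hinf hsup) where
  map := r
  top_map _ := rfl
  bot_map _ := rfl
  inf_map a b := by
    change A.inf a b ≫ r = A.inf ((a ≫ r) ≫ ι) ((b ≫ r) ≫ ι) ≫ r
    rw [Category.assoc, Category.assoc, ← hinf]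
    simp only [Category.assoc, hr, Category.comp_id]
  sup_map a b := by
    change A.sup a b ≫ r = A.sup ((a ≫ r) ≫ ι) ((b ≫ r) ≫ ι) ≫ r
    rw [Category.assoc, Category.assoc, ← hsup]
    simp only [Category.assoc, hr, Category.comp_id]

lemma IsJoin.congr {I J : E} {f : J ⟶ I} {a a' : J ⟶ A.obj} {s s' : I ⟶ A.obj}
    (h : A.IsJoin f a s) (ha : a = a') (hs : s = s') : A.IsJoin f a' s' := by
  subst ha hs; exact h

lemma IsJoin.unique {I J : E} {f : J ⟶ I} {a : J ⟶ A.obj} {s t : I ⟶ A.obj}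
    (hs : A.IsJoin f a s) (ht : A.IsJoin f a t) : s = t := by
  have key : ∀ {s t : I ⟶ A.obj}, A.IsJoin f a s → A.IsJoin f a t → A.le s t := by
    intro s t hs ht
    have h := (hs (𝟙 I) t).2 fun T p q hpq => by
      have := (ht (𝟙 I) t).1 (by simpa using A.le_refl t) p q hpq
      exact this
    simpa using h
  exact (key hs ht).antisymm (key ht hs)

/-- The condition for the retraction `r` to preserve joins. -/
def PreservesJoins (A : InternalLattice E) {Q : E} (ι : Q ⟶ A.obj) (r : A.obj ⟶ Q) : Prop :=
  ∀ ⦃I J : E⦄ (f : J ⟶ I) (a : J ⟶ A.obj) (s : I ⟶ A.obj), A.IsJoin f a s →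
    ∀ ⦃K : E⦄ (u : K ⟶ I) (b : K ⟶ Q), A.le (u ≫ s ≫ r ≫ ι) (b ≫ ι) ↔
      ∀ ⦃T : E⦄ (p : T ⟶ K) (q : T ⟶ J), p ≫ u = q ≫ f → A.le (q ≫ a ≫ r ≫ ι) (p ≫ b ≫ ι)

lemma retract_isJoin (hj : A.PreservesJoins ι r) {I J : E} (f : J ⟶ I) (a : J ⟶ A.obj)
    (s : I ⟶ A.obj) (h : A.IsJoin f a s) :
    (A.retract ι r hr hinf hsup).IsJoin f (a ≫ r) (s ≫ r) := by
  intro K u b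
  refine (retract_le_iff (u ≫ s ≫ r) b).trans ?_
  have h1 := hj f a s h u b
  simp only [Category.assoc]
  rw [h1]
  refine forall_congr' fun T => forall_congr' fun p => forall_congr' fun q =>
    imp_congr_right fun _ => ?_
  have h2 := retract_le_iff (hr := hr) (hinf := hinf) (hsup := hsup) (q ≫ a ≫ r)
    (p ≫ (show K ⟶ Q from b))
  have e : (p ≫ (show K ⟶ Q from b)) ≫ ι = p ≫ b ≫ ι := Category.assoc _ _ _
  rw [e, Category.assoc, Category.assoc] at h2
  exact h2.symm

lemma retract_exists_join (hA : A.IsFrame) (hj : A.PreservesJoins ι r) {I J : E} (f : J ⟶ I)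
    (a : J ⟶ Q) : ∃ s : I ⟶ A.obj, A.IsJoin f (a ≫ ι) s ∧
      (A.retract ι r hr hinf hsup).IsJoin f a (s ≫ r) := by
  obtain ⟨s, hs⟩ := hA.exists_join f (a ≫ ι)
  refine ⟨s, hs, ?_⟩
  have h := retract_isJoin (hr := hr) (hinf := hinf) (hsup := hsup) hj f _ s hs
  have e : (a ≫ ι) ≫ r = a := by rw [Category.assoc, hr, Category.comp_id]
  exact h.congr e rfl

/-- A retract of a frame whose retraction preserves joins is a frame. -/
lemma retract_isFrame (hA : A.IsFrame) (hj : A.PreservesJoins ι r) :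
    (A.retract ι r hr hinf hsup).IsFrame where
  exists_join f a := by
    obtain ⟨s, -, hs⟩ := retract_exists_join (hr := hr) (hinf := hinf) (hsup := hsup) hA hj f a
    exact ⟨_, hs⟩
  inf_join {I J} f a s c h := by
    obtain ⟨s', h0, h1⟩ := retract_exists_join (hr := hr) (hinf := hinf) (hsup := hsup) hA hj f a
    have h2 : s = s' ≫ r := h.unique h1
    have key : ∀ (a : J ⟶ Q) (c : I ⟶ Q), A.IsJoin f (a ≫ ι) s' →
        (A.retract ι r hr hinf hsup).IsJoin f (A.inf ((f ≫ c) ≫ ι) (a ≫ ι) ≫ r)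
          (A.inf (c ≫ ι) ((s' ≫ r) ≫ ι) ≫ r) := by
      intro a c h0
      have h3 := retract_isJoin (hr := hr) (hinf := hinf) (hsup := hsup) hj f _ _
        (hA.inf_join f _ s' (c ≫ ι) h0)
      have h4 : A.inf (c ≫ ι) s' ≫ r = A.inf (c ≫ ι) ((s' ≫ r) ≫ ι) ≫ r := by
        have e : A.inf (c ≫ ι) s' ≫ r = (A.inf (c ≫ ι) s' ≫ r ≫ ι) ≫ r := by
          simp only [Category.assoc, hr, Category.comp_id]
        rw [e, hinf]
        simp only [Category.assoc, reassoc_of% hr]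
      exact h3.congr (by rw [Category.assoc]) h4
    rw [h2]
    exact key a c h0

end

end InternalLattice

/-- The localic space whose frame is a retract of the frame of `L`, as a subspace of `L`. -/
def Subspace.ofRetract (L : LocalicSpace E) {Q : E} (ι : Q ⟶ L.opens.obj) (r : L.opens.obj ⟶ Q)
    (hr : ι ≫ r = 𝟙 Q)
    (hinf : ∀ {I : E} (a b : I ⟶ L.opens.obj),
      L.opens.inf a b ≫ r ≫ ι = L.opens.inf (a ≫ r ≫ ι) (b ≫ r ≫ ι))
    (hsup : ∀ {I : E} (a b : I ⟶ L.opens.obj),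
      L.opens.sup a b ≫ r ≫ ι = L.opens.sup (a ≫ r ≫ ι) (b ≫ r ≫ ι))
    (hj : L.opens.PreservesJoins ι r) : Subspace L where
  space := ⟨L.opens.retract ι r hr hinf hsup, InternalLattice.retract_isFrame L.isFrame hj⟩
  incl := ⟨InternalLattice.retractHom L.opens ι r hr hinf hsup, fun f a s h =>
    InternalLattice.retract_isJoin (hr := hr) (hinf := hinf) (hsup := hsup) hj f a s h⟩
  epi := by
    have key : Epi r := ⟨fun {Z} g h hgh => by
      rw [← Category.id_comp g, ← Category.id_comp h, ← hr, Category.assoc, Category.assoc, hgh]⟩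
    exact key

end Retracts



section Topos

variable {E : Type u} [Category.{v} E] [CartesianMonoidalCategory E]

/-- The empty space: its frame of opens is the one-element frame. -/
def emptySpace (E : Type u) [Category.{v} E] [CartesianMonoidalCategory E] : LocalicSpace E where
  opens :=
    { obj := 𝟙_ E
      top := fun I => toUnit I
      bot := fun I => toUnit I
      inf := fun {I} _ _ => toUnit I
      sup := fun {I} _ _ => toUnit I
      comp_top := fun _ => toUnit_unique _ _
      comp_bot := fun _ => toUnit_unique _ _
      comp_inf := fun _ _ _ => toUnit_unique _ _
      comp_sup := fun _ _ _ => toUnit_unique _ _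
      inf_comm := fun _ _ => toUnit_unique _ _
      sup_comm := fun _ _ => toUnit_unique _ _
      inf_assoc := fun _ _ _ => toUnit_unique _ _
      sup_assoc := fun _ _ _ => toUnit_unique _ _
      inf_sup_self := fun _ _ => toUnit_unique _ _
      sup_inf_self := fun _ _ => toUnit_unique _ _
      inf_sup_left := fun _ _ _ => toUnit_unique _ _
      inf_top := fun _ => toUnit_unique _ _
      sup_bot := fun _ => toUnit_unique _ _ }
  isFrame :=
    { exists_join := fun {I _} _ _ => ⟨toUnit I, fun _ _ _ =>
        ⟨fun _ _ _ _ _ => toUnit_unique _ _, fun _ => toUnit_unique _ _⟩⟩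
      inf_join := fun _ _ _ _ _ _ _ _ =>
        ⟨fun _ _ _ _ _ => toUnit_unique _ _, fun _ => toUnit_unique _ _⟩ }

/-- The empty space is initial among the spaces. -/
def emptySpaceIsInitial : IsInitial (emptySpace E) :=
  IsInitial.ofUniqueHom
    (fun X =>
      { inv := ⟨toUnit _, fun _ => toUnit_unique _ _, fun _ => toUnit_unique _ _,
          fun _ _ => toUnit_unique _ _, fun _ _ => toUnit_unique _ _⟩
        map_join := fun _ _ _ _ _ _ _ =>
          ⟨fun _ _ _ _ _ => toUnit_unique _ _, fun _ => toUnit_unique _ _⟩ })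
    (fun X f => by
      apply LocalicSpace.Map.ext; apply InternalLattice.Hom.ext; exact toUnit_unique _ _)


/-- The empty subspace. -/
def Subspace.empty (L : LocalicSpace E) : Subspace L where
  space := emptySpace E
  incl := emptySpaceIsInitial.to L
  epi := by
    have key : ∀ m : L.opens.obj ⟶ 𝟙_ E, Epi m := fun m => ⟨fun {Z} g h hgh => by
      have e : L.opens.top (𝟙_ E) ≫ m = 𝟙 (𝟙_ E) := toUnit_unique _ _
      rw [← Category.id_comp g, ← Category.id_comp h, ← e, Category.assoc, Category.assoc, hgh]⟩
    exact key _

/-- A global element, as a constant generalized element at stage `I`. -/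
abbrev constAt {A : E} (U : 𝟙_ E ⟶ A) (I : E) : I ⟶ A := toUnit I ≫ U

lemma comp_constAt {A I J : E} (U : 𝟙_ E ⟶ A) (u : J ⟶ I) : u ≫ constAt U I = constAt U J := by
  simp [constAt]

section OpenClosed

variable (L : LocalicSpace E) (U : 𝟙_ E ⟶ L.opens.obj)

open InternalLattice

lemma comp_supU {I : E} (a : I ⟶ L.opens.obj) :
    a ≫ L.opens.sup (𝟙 _) (constAt U _) = L.opens.sup a (constAt U I) := by
  rw [L.opens.comp_sup, Category.comp_id, comp_constAt]

lemma comp_infU {I : E} (a : I ⟶ L.opens.obj) :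
    a ≫ L.opens.inf (𝟙 _) (constAt U _) = L.opens.inf a (constAt U I) := by
  rw [L.opens.comp_inf, Category.comp_id, comp_constAt]

variable [HasEqualizers E]

/-- The closed complement of the open `U` of `L`: its opens are the opens `a` of `L` with
`a ⊔ U = a`, and the inverse image along the inclusion is `a ↦ a ⊔ U`. -/
noncomputable def closedSubspace : Subspace L :=
  Subspace.ofRetract L
    (equalizer.ι (L.opens.sup (𝟙 _) (constAt U _)) (𝟙 _))
    (equalizer.lift (L.opens.sup (𝟙 _) (constAt U _)) (by
      rw [comp_supU, Category.comp_id]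
      exact sup_eq_iff_le.2 ((join_le_iff.1 (L.opens.le_refl _)).2)))
    (by
      refine equalizer.hom_ext ((Category.assoc _ _ _).trans ?_)
      rw [equalizer.lift_ι, Category.id_comp, equalizer.condition, Category.comp_id])
    (by
      intro I a b
      simp only [equalizer.lift_ι, comp_supU]
      exact L.opens.sup_inf_distrib _ _ _)
    (by
      intro I a b
      simp only [equalizer.lift_ι, comp_supU]
      exact L.opens.sup_sup_distrib _ _ _)
    (by
      intro I J f a s h K u b
      have hb : L.opens.le (constAt U K) (b ≫ equalizer.ι _ _) := by
        rw [← sup_eq_iff_le, ← comp_supU, Category.assoc, equalizer.condition, Category.comp_id]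
      have red : ∀ {T : E} (x : T ⟶ L.opens.obj) (p : T ⟶ K),
          L.opens.le (L.opens.sup x (constAt U T)) (p ≫ b ≫ equalizer.ι _ _) ↔
            L.opens.le x (p ≫ b ≫ equalizer.ι _ _) := by
        intro T x p
        have h1 := hb.comp p
        rw [comp_constAt] at h1
        rw [join_le_iff]
        exact ⟨fun h => h.1, fun h => ⟨h, h1⟩⟩
      have red1 := red (u ≫ s) (𝟙 K)
      simp only [Category.id_comp] at red1
      simp only [equalizer.lift_ι]
      rw [← Category.assoc u s, comp_supU, red1, h u]
      refine forall_congr' fun T => forall_congr' fun p => forall_congr' fun q =>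
        imp_congr_right fun _ => ?_
      rw [← Category.assoc q a, comp_supU, red])

/-- The open subspace of `L` given by `U`: its opens are the opens `a` of `L` with
`a ⊓ U = a`, and the inverse image along the inclusion is `a ↦ a ⊓ U`. -/
noncomputable def openSubspace : Subspace L :=
  Subspace.ofRetract L
    (equalizer.ι (L.opens.inf (𝟙 _) (constAt U _)) (𝟙 _))
    (equalizer.lift (L.opens.inf (𝟙 _) (constAt U _)) (by
      rw [comp_infU, Category.comp_id]
      exact show L.opens.le _ _ from (le_meet_iff.1 (L.opens.le_refl _)).2))
    (by
      refine equalizer.hom_ext ((Category.assoc _ _ _).trans ?_)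
      rw [equalizer.lift_ι, Category.id_comp, equalizer.condition, Category.comp_id])
    (by
      intro I a b
      simp only [equalizer.lift_ι, comp_infU]
      exact L.opens.inf_inf_distrib _ _ _)
    (by
      intro I a b
      simp only [equalizer.lift_ι, comp_infU]
      exact L.opens.inf_sup_distrib _ _ _)
    (by
      intro I J f a s h K u b
      have h' := L.isFrame.inf_join f a s (constAt U I) h
      simp only [equalizer.lift_ι]
      have e : u ≫ s ≫ L.opens.inf (𝟙 _) (constAt U _) = u ≫ L.opens.inf (constAt U I) s := by
        rw [comp_infU, L.opens.inf_comm]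
      rw [e, h' u]
      refine forall_congr' fun T => forall_congr' fun p => forall_congr' fun q =>
        imp_congr_right fun _ => ?_
      rw [comp_infU, L.opens.inf_comm, comp_constAt])

end OpenClosed


section TruthValues

open HasSubobjectClassifier MonoidalClosed

variable [HasSubobjectClassifier E]

/-- The constant truth value "true" at stage `I`. -/
noncomputable def tr (I : E) : I ⟶ Ω E := Subobject.Classifier.χ₀ _ I ≫ truth E

lemma comp_tr {I J : E} (u : J ⟶ I) : u ≫ tr I = tr J := by
  unfold tr
  rw [← Category.assoc]
  congr 1
  exact Subsingleton.elim _ _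

variable [HasFiniteLimits E]

/-- The truth value of `a = b`. -/
noncomputable def eqv {I X : E} (a b : I ⟶ X) : I ⟶ Ω E := χ (equalizer.ι a b)

lemma comp_χ_eq_tr {I J K : E} (m : J ⟶ I) [Mono m] (v : K ⟶ I) :
    v ≫ χ m = tr K ↔ ∃ w : K ⟶ J, w ≫ m = v := by
  constructor
  · intro h
    exact ⟨(isPullback_χ m).lift v (Subobject.Classifier.χ₀ _ K) h, (isPullback_χ m).lift_fst _ _ _⟩
  · rintro ⟨w, rfl⟩
    rw [Category.assoc, comm m, ← Category.assoc]
    unfold tr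
    congr 1
    exact Subsingleton.elim _ _

lemma comp_eqv {I X K : E} (a b : I ⟶ X) (v : K ⟶ I) :
    v ≫ eqv a b = tr K ↔ v ≫ a = v ≫ b := by
  unfold eqv
  rw [comp_χ_eq_tr]
  constructor
  · rintro ⟨w, rfl⟩
    rw [Category.assoc, Category.assoc, equalizer.condition]
  · intro h
    exact ⟨equalizer.lift v h, equalizer.lift_ι _ _⟩

lemma truth_ext {I : E} {s t : I ⟶ Ω E}
    (h : ∀ ⦃K : E⦄ (v : K ⟶ I), v ≫ s = tr K ↔ v ≫ t = tr K) : s = t := by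
  obtain ⟨Z, i, hi, rfl⟩ := Subobject.Classifier.surjective_χ _ s
  obtain ⟨Z', j, hj, rfl⟩ := Subobject.Classifier.surjective_χ _ t
  change χ i = χ j
  have h1 : ∃ w, w ≫ j = i := (comp_χ_eq_tr j i).1 ((h i).1 ((comp_χ_eq_tr i i).2 ⟨𝟙 _, by simp⟩))
  have h2 : ∃ w, w ≫ i = j := (comp_χ_eq_tr i j).1 ((h j).2 ((comp_χ_eq_tr j j).2 ⟨𝟙 _, by simp⟩))
  obtain ⟨w, hw⟩ := h1
  obtain ⟨w', hw'⟩ := h2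
  have e1 : w ≫ w' = 𝟙 _ := by rw [← cancel_mono i, Category.assoc, hw', hw, Category.id_comp]
  have e2 : w' ≫ w = 𝟙 _ := by rw [← cancel_mono j, Category.assoc, hw, hw', Category.id_comp]
  symm
  refine HasSubobjectClassifier.unique i (χ j) ?_
  refine (isPullback_χ j).of_iso ⟨w', w, e2, e1⟩ (Iso.refl _) (Iso.refl _) (Iso.refl _) ?_ ?_ ?_ ?_
  · simp [hw']
  · exact Subsingleton.elim _ _
  · simp
  · simp

/-- The logical connectives on truth values, in the standard encoding by equality. -/
noncomputable def tAnd {I : E} (s t : I ⟶ Ω E) : I ⟶ Ω E := eqv (lift s t) (lift (tr I) (tr I))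

noncomputable def tImp {I : E} (s t : I ⟶ Ω E) : I ⟶ Ω E := eqv (tAnd s t) s

/-- `tAll t` is the truth value of `∀ x : X, t (x, i)`. -/
noncomputable def tAll [MonoidalClosed E] {X I : E} (t : X ⊗ I ⟶ Ω E) : I ⟶ Ω E :=
  eqv (curry t) (curry (tr _))

lemma comp_tAnd {I K : E} (s t : I ⟶ Ω E) (v : K ⟶ I) :
    v ≫ tAnd s t = tr K ↔ v ≫ s = tr K ∧ v ≫ t = tr K := by
  unfold tAnd
  rw [comp_eqv, comp_lift, comp_lift, comp_tr]
  constructor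
  · intro h
    have h1 := congrArg (fun z => z ≫ fst _ _) h
    have h2 := congrArg (fun z => z ≫ snd _ _) h
    simp only [lift_fst] at h1
    simp only [lift_snd] at h2
    exact ⟨h1, h2⟩
  · rintro ⟨h1, h2⟩
    rw [h1, h2]

lemma comp_tImp {I K : E} (s t : I ⟶ Ω E) (v : K ⟶ I) :
    v ≫ tImp s t = tr K ↔
      ∀ ⦃T : E⦄ (w : T ⟶ K), w ≫ v ≫ s = tr T → w ≫ v ≫ t = tr T := by
  unfold tImp
  rw [comp_eqv]
  constructor
  · intro h T w hs
    have h1 : (w ≫ v) ≫ tAnd s t = tr T := by rw [Category.assoc, h, hs]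
    have h2 := ((comp_tAnd s t (w ≫ v)).1 h1).2
    rwa [Category.assoc] at h2
  · intro h
    apply truth_ext
    intro T w
    rw [← Category.assoc, comp_tAnd, Category.assoc, Category.assoc]
    exact ⟨fun k => k.1, fun k => ⟨k, h w k⟩⟩

/-- The order on truth values. -/
def tLe {I : E} (s t : I ⟶ Ω E) : Prop := ∀ ⦃K : E⦄ (v : K ⟶ I), v ≫ s = tr K → v ≫ t = tr K

lemma tAnd_le_iff {I : E} (s t c : I ⟶ Ω E) : tLe (tAnd s t) c ↔ tLe s (tImp t c) := by
  constructor
  · intro h K v hv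
    rw [comp_tImp]
    intro T w hw
    rw [← Category.assoc]
    apply h
    rw [comp_tAnd, Category.assoc, hv, comp_tr]
    exact ⟨rfl, by rw [Category.assoc, hw]⟩
  · intro h K v hv
    rw [comp_tAnd] at hv
    have := (comp_tImp _ _ _).1 (h v hv.1) (𝟙 K) (by rw [Category.id_comp]; exact hv.2)
    rwa [Category.id_comp] at this

lemma comp_tAnd' {I J : E} (u : J ⟶ I) (s t : I ⟶ Ω E) :
    u ≫ tAnd s t = tAnd (u ≫ s) (u ≫ t) := by
  apply truth_ext
  intro K v
  rw [← Category.assoc, comp_tAnd, comp_tAnd, Category.assoc, Category.assoc]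

lemma comp_tImp' {I J : E} (u : J ⟶ I) (s t : I ⟶ Ω E) :
    u ≫ tImp s t = tImp (u ≫ s) (u ≫ t) := by
  apply truth_ext
  intro K v
  rw [← Category.assoc, comp_tImp, comp_tImp]
  simp only [Category.assoc]

variable [MonoidalClosed E]

lemma comp_tAll {X I K : E} (t : X ⊗ I ⟶ Ω E) (v : K ⟶ I) :
    v ≫ tAll t = tr K ↔ ∀ ⦃T : E⦄ (w : T ⟶ K) (x : T ⟶ X), lift x (w ≫ v) ≫ t = tr T := by
  unfold tAll
  rw [comp_eqv, ← curry_natural_left, ← curry_natural_left, curry_injective.eq_iff, comp_tr]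
  constructor
  · intro h T w x
    have e : lift x (w ≫ v) = lift x w ≫ X ◁ v := by simp
    rw [e, Category.assoc, h, comp_tr]
  · intro h
    apply truth_ext
    intro T z
    have e : z ≫ X ◁ v = lift (z ≫ fst _ _) ((z ≫ snd _ _) ≫ v) := by
      ext <;> simp
    rw [← Category.assoc, e, h, comp_tr]

/-- `tBot` is the truth value of `∀ ω, ω`. -/
noncomputable def tBot (I : E) : I ⟶ Ω E := tAll (fst (Ω E) I)

/-- `tOr s t` is the truth value of `∀ ω, ((s ⇒ ω) ∧ (t ⇒ ω)) ⇒ ω`. -/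
noncomputable def tOr {I : E} (s t : I ⟶ Ω E) : I ⟶ Ω E :=
  tAll (tImp (tAnd (tImp (snd (Ω E) I ≫ s) (fst _ _)) (tImp (snd (Ω E) I ≫ t) (fst _ _))) (fst _ _))

/-- `tEx f t` is the truth value, at `i : I`, of `∃ j : J, f j = i ∧ t j`, encoded as
`∀ ω, (∀ j, (f j = i ∧ t j) ⇒ ω) ⇒ ω`. -/
noncomputable def tEx {I J : E} (f : J ⟶ I) (t : J ⟶ Ω E) : I ⟶ Ω E :=
  tAll (tImp
    (tAll (X := J) (I := Ω E ⊗ I)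
      (tImp (tAnd (eqv (fst _ _ ≫ f) (snd _ _ ≫ snd _ _)) (fst _ _ ≫ t)) (snd _ _ ≫ fst _ _)))
    (fst (Ω E) I))

lemma tBot_le {I : E} (t : I ⟶ Ω E) : tLe (tBot I) t := by
  intro K v h
  have := (comp_tAll _ v).1 h (𝟙 K) (v ≫ t)
  simpa using this

lemma tOr_le_iff {I : E} (s t c : I ⟶ Ω E) : tLe (tOr s t) c ↔ tLe s c ∧ tLe t c := by
  constructor
  · intro h
    refine ⟨fun K v hv => h v ?_, fun K v hv => h v ?_⟩
    all_goals
      refine (comp_tAll _ v).2 fun T w x => (comp_tImp _ _ _).2 fun S y hy => ?_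
      rw [← Category.assoc, comp_tAnd] at hy
    · have := (comp_tImp _ _ _).1 hy.1 (𝟙 _) (by
        simp only [Category.assoc, lift_snd_assoc, hv, comp_tr])
      simpa using this
    · have := (comp_tImp _ _ _).1 hy.2 (𝟙 _) (by
        simp only [Category.assoc, lift_snd_assoc, hv, comp_tr])
      simpa using this
  · rintro ⟨hs, ht⟩ K v h
    have h1 := (comp_tAll _ v).1 h (𝟙 K) (v ≫ c)
    rw [comp_tImp] at h1
    have h2 := h1 (𝟙 K) (by
      rw [Category.id_comp, comp_tAnd, comp_tImp, comp_tImp]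
      refine ⟨fun T w hw => ?_, fun T w hw => ?_⟩
      · have := hs (w ≫ v) (by simpa using hw)
        simpa using this
      · have := ht (w ≫ v) (by simpa using hw)
        simpa using this)
    simpa using h2

lemma comp_tEx_le_iff {I J K : E} (f : J ⟶ I) (t : J ⟶ Ω E) (u : K ⟶ I) (b : K ⟶ Ω E) :
    tLe (u ≫ tEx f t) b ↔
      ∀ ⦃T : E⦄ (p : T ⟶ K) (q : T ⟶ J), p ≫ u = q ≫ f → q ≫ t = tr T → p ≫ b = tr T := by
  constructor
  · intro h T p q hpq hq
    apply h
    rw [← Category.assoc]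
    refine (comp_tAll _ _).2 fun S w x => (comp_tImp _ _ _).2 fun R y hy => ?_
    have h1 := (comp_tAll _ _).1 (by rw [← Category.assoc] at hy; exact hy) (𝟙 R) (y ≫ w ≫ q)
    have h2 := (comp_tImp _ _ _).1 h1 (𝟙 R) (by
      rw [Category.id_comp, comp_tAnd, comp_eqv]
      constructor
      · simp [hpq]
      · simp [hq, comp_tr])
    simpa using h2
  · intro h S v hv
    rw [← Category.assoc] at hv
    have h1 := (comp_tAll _ _).1 hv (𝟙 S) (v ≫ b)
    have h2 := (comp_tImp _ _ _).1 h1 (𝟙 S) (by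
      rw [Category.id_comp, comp_tAll]
      intro T w x
      rw [comp_tImp]
      intro R y hy
      rw [← Category.assoc, comp_tAnd, comp_eqv] at hy
      have := h (y ≫ w ≫ v) (y ≫ x) (by simpa using hy.1.symm) (by simpa using hy.2)
      simpa using this)
    simpa using h2


lemma comp_tBot {I J : E} (u : J ⟶ I) : u ≫ tBot I = tBot J := by
  apply truth_ext
  intro K v
  unfold tBot
  rw [← Category.assoc, comp_tAll, comp_tAll]
  simp only [lift_fst]

lemma comp_tOr {I J : E} (u : J ⟶ I) (s t : I ⟶ Ω E) :
    u ≫ tOr s t = tOr (u ≫ s) (u ≫ t) := by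
  apply truth_ext
  intro K v
  unfold tOr
  rw [← Category.assoc, comp_tAll, comp_tAll]
  refine forall_congr' fun T => forall_congr' fun w => forall_congr' fun x => ?_
  rw [comp_tImp, comp_tImp]
  refine forall_congr' fun S => forall_congr' fun y => ?_
  rw [← Category.assoc y, ← Category.assoc y, ← Category.assoc y, ← Category.assoc y, comp_tAnd,
    comp_tAnd, comp_tImp, comp_tImp, comp_tImp, comp_tImp]
  simp only [Category.assoc, lift_snd_assoc, lift_fst]

end TruthValues


section DiscreteSpaces

open HasSubobjectClassifier MonoidalClosed

variable [HasFiniteLimits E] [HasSubobjectClassifier E] [MonoidalClosed E]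

/-- The truth values at stage `I`, as an external lattice. -/
def TruthValue (I : E) : Type v := I ⟶ Ω E

noncomputable instance (I : E) : DistribLattice (TruthValue I) :=
  letI _L : Lattice (TruthValue I) :=
    { le := fun s t => tLe (E := E) (I := I) s t
      le_refl := fun _ _ _ h => h
      le_trans := fun _ _ _ h k _ v hv => k v (h v hv)
      le_antisymm := fun _ _ h k => truth_ext fun _ v => ⟨h v, k v⟩
      sup := fun s t => tOr (E := E) (I := I) s t
      inf := fun s t => tAnd (E := E) (I := I) s t
      le_sup_left := fun s t => ((tOr_le_iff (E := E) (I := I) s t _).1 fun _ _ h => h).1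
      le_sup_right := fun s t => ((tOr_le_iff (E := E) (I := I) s t _).1 fun _ _ h => h).2
      sup_le := fun s t c hs ht => (tOr_le_iff (E := E) (I := I) s t c).2 ⟨hs, ht⟩
      inf_le_left := fun s t _ v h => ((comp_tAnd (E := E) (I := I) s t v).1 h).1
      inf_le_right := fun s t _ v h => ((comp_tAnd (E := E) (I := I) s t v).1 h).2
      le_inf := fun c s t hs ht _ v h =>
        (comp_tAnd (E := E) (I := I) s t v).2 ⟨hs v h, ht v h⟩ }
  DistribLattice.ofInfSupLe fun a b c => by
    have h1 : tLe (E := E) (I := I) (tOr b c)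
        (tImp a (tOr (tAnd a b) (tAnd a c))) := by
      have h0 := (tOr_le_iff (tAnd (E := E) (I := I) a b) (tAnd (E := E) (I := I) a c) _).1
        fun _ _ h => h
      refine (tOr_le_iff _ _ _).2 ⟨(tAnd_le_iff _ _ _).1 ?_, (tAnd_le_iff _ _ _).1 ?_⟩
      · intro K v h
        exact h0.1 v ((comp_tAnd _ _ v).2 ((comp_tAnd _ _ v).1 h).symm)
      · intro K v h
        exact h0.2 v ((comp_tAnd _ _ v).2 ((comp_tAnd _ _ v).1 h).symm)
    intro K v h
    exact (tAnd_le_iff _ _ _).2 h1 v ((comp_tAnd _ _ v).2 ((comp_tAnd _ _ v).1 h).symm)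

/-- The internal lattice of subsets of `X`: the power object `Ω ^ X`, whose generalized elements
`I ⟶ Ω ^ X` are the truth-valued maps `X ⊗ I ⟶ Ω`, with the pointwise connectives. -/
noncomputable def powerLattice (X : E) : InternalLattice E where
  obj := (ihom X).obj (Ω E)
  top I := curry (tr (X ⊗ I))
  bot I := curry (tBot (X ⊗ I))
  inf a b := curry (tAnd (uncurry a) (uncurry b))
  sup a b := curry (tOr (uncurry a) (uncurry b))
  comp_top u := by rw [← curry_natural_left, comp_tr]
  comp_bot u := by rw [← curry_natural_left, comp_tBot]
  comp_inf u a b := by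
    rw [← curry_natural_left, comp_tAnd', uncurry_natural_left, uncurry_natural_left]
  comp_sup u a b := by
    rw [← curry_natural_left, comp_tOr, uncurry_natural_left, uncurry_natural_left]
  inf_comm {I} a b := congrArg curry (_root_.inf_comm (α := TruthValue (X ⊗ I)) _ _)
  sup_comm {I} a b := congrArg curry (_root_.sup_comm (α := TruthValue (X ⊗ I)) _ _)
  inf_assoc {I} a b c := by
    simp only [uncurry_curry]
    exact congrArg curry (_root_.inf_assoc (α := TruthValue (X ⊗ I)) _ _ _)
  sup_assoc {I} a b c := by
    simp only [uncurry_curry]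
    exact congrArg curry (_root_.sup_assoc (α := TruthValue (X ⊗ I)) _ _ _)
  inf_sup_self {I} a b := by
    rw [uncurry_curry, curry_eq_iff]
    exact _root_.inf_sup_self (α := TruthValue (X ⊗ I))
  sup_inf_self {I} a b := by
    rw [uncurry_curry, curry_eq_iff]
    exact _root_.sup_inf_self (α := TruthValue (X ⊗ I))
  inf_sup_left {I} a b c := by
    simp only [uncurry_curry]
    exact congrArg curry (_root_.inf_sup_left (α := TruthValue (X ⊗ I)) _ _ _)
  inf_top {I} a := by
    rw [uncurry_curry, curry_eq_iff]
    refine _root_.inf_eq_left (α := TruthValue (X ⊗ I)).2 fun K v _ => comp_tr v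
  sup_bot {I} a := by
    rw [uncurry_curry, curry_eq_iff]
    exact _root_.sup_eq_left (α := TruthValue (X ⊗ I)).2 (tBot_le _)

lemma powerLattice_le_iff (X : E) {I : E} (a b : I ⟶ (ihom X).obj (Ω E)) :
    (powerLattice X).le a b ↔ tLe (uncurry a) (uncurry b) := by
  change curry (tAnd (uncurry a) (uncurry b)) = a ↔ _
  rw [curry_eq_iff]
  exact _root_.inf_eq_left (α := TruthValue (X ⊗ I))

lemma powerLattice_join_aux (X : E) {I J K : E} (f : J ⟶ I) (a : J ⟶ (ihom X).obj (Ω E))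
    (u : K ⟶ I) (b : K ⟶ (ihom X).obj (Ω E)) :
    tLe (uncurry (u ≫ curry (tEx (X ◁ f) (uncurry a)))) (uncurry b) ↔
      ∀ ⦃T : E⦄ (p : T ⟶ K) (q : T ⟶ J), p ≫ u = q ≫ f →
        tLe (uncurry (q ≫ a)) (uncurry (p ≫ b)) := by
  rw [uncurry_natural_left, uncurry_curry, comp_tEx_le_iff]
  constructor
  · intro h T p q hpq S v hv
    rw [uncurry_natural_left] at hv ⊢
    rw [← Category.assoc] at hv ⊢
    refine h _ _ ?_ hv
    simp only [Category.assoc, ← MonoidalCategory.whiskerLeft_comp, hpq]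
  · intro h T p q hpq hq
    have e1 : p ≫ fst _ _ = q ≫ fst _ _ := by
      have := congrArg (fun z => z ≫ fst _ _) hpq
      simpa using this
    have e2 : (p ≫ snd _ _) ≫ u = (q ≫ snd _ _) ≫ f := by
      have := congrArg (fun z => z ≫ snd _ _) hpq
      simpa using this
    have h1 := h _ _ e2 (lift (p ≫ fst _ _) (𝟙 T))
    rw [uncurry_natural_left, uncurry_natural_left, ← Category.assoc, ← Category.assoc] at h1
    have e3 : lift (p ≫ fst _ _) (𝟙 T) ≫ X ◁ (q ≫ snd _ _) = q := by
      ext <;> simp [e1]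
    have e4 : lift (p ≫ fst _ _) (𝟙 T) ≫ X ◁ (p ≫ snd _ _) = p := by
      ext <;> simp
    rw [e3, e4] at h1
    exact h1 hq

lemma powerLattice_isJoin (X : E) {I J : E} (f : J ⟶ I) (a : J ⟶ (ihom X).obj (Ω E)) :
    (powerLattice X).IsJoin f a (curry (tEx (X ◁ f) (uncurry a))) := by
  intro K u b
  refine (powerLattice_le_iff X _ _).trans ((powerLattice_join_aux X f a u b).trans ?_)
  exact forall_congr' fun T => forall_congr' fun p => forall_congr' fun q =>
    imp_congr_right fun _ => (powerLattice_le_iff X _ _).symm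

lemma powerLattice_imp_aux (X : E) {K T : E} (y z : K ⟶ (ihom X).obj (Ω E)) (p : T ⟶ K)
    (x : T ⟶ (ihom X).obj (Ω E)) :
    tLe (uncurry x) (uncurry (p ≫ curry (tImp (uncurry y) (uncurry z)))) ↔
      tLe (uncurry (curry (tAnd (uncurry x) (uncurry (p ≫ y))))) (uncurry (p ≫ z)) := by
  rw [uncurry_natural_left, uncurry_curry, uncurry_curry, tAnd_le_iff, comp_tImp',
    uncurry_natural_left, uncurry_natural_left]

lemma powerLattice_isFrame (X : E) : (powerLattice X).IsFrame where
  exists_join f a := ⟨_, powerLattice_isJoin X f a⟩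
  inf_join := (powerLattice X).inf_join_of_imp fun y z =>
    ⟨curry (tImp (uncurry y) (uncurry z)), fun p x =>
      (powerLattice_le_iff X _ _).trans
        ((powerLattice_imp_aux X y z p x).trans (powerLattice_le_iff X _ _).symm)⟩

/-- The discrete space on an object `X` of the base: its opens are the subsets of `X`. -/
noncomputable def discrete (X : E) : LocalicSpace E := ⟨powerLattice X, powerLattice_isFrame X⟩

/-- The open of the discrete space `X` given by a subobject `m : P ⟶ X`. -/
noncomputable def openOf {P X : E} (m : P ⟶ X) [Mono m] : 𝟙_ E ⟶ (discrete X).opens.obj :=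
  curry (fst X (𝟙_ E) ≫ χ m)

/-- Images exist in an elementary topos. -/
instance hasImages : HasImages E where
  has_image {J I} f := by
    have h0 := fun b => (comp_tEx_le_iff f (tr J) (𝟙 I) b)
    simp only [Category.id_comp, Category.comp_id] at h0
    have hfac : f ≫ tEx f (tr J) = tr J := by
      refine (h0 _).1 (fun _ _ h => h) f (𝟙 J) (by simp) ?_
      rw [comp_tr]
    let m : equalizer (tEx f (tr J)) (tr I) ⟶ I := equalizer.ι _ _
    let F : MonoFactorisation f :=
      { I := equalizer (tEx f (tr J)) (tr I)
        m := m
        m_mono := inferInstance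
        e := equalizer.lift f (by rw [hfac, comp_tr])
        fac := equalizer.lift_ι _ _ }
    have hlift : ∀ F' : MonoFactorisation f, ∃ w : F.I ⟶ F'.I, w ≫ F'.m = F.m := by
      intro F'
      have := F'.m_mono
      rw [← comp_χ_eq_tr]
      refine (h0 (χ F'.m)).2 (fun T p q hpq _ => ?_) _ ?_
      · rw [hpq, comp_χ_eq_tr]
        exact ⟨q ≫ F'.e, by rw [Category.assoc, F'.fac]⟩
      · change equalizer.ι _ _ ≫ _ = _
        rw [equalizer.condition, comp_tr]
    exact HasImage.mk ⟨F, ⟨fun F' => (hlift F').choose, fun F' => (hlift F').choose_spec⟩⟩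

end DiscreteSpaces


section Statement

open HasSubobjectClassifier MonoidalClosed

variable [HasFiniteLimits E] [HasSubobjectClassifier E] [MonoidalClosed E]

/-- The empty space is the discrete space on an initial object of the base. -/
theorem discrete_initial {Z : E} (hZ : IsInitial Z) : Nonempty (discrete Z ≅ emptySpace E) := by
  have hom_eq : ∀ {I : E} (s t : I ⟶ (discrete Z).opens.obj), s = t := by
    intro I s t
    refine (uncurry_injective (A := Z) (X := Ω E)) (truth_ext fun K v => ?_)
    have e : v = (v ≫ fst Z I) ≫ hZ.to _ := by
      rw [Category.assoc]
      have h : ∀ (x : K ⟶ Z) {Y : E} (y y' : K ⟶ Y), y = y' := by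
        intro x Y y y'
        have h1 : ∀ w w' : K ⊗ Z ⟶ Y, w = w' := by
          have hi : IsInitial (K ⊗ Z) := hZ.ofIso (zeroMul hZ).symm
          exact fun w w' => hi.hom_ext w w'
        have h2 := congrArg (fun w => lift (𝟙 K) x ≫ w) (h1 (fst _ _ ≫ y) (fst _ _ ≫ y'))
        simpa using h2
      exact h (v ≫ fst Z I) _ _
    rw [e, Category.assoc, Category.assoc, Category.assoc, Category.assoc]
    have e2 : ∀ w w' : Z ⟶ Ω E, w = w' := fun w w' => hZ.hom_ext w w'
    rw [e2 (hZ.to _ ≫ uncurry s) (hZ.to _ ≫ uncurry t)]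
  refine ⟨⟨⟨⟨(discrete Z).opens.top (𝟙_ E), fun _ => hom_eq _ _, fun _ => hom_eq _ _,
    fun _ _ => hom_eq _ _, fun _ _ => hom_eq _ _⟩, ?_⟩, emptySpaceIsInitial.to _, ?_, ?_⟩⟩
  · intro I J f a s _ K u b
    have h : ∀ {T : E} (x y : T ⟶ (discrete Z).opens.obj), (discrete Z).opens.le x y := by
      intro T x y
      rw [hom_eq x y]
      exact (discrete Z).opens.le_refl y
    exact ⟨fun _ _ _ _ _ => h _ _, fun _ => h _ _⟩
  · apply LocalicSpace.Map.ext
    apply InternalLattice.Hom.ext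
    exact hom_eq _ _
  · exact emptySpaceIsInitial.hom_ext _ _

/-- The one-point space `1`, the discrete space on the terminal object. -/
noncomputable abbrev point (E : Type u) [Category.{v} E] [CartesianMonoidalCategory E]
    [HasFiniteLimits E] [HasSubobjectClassifier E] [MonoidalClosed E] : LocalicSpace E :=
  discrete (𝟙_ E)

/-- The image of `X` in `1`, as a truth value (a subobject of `1`). -/
noncomputable abbrev support (X : E) : E := image (toUnit X)

instance (X : E) : Mono (toUnit (support X)) := by
  rw [toUnit_unique (toUnit (support X)) (image.ι (toUnit X))]
  infer_instance

/-- The open subspace of `1` given by a truth value `φ`. -/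
noncomputable def openOfTruth (φ : E) [Mono (toUnit φ)] : Subspace (point E) :=
  openSubspace (point E) (openOf (toUnit φ))

/-- The closed complement in `1` of the open subspace given by a truth value `φ`. -/
noncomputable def closedOfTruth (φ : E) [Mono (toUnit φ)] : Subspace (point E) :=
  closedSubspace (point E) (openOf (toUnit φ))

/-- `B` is the internal Boolean algebra freely generated by no generators, subject to one relation
`1 ≤ 0` for each `x : X` (imposed on the generic element of `X`). -/
structure IsFreeOnRelations (X : E) (B : InternalLattice E) : Prop where
  isBoolean : B.IsBoolean
  rel : B.le (B.top X) (B.bot X)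
  existsUnique_hom : ∀ C : InternalLattice E, C.IsBoolean → C.le (C.top X) (C.bot X) →
    ∃! _h : InternalLattice.Hom B C, True

/-- For a subobject `φ` of `1`: `B` is the quotient of the Boolean algebra `2 = {0, 1}` by the
congruence `{(0, 0), (1, 1)} ∪ φ × {(0, 1), (1, 0)}`. That is, the elements `0` and `1` of `B` are
jointly epimorphic, so that `2 = 1 + 1 ⟶ B` is epimorphic, and `0 = 1` holds in `B` at a stage
precisely if `φ` does. -/
structure IsQuotientOfTwo (φ : E) (B : InternalLattice E) : Prop where
  jointly_epi : ∀ {Z : E} (g h : B.obj ⟶ Z), B.bot (𝟙_ E) ≫ g = B.bot (𝟙_ E) ≫ h →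
    B.top (𝟙_ E) ≫ g = B.top (𝟙_ E) ≫ h → g = h
  bot_eq_top_iff : ∀ I : E, B.bot I = B.top I ↔ Nonempty (I ⟶ φ)

end Statement

end Topos

end PointFree

open PointFree

/-! A space has at most one map to the empty space `0`, and it has one only if `0 = 1` in its frame.
So `0 ^ X` carries no data beyond a condition: it is a space `Z` such that `W` maps to `Z`, and then
uniquely, precisely if every space over both `W` and `X` is trivial
(`isExponential_emptySpace_iff`).

Such conditions are compared through truth values. The frame of `1` is initial among frames, because
every truth value is the join of "true" over its proofs. Hence each truth value `φ` gives one open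
`truthOpen W φ` in each space `W`. The space `W` maps to the open subspace `φ` of `1` iff this open
is `⊤`, and to the closed complement iff it is `⊥`, that is, iff `0 = 1` in the frame of `W` at
stage `φ`.

For discrete `X`, the functions from `X` to the opens of `W` form the frame of a space over `W` and
`X`. If it is trivial, then `0 = 1` in the frame of `W` at stage `X`; since the stages where `0 = 1`
are those over a subobject of `1`, this also holds at the image `φ` of `X`. Thus `0 ^ X` is the
closed complement of `φ` (`isExponential_discrete`). If the product of `W` with this complement is
trivial, then so is the closed complement of `φ` in `W`, which maps to both; hence `φ` is `⊤` in
`W`, and the second exponential is `φ` (`isExponential_closedOfTruth`).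

For `Spec A`, the ideals of `A` with values in the opens of `W` form the frame of a space over `W`
and `Spec A`. If it is trivial, the principal ideal of `0` has value `⊤` at `1`; this value is the
truth value of `1 ≤ 0` in `A`, so `0 = 1` in `A` holds over `W` (`isExponential_spec`).

The Boolean algebra `B` consists of the elements of the frame of the closed complement that are
covered by the cases `0` and `1`. Maps out of `B` are defined by cases on `0` and `1`, as functional
relations, which are graphs because a topos is balanced. Finally, open and closed subspaces are
complementary because in a distributive lattice an element `a` is determined by `a ⊓ U` and `a ⊔ U`.
-/

namespace PointFree

/-! ### Order calculus of internal lattices, maps of spaces and subspaces -/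

section Lattices

variable {E : Type u} [Category.{v} E]

namespace InternalLattice

variable {A B : InternalLattice E}

/-- The Yoneda lemma for posets. It reduces preservation of joins to adjunctions. -/
lemma eq_of_forall_le_iff {I : E} {a b : I ⟶ A.obj} (h : ∀ c : I ⟶ A.obj, A.le a c ↔ A.le b c) :
    a = b :=
  ((h b).2 (A.le_refl b)).antisymm ((h a).1 (A.le_refl a))

lemma eq_of_forall_le_iff' {I : E} {a b : I ⟶ A.obj} (h : ∀ c : I ⟶ A.obj, A.le c a ↔ A.le c b) :
    a = b :=
  ((h a).1 (A.le_refl a)).antisymm ((h b).2 (A.le_refl b))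

lemma top_le_iff_eq {I : E} {a : I ⟶ A.obj} : A.le (A.top I) a ↔ a = A.top I :=
  ⟨fun h => (le_top a).antisymm h, fun h => h ▸ A.le_refl _⟩

lemma le_bot_iff_eq {I : E} {a : I ⟶ A.obj} : A.le a (A.bot I) ↔ a = A.bot I :=
  ⟨fun h => h.antisymm (bot_le a), fun h => h ▸ A.le_refl _⟩

lemma sup_top {I : E} (a : I ⟶ A.obj) : A.sup a (A.top I) = A.top I :=
  top_le_iff_eq.1 (join_le_iff.1 (A.le_refl _)).2

lemma inf_bot {I : E} (a : I ⟶ A.obj) : A.inf a (A.bot I) = A.bot I :=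
  le_bot_iff_eq.1 (le_meet_iff.1 (A.le_refl _)).2

lemma inf_self {I : E} (a : I ⟶ A.obj) : A.inf a a = a := A.le_refl a

lemma sup_self {I : E} (a : I ⟶ A.obj) : A.sup a a = a := sup_eq_iff_le.2 (A.le_refl a)

lemma sup_inf_left {I : E} (a b c : I ⟶ A.obj) :
    A.sup a (A.inf b c) = A.inf (A.sup a b) (A.sup a c) :=
  _root_.sup_inf_left (α := A.El I) a b c

/-- Cancellation in distributive lattices, the algebraic content of the excluded middle for
subspaces. -/
lemma eq_of_inf_eq_of_sup_eq {I : E} {a b c : I ⟶ A.obj} (h : A.inf a c = A.inf b c)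
    (k : A.sup a c = A.sup b c) : a = b :=
  _root_.eq_of_inf_eq_sup_eq (α := A.El I) h k

lemma le_of_bot_eq_top {I : E} (h : A.bot I = A.top I) (a b : I ⟶ A.obj) : A.le a b :=
  (le_top a).trans (h ▸ bot_le b)

lemma bot_eq_top_comp {I J : E} (h : A.bot I = A.top I) (u : J ⟶ I) : A.bot J = A.top J := by
  rw [← A.comp_bot u, h, A.comp_top]

/-- Over the stage `I` itself, all members of the family are instances of the generic member, which
lives at stage `J`. -/
lemma IsJoin.le_iff {I J : E} {f : J ⟶ I} {a : J ⟶ A.obj} {s : I ⟶ A.obj} (h : A.IsJoin f a s)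
    (b : I ⟶ A.obj) : A.le s b ↔ A.le a (f ≫ b) := by
  have h1 := h (𝟙 I) b
  rw [Category.id_comp] at h1
  rw [h1]
  constructor
  · intro h
    simpa using h f (𝟙 J) (by simp)
  · intro h T p q hpq
    rw [Category.comp_id] at hpq
    rw [hpq, Category.assoc]
    exact h.comp q

/-- A lattice homomorphism which is an isomorphism has an inverse homomorphism. -/
def Hom.inverse (h : Hom A B) (n : B.obj ⟶ A.obj) (h1 : h.map ≫ n = 𝟙 _) (h2 : n ≫ h.map = 𝟙 _) :
    Hom B A where
  map := n
  top_map I := by rw [← h.top_map, Category.assoc, h1, Category.comp_id]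
  bot_map I := by rw [← h.bot_map, Category.assoc, h1, Category.comp_id]
  inf_map {I} a b := by
    have e : B.inf a b = A.inf (a ≫ n) (b ≫ n) ≫ h.map := by
      rw [h.inf_map, Category.assoc, Category.assoc, h2, Category.comp_id, Category.comp_id]
    rw [e, Category.assoc, h1, Category.comp_id]
  sup_map {I} a b := by
    have e : B.sup a b = A.sup (a ≫ n) (b ≫ n) ≫ h.map := by
      rw [h.sup_map, Category.assoc, Category.assoc, h2, Category.comp_id, Category.comp_id]
    rw [e, Category.assoc, h1, Category.comp_id]

end InternalLattice

open InternalLattice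

namespace LocalicSpace

variable {X Y Z : LocalicSpace E}

lemma hom_ext {f g : X ⟶ Y} (h : f.inv.map = g.inv.map) : f = g :=
  LocalicSpace.Map.ext (InternalLattice.Hom.ext h)

lemma comp_inv (f : X ⟶ Y) (g : Y ⟶ Z) : (f ≫ g).inv.map = g.inv.map ≫ f.inv.map := rfl

/-- A map of spaces, from an inverse image morphism that preserves finite meets and has a right
adjoint in the sense of generalized elements. -/
def Map.ofAdjoint (m : Y.opens.obj ⟶ X.opens.obj) (htop : ∀ I, Y.opens.top I ≫ m = X.opens.top I)
    (hinf : ∀ {I : E} (a b : I ⟶ Y.opens.obj),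
      Y.opens.inf a b ≫ m = X.opens.inf (a ≫ m) (b ≫ m))
    (hm : ∀ {I : E} (b : I ⟶ X.opens.obj), ∃ r : I ⟶ Y.opens.obj,
      ∀ ⦃K : E⦄ (u : K ⟶ I) (a : K ⟶ Y.opens.obj),
        X.opens.le (a ≫ m) (u ≫ b) ↔ Y.opens.le a (u ≫ r)) : X ⟶ Y where
  inv :=
    { map := m
      top_map := htop
      bot_map := fun I => by
        obtain ⟨r, hr⟩ := hm (X.opens.bot I)
        have := (hr (𝟙 I) (Y.opens.bot I)).2 (bot_le _)
        rwa [Category.id_comp, le_bot_iff_eq] at this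
      inf_map := hinf
      sup_map := fun {I} a b => eq_of_forall_le_iff fun c => by
        obtain ⟨r, hr⟩ := hm c
        have h := hr (𝟙 I)
        rw [Category.id_comp, Category.id_comp] at h
        rw [join_le_iff, h, h, h, join_le_iff] }
  map_join {I J} f a s h := by
    intro K u b
    obtain ⟨r, hr⟩ := hm b
    have h1 := hr (𝟙 K) (u ≫ s)
    rw [Category.id_comp, Category.id_comp] at h1
    rw [← Category.assoc, h1, h]
    refine forall_congr' fun T => forall_congr' fun p => forall_congr' fun q =>
      imp_congr_right fun _ => ?_
    rw [← Category.assoc, hr]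

/-- The inverse of a map whose inverse image morphism is an isomorphism. -/
def inverse (f : X ⟶ Y) (n : X.opens.obj ⟶ Y.opens.obj) (h1 : f.inv.map ≫ n = 𝟙 _)
    (h2 : n ≫ f.inv.map = 𝟙 _) : Y ⟶ X where
  inv := f.inv.inverse n h1 h2
  map_join {I J} k a s h := by
    -- The join exists in the frame of `Y`, and its image under `f` is again a join; uniqueness of
    -- joins identifies it with `s`.
    obtain ⟨s', hs'⟩ := Y.isFrame.exists_join k (a ≫ n)
    have h3 := f.map_join _ _ _ hs'
    have e1 : (a ≫ n) ≫ f.inv.map = a := by rw [Category.assoc, h2, Category.comp_id]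
    have e2 : s = s' ≫ f.inv.map := h.unique (h3.congr e1 rfl)
    refine hs'.congr rfl ?_
    change s' = s ≫ n
    rw [e2, Category.assoc, h1, Category.comp_id]

lemma inverse_comp (f : X ⟶ Y) (n : X.opens.obj ⟶ Y.opens.obj) (h1 : f.inv.map ≫ n = 𝟙 _)
    (h2 : n ≫ f.inv.map = 𝟙 _) : inverse f n h1 h2 ≫ f = 𝟙 Y := hom_ext h1

lemma comp_inverse (f : X ⟶ Y) (n : X.opens.obj ⟶ Y.opens.obj) (h1 : f.inv.map ≫ n = 𝟙 _)
    (h2 : n ≫ f.inv.map = 𝟙 _) : f ≫ inverse f n h1 h2 = 𝟙 X := hom_ext h2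

/-- A space is trivial if its frame has one element. -/
def IsTrivial (X : LocalicSpace E) : Prop := ∀ I : E, X.opens.bot I = X.opens.top I

end LocalicSpace

lemma Subspace.mono_incl {L : LocalicSpace E} (S : Subspace L) {W : LocalicSpace E}
    {k l : W ⟶ S.space} (h : k ≫ S.incl = l ≫ S.incl) : k = l := by
  have := S.epi
  apply LocalicSpace.hom_ext
  rw [← cancel_epi S.incl.inv.map]
  exact congrArg (fun g => (LocalicSpace.Map.inv g).map) h

section OfRetract

variable {L : LocalicSpace E} {Q : E} {ι : Q ⟶ L.opens.obj} {r : L.opens.obj ⟶ Q}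
    {hr : ι ≫ r = 𝟙 Q}
    {hinf : ∀ {I : E} (a b : I ⟶ L.opens.obj),
      L.opens.inf a b ≫ r ≫ ι = L.opens.inf (a ≫ r ≫ ι) (b ≫ r ≫ ι)}
    {hsup : ∀ {I : E} (a b : I ⟶ L.opens.obj),
      L.opens.sup a b ≫ r ≫ ι = L.opens.sup (a ≫ r ≫ ι) (b ≫ r ≫ ι)}
    {hj : L.opens.PreservesJoins ι r}

/-- Maps into the subspace given by a retract of the frame of opens. -/
lemma Subspace.ofRetract_lift {W : LocalicSpace E} (g : W ⟶ L)
    (hg : r ≫ ι ≫ g.inv.map = g.inv.map) :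
    ∃ k : W ⟶ (Subspace.ofRetract L ι r hr hinf hsup hj).space,
      k ≫ (Subspace.ofRetract L ι r hr hinf hsup hj).incl = g := by
  let R := L.opens.retract ι r hr hinf hsup
  have h4 : ∀ {I J : E} (f : J ⟶ I) (a : J ⟶ Q) (s : I ⟶ Q), R.IsJoin f a s →
      W.opens.IsJoin f (a ≫ ι ≫ g.inv.map) (s ≫ ι ≫ g.inv.map) := by
    intro I J f a s h
    obtain ⟨s', h0, h1⟩ := retract_exists_join (hr := hr) (hinf := hinf) (hsup := hsup)
      L.isFrame hj f a
    have h2 : s = s' ≫ r := h.unique h1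
    refine (g.map_join f _ _ h0).congr (Category.assoc _ _ _) ?_
    rw [h2, Category.assoc, hg]
  refine ⟨⟨⟨ι ≫ g.inv.map, fun I => ?_, fun I => ?_, fun {I} a b => ?_, fun {I} a b => ?_⟩,
    h4⟩, LocalicSpace.hom_ext hg⟩
  · exact (Category.assoc _ _ _).trans ((congrArg _ hg).trans (g.inv.top_map I))
  · exact (Category.assoc _ _ _).trans ((congrArg _ hg).trans (g.inv.bot_map I))
  · refine (Category.assoc _ _ _).trans ((congrArg _ hg).trans ((g.inv.inf_map _ _).trans ?_))
    exact congrArg₂ _ (Category.assoc _ _ _) (Category.assoc _ _ _)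
  · refine (Category.assoc _ _ _).trans ((congrArg _ hg).trans ((g.inv.sup_map _ _).trans ?_))
    exact congrArg₂ _ (Category.assoc _ _ _) (Category.assoc _ _ _)

lemma Subspace.ofRetract_incl_eq_iff {I : E} (a b : I ⟶ L.opens.obj) :
    a ≫ (Subspace.ofRetract L ι r hr hinf hsup hj).incl.inv.map =
        b ≫ (Subspace.ofRetract L ι r hr hinf hsup hj).incl.inv.map ↔
      a ≫ r ≫ ι = b ≫ r ≫ ι := by
  change a ≫ r = b ≫ r ↔ _
  refine ⟨fun h => by rw [← Category.assoc, h, Category.assoc], fun h => ?_⟩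
  have e : ∀ c : I ⟶ L.opens.obj, c ≫ r = (c ≫ r ≫ ι) ≫ r := fun c => by simp [hr]
  rw [e a, h, ← e]

end OfRetract

end Lattices

/-! ### Trivial spaces and exponentials of the empty space -/

section Cartesian

open InternalLattice

variable {E : Type u} [Category.{v} E] [CartesianMonoidalCategory E]

/-- The single element of the one-element frame is its top, whose image is prescribed. -/
instance (T : LocalicSpace E) : Subsingleton (T ⟶ emptySpace E) where
  allEq f g := by
    apply LocalicSpace.hom_ext
    have h : ∀ f : T ⟶ emptySpace E, f.inv.map = T.opens.top (𝟙_ E) := fun f => by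
      rw [← f.inv.top_map]
      exact (Category.id_comp _).symm.trans (congrArg (· ≫ f.inv.map) (toUnit_unique _ _))
    rw [h f, h g]

lemma isTrivial_of_hom_emptySpace {T : LocalicSpace E} (f : T ⟶ emptySpace E) : T.IsTrivial :=
  fun I => by rw [← f.inv.top_map, ← f.inv.bot_map]; rfl

lemma LocalicSpace.isTrivial_of_bot_eq_top {T : LocalicSpace E}
    (h : T.opens.bot (𝟙_ E) = T.opens.top (𝟙_ E)) : T.IsTrivial :=
  fun I => bot_eq_top_comp h (toUnit I)

/-- The map from a trivial space to the empty space. -/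
def LocalicSpace.IsTrivial.toEmpty {T : LocalicSpace E} (h : T.IsTrivial) : T ⟶ emptySpace E where
  inv :=
    { map := T.opens.top (𝟙_ E)
      top_map := fun _ => T.opens.comp_top _
      bot_map := fun I => (T.opens.comp_top _).trans (h I).symm
      inf_map := fun _ _ => (le_of_bot_eq_top (h _) _ _).antisymm (le_of_bot_eq_top (h _) _ _)
      sup_map := fun _ _ => (le_of_bot_eq_top (h _) _ _).antisymm (le_of_bot_eq_top (h _) _ _) }
  map_join _ _ _ _ _ _ _ :=
    ⟨fun _ _ _ _ _ => le_of_bot_eq_top (h _) _ _, fun _ => le_of_bot_eq_top (h _) _ _⟩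

/-- The exponential `0 ^ X` classifies the spaces whose product with `X` is trivial. -/
lemma isExponential_emptySpace_iff (X Z : LocalicSpace E) :
    IsExponential X (emptySpace E) Z ↔
      (∀ T : LocalicSpace E, (T ⟶ Z) → (T ⟶ X) → T.IsTrivial) ∧
      ∀ W : LocalicSpace E,
        (∀ T : LocalicSpace E, (T ⟶ W) → (T ⟶ X) → T.IsTrivial) → ∃! _h : W ⟶ Z, True := by
  constructor
  · rintro ⟨ev, hev⟩
    refine ⟨fun T z x => isTrivial_of_hom_emptySpace (ev.app z x), fun W hW => ?_⟩
    obtain ⟨h, -, hu⟩ := hev W ⟨fun T w x => (hW T w x).toEmpty, fun _ _ _ _ _ =>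
      Subsingleton.elim _ _⟩
    exact ⟨h, trivial, fun k _ => hu k fun _ _ _ => Subsingleton.elim _ _⟩
  · rintro ⟨h1, h2⟩
    refine ⟨⟨fun T z x => (h1 T z x).toEmpty, fun _ _ _ _ _ => Subsingleton.elim _ _⟩,
      fun W g => ?_⟩
    obtain ⟨h, -, hu⟩ := h2 W fun T w x => isTrivial_of_hom_emptySpace (g.app w x)
    exact ⟨h, fun _ _ _ => Subsingleton.elim _ _, fun k _ => hu k trivial⟩

/-- The exponentials `0 ^ X` and `0 ^ Y` are isomorphic if there are maps between `X` and `Y`. -/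
lemma IsExponential.iso_of_hom {X Y Z Z' : LocalicSpace E} (f : X ⟶ Y) (g : Y ⟶ X)
    (h : IsExponential X (emptySpace E) Z) (h' : IsExponential Y (emptySpace E) Z') :
    Nonempty (Z ≅ Z') := by
  rw [isExponential_emptySpace_iff] at h h'
  have t : ∀ T : LocalicSpace E, (T ⟶ Z) → (T ⟶ Y) → T.IsTrivial := fun T z y => h.1 T z (y ≫ g)
  have t' : ∀ T : LocalicSpace E, (T ⟶ Z') → (T ⟶ X) → T.IsTrivial :=
    fun T z x => h'.1 T z (x ≫ f)
  obtain ⟨k, -, -⟩ := h'.2 Z t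
  obtain ⟨l, -, -⟩ := h.2 Z' t'
  exact ⟨⟨k, l, (h.2 Z h.1).unique trivial trivial, (h'.2 Z' h'.1).unique trivial trivial⟩⟩

/-- Internal joins are stable under products with a fixed object. -/
lemma InternalLattice.IsJoin.whiskerLeft {A : InternalLattice E} {I J : E} {f : J ⟶ I}
    {a : J ⟶ A.obj} {s : I ⟶ A.obj} (h : A.IsJoin f a s) (X : E) :
    A.IsJoin (X ◁ f) (snd X J ≫ a) (snd X I ≫ s) := by
  intro K u b
  have h1 := h (u ≫ snd X I) b
  rw [Category.assoc] at h1
  rw [h1]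
  constructor
  · intro h T p q hpq
    rw [← Category.assoc q]
    exact h p (q ≫ snd X J) (by rw [← Category.assoc, hpq]; simp)
  · intro h T p q hpq
    have h2 := h p (lift (p ≫ u ≫ fst X I) q) (by ext <;> simp [hpq])
    rwa [lift_snd_assoc] at h2

/-- The stages where a lattice degenerates are those over a subobject of `1`. This is what allows
degeneracy at `X` to be transferred to the image of `X` in `1`. -/
lemma InternalLattice.bot_eq_top_iff_nonempty [HasEqualizers E] (A : InternalLattice E) (I : E) :
    A.bot I = A.top I ↔ Nonempty (I ⟶ equalizer (A.bot (𝟙_ E)) (A.top (𝟙_ E))) := by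
  constructor
  · intro h
    exact ⟨equalizer.lift (toUnit I) (by rw [A.comp_bot, A.comp_top, h])⟩
  · rintro ⟨w⟩
    rw [← A.comp_bot (w ≫ equalizer.ι _ _), Category.assoc, equalizer.condition,
      ← Category.assoc, A.comp_top]

instance [HasEqualizers E] {A : E} (f g : 𝟙_ E ⟶ A) : Mono (toUnit (equalizer f g)) := by
  rw [toUnit_unique (toUnit _) (equalizer.ι f g)]
  infer_instance

/-! ### Open subspaces and their closed complements -/

section OpenClosed

variable [HasEqualizers E] (L : LocalicSpace E) (U : 𝟙_ E ⟶ L.opens.obj)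

lemma closedRetract_aux : L.opens.sup (𝟙 _) (constAt U _) ≫ L.opens.sup (𝟙 _) (constAt U _) =
    L.opens.sup (𝟙 _) (constAt U _) ≫ 𝟙 _ := by
  rw [comp_supU, Category.comp_id]
  exact sup_eq_iff_le.2 ((join_le_iff.1 (L.opens.le_refl _)).2)

lemma openRetract_aux : L.opens.inf (𝟙 _) (constAt U _) ≫ L.opens.inf (𝟙 _) (constAt U _) =
    L.opens.inf (𝟙 _) (constAt U _) ≫ 𝟙 _ := by
  rw [comp_infU, Category.comp_id]
  exact show L.opens.le _ _ from (le_meet_iff.1 (L.opens.le_refl _)).2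

lemma comp_closedRetract {I : E} (a : I ⟶ L.opens.obj) :
    a ≫ equalizer.lift (L.opens.sup (𝟙 _) (constAt U _)) (closedRetract_aux L U) ≫
      equalizer.ι (L.opens.sup (𝟙 _) (constAt U _)) (𝟙 _) = L.opens.sup a (constAt U I) := by
  rw [equalizer.lift_ι, comp_supU]

lemma comp_openRetract {I : E} (a : I ⟶ L.opens.obj) :
    a ≫ equalizer.lift (L.opens.inf (𝟙 _) (constAt U _)) (openRetract_aux L U) ≫
      equalizer.ι (L.opens.inf (𝟙 _) (constAt U _)) (𝟙 _) = L.opens.inf a (constAt U I) := by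
  rw [equalizer.lift_ι, comp_infU]

/-- If `g` sends `U` to `⊥`, then its inverse image does not distinguish `a` from `a ⊔ U`, so it
factors through the retraction. -/
lemma closedSubspace_lift {W : LocalicSpace E} (g : W ⟶ L)
    (hg : U ≫ g.inv.map = W.opens.bot (𝟙_ E)) :
    ∃ k : W ⟶ (closedSubspace L U).space, k ≫ (closedSubspace L U).incl = g := by
  refine Subspace.ofRetract_lift g ?_
    (hinf := fun a b => by simp only [comp_closedRetract]; exact L.opens.sup_inf_distrib _ _ _)
    (hsup := fun a b => by simp only [comp_closedRetract]; exact L.opens.sup_sup_distrib _ _ _)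
  rw [equalizer.lift_ι_assoc, g.inv.sup_map, Category.id_comp, constAt, Category.assoc, hg,
    W.opens.comp_bot, W.opens.sup_bot]

lemma openSubspace_lift {W : LocalicSpace E} (g : W ⟶ L)
    (hg : U ≫ g.inv.map = W.opens.top (𝟙_ E)) :
    ∃ k : W ⟶ (openSubspace L U).space, k ≫ (openSubspace L U).incl = g := by
  refine Subspace.ofRetract_lift g ?_
    (hinf := fun a b => by simp only [comp_openRetract]; exact L.opens.inf_inf_distrib _ _ _)
    (hsup := fun a b => by simp only [comp_openRetract]; exact L.opens.inf_sup_distrib _ _ _)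
  rw [equalizer.lift_ι_assoc, g.inv.inf_map, Category.id_comp, constAt, Category.assoc, hg,
    W.opens.comp_top, W.opens.inf_top]

lemma closedSubspace_incl_eq_iff {I : E} (a b : I ⟶ L.opens.obj) :
    a ≫ (closedSubspace L U).incl.inv.map = b ≫ (closedSubspace L U).incl.inv.map ↔
      L.opens.sup a (constAt U I) = L.opens.sup b (constAt U I) := by
  rw [← comp_closedRetract L U a, ← comp_closedRetract L U b]
  exact Subspace.ofRetract_incl_eq_iff a b
    (hinf := fun a b => by simp only [comp_closedRetract]; exact L.opens.sup_inf_distrib _ _ _)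
    (hsup := fun a b => by simp only [comp_closedRetract]; exact L.opens.sup_sup_distrib _ _ _)

lemma openSubspace_incl_eq_iff {I : E} (a b : I ⟶ L.opens.obj) :
    a ≫ (openSubspace L U).incl.inv.map = b ≫ (openSubspace L U).incl.inv.map ↔
      L.opens.inf a (constAt U I) = L.opens.inf b (constAt U I) := by
  rw [← comp_openRetract L U a, ← comp_openRetract L U b]
  exact Subspace.ofRetract_incl_eq_iff a b
    (hinf := fun a b => by simp only [comp_openRetract]; exact L.opens.inf_inf_distrib _ _ _)
    (hsup := fun a b => by simp only [comp_openRetract]; exact L.opens.inf_sup_distrib _ _ _)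

lemma closedSubspace_incl_eq_bot :
    U ≫ (closedSubspace L U).incl.inv.map = (closedSubspace L U).space.opens.bot (𝟙_ E) := by
  rw [← (closedSubspace L U).incl.inv.bot_map, closedSubspace_incl_eq_iff]
  have e : constAt U (𝟙_ E) = U := by
    rw [constAt, toUnit_unique (toUnit (𝟙_ E)) (𝟙 _), Category.id_comp]
  rw [e, sup_self, L.opens.sup_comm, L.opens.sup_bot]

lemma openSubspace_incl_eq_top :
    U ≫ (openSubspace L U).incl.inv.map = (openSubspace L U).space.opens.top (𝟙_ E) := by
  rw [← (openSubspace L U).incl.inv.top_map, openSubspace_incl_eq_iff]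
  have e : constAt U (𝟙_ E) = U := by
    rw [constAt, toUnit_unique (toUnit (𝟙_ E)) (𝟙 _), Category.id_comp]
  rw [e, inf_self, L.opens.inf_comm, L.opens.inf_top]

variable {L U} in
lemma map_eq_bot_of_closedSubspace {W : LocalicSpace E} (k : W ⟶ (closedSubspace L U).space) :
    U ≫ (k ≫ (closedSubspace L U).incl).inv.map = W.opens.bot (𝟙_ E) := by
  rw [LocalicSpace.comp_inv, ← Category.assoc, closedSubspace_incl_eq_bot, k.inv.bot_map]

variable {L U} in
lemma map_eq_top_of_openSubspace {W : LocalicSpace E} (k : W ⟶ (openSubspace L U).space) :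
    U ≫ (k ≫ (openSubspace L U).incl).inv.map = W.opens.top (𝟙_ E) := by
  rw [LocalicSpace.comp_inv, ← Category.assoc, openSubspace_incl_eq_top, k.inv.top_map]

/-- In the closed complement `⊥` and `⊤` become `U` and `⊤`. -/
lemma isTrivial_closedSubspace_iff :
    (closedSubspace L U).space.IsTrivial ↔ U = L.opens.top (𝟙_ E) := by
  have e : constAt U (𝟙_ E) = U := by
    rw [constAt, toUnit_unique (toUnit (𝟙_ E)) (𝟙 _), Category.id_comp]
  have h : (closedSubspace L U).space.opens.bot (𝟙_ E) =
      (closedSubspace L U).space.opens.top (𝟙_ E) ↔ U = L.opens.top (𝟙_ E) := by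
    rw [← (closedSubspace L U).incl.inv.bot_map, ← (closedSubspace L U).incl.inv.top_map,
      closedSubspace_incl_eq_iff, e, L.opens.sup_comm, L.opens.sup_bot, L.opens.sup_comm, sup_top]
  exact ⟨fun k => h.1 (k _), fun k => LocalicSpace.isTrivial_of_bot_eq_top (h.2 k)⟩

/-- If `S` contains both subspaces, the inverse image along `S` determines `a ⊓ U` and `a ⊔ U`,
hence `a`. It is then both monic and epic, so `S` is the whole of `L`. -/
lemma isLUB_open_closed [Balanced E] :
    IsLUB {openSubspace L U, closedSubspace L U} (Subspace.whole L) := by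
  refine ⟨fun S _ => ⟨S.incl, Category.comp_id _⟩, fun S hS => ?_⟩
  obtain ⟨k, hk⟩ := hS (Set.mem_insert _ _)
  obtain ⟨l, hl⟩ := hS (Set.mem_insert_of_mem _ rfl)
  have := S.epi
  have hm : Mono S.incl.inv.map := ⟨fun {I} a b hab => by
    refine eq_of_inf_eq_of_sup_eq (c := constAt U I) ?_ ?_
    · rw [← openSubspace_incl_eq_iff, ← hk, LocalicSpace.comp_inv, ← Category.assoc, hab,
        Category.assoc]
    · rw [← closedSubspace_incl_eq_iff, ← hl, LocalicSpace.comp_inv, ← Category.assoc, hab,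
        Category.assoc]⟩
  obtain ⟨n, h1, h2⟩ := (isIso_of_mono_of_epi S.incl.inv.map).out
  exact ⟨LocalicSpace.inverse S.incl n h1 h2, LocalicSpace.inverse_comp _ _ _ _⟩

/-- In a subspace contained in both, `U` restricts to `⊤` and to `⊥`, so the subspace is trivial. -/
lemma isGLB_open_closed :
    IsGLB {openSubspace L U, closedSubspace L U} (Subspace.empty L) := by
  refine ⟨fun S _ => ⟨emptySpaceIsInitial.to _, emptySpaceIsInitial.hom_ext _ _⟩, fun S hS => ?_⟩
  obtain ⟨k, hk⟩ := hS (Set.mem_insert _ _)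
  obtain ⟨l, hl⟩ := hS (Set.mem_insert_of_mem _ rfl)
  have h1 := map_eq_top_of_openSubspace k
  have h2 := map_eq_bot_of_closedSubspace l
  rw [hk] at h1
  rw [hl] at h2
  have ht : S.space.IsTrivial := LocalicSpace.isTrivial_of_bot_eq_top (h2.symm.trans h1)
  refine ⟨ht.toEmpty, LocalicSpace.hom_ext ?_⟩
  exact (le_of_bot_eq_top (ht _) _ _).antisymm (le_of_bot_eq_top (ht _) _ _)

end OpenClosed

end Cartesian

end PointFree

namespace PointFree

/-! ### Discrete spaces, truth values and the point -/

section Topos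

open HasSubobjectClassifier MonoidalClosed InternalLattice

variable {E : Type u} [Category.{v} E] [CartesianMonoidalCategory E] [HasFiniteLimits E]
  [HasSubobjectClassifier E] [MonoidalClosed E]

/-- The generalized element `x` of `X` belongs to the generalized subset `a` of `X`. -/
def Mem {X I : E} (x : I ⟶ X) (a : I ⟶ (discrete X).opens.obj) : Prop :=
  lift x (𝟙 I) ≫ uncurry (show I ⟶ (ihom X).obj (Ω E) from a) = tr I

lemma mem_comp_iff {X I J : E} (x : J ⟶ X) (u : J ⟶ I) (a : I ⟶ (discrete X).opens.obj) :
    Mem x (u ≫ a) ↔ lift x u ≫ uncurry (show I ⟶ (ihom X).obj (Ω E) from a) = tr J := by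
  have e : uncurry (u ≫ show I ⟶ (ihom X).obj (Ω E) from a) = X ◁ u ≫ uncurry _ :=
    uncurry_natural_left _ _
  change lift x (𝟙 J) ≫ uncurry (u ≫ show I ⟶ (ihom X).obj (Ω E) from a) = tr J ↔ _
  rw [e, ← Category.assoc]
  simp

lemma Mem.comp {X I J : E} {x : I ⟶ X} {a : I ⟶ (discrete X).opens.obj} (h : Mem x a)
    (u : J ⟶ I) : Mem (u ≫ x) (u ≫ a) := by
  rw [mem_comp_iff]
  have e : lift (u ≫ x) u = u ≫ lift x (𝟙 I) := by simp
  rw [e, Category.assoc]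
  exact (congrArg _ h).trans (comp_tr u)

/-- Comprehension: with `discrete_le_iff`, it lets the frame of a discrete space be handled through
membership alone. -/
lemma exists_mem_iff {X I : E} (t : X ⊗ I ⟶ Ω E) :
    ∃ a : I ⟶ (discrete X).opens.obj, ∀ ⦃T : E⦄ (u : T ⟶ I) (x : T ⟶ X),
      Mem x (u ≫ a) ↔ lift x u ≫ t = tr T :=
  ⟨curry t, fun T u x => (mem_comp_iff x u _).trans
    (iff_of_eq (congrArg (fun s => lift x u ≫ s = tr T) (uncurry_curry t)))⟩

lemma discrete_le_iff {X I : E} (a b : I ⟶ (discrete X).opens.obj) :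
    (discrete X).opens.le a b ↔
      ∀ ⦃T : E⦄ (u : T ⟶ I) (x : T ⟶ X), Mem x (u ≫ a) → Mem x (u ≫ b) := by
  refine (powerLattice_le_iff X a b).trans ?_
  simp only [mem_comp_iff]
  constructor
  · intro h T u x hx
    exact h _ hx
  · intro h T v hv
    have e : lift (v ≫ fst X I) (v ≫ snd X I) = v := by ext <;> simp
    have := h (v ≫ snd X I) (v ≫ fst X I)
    rw [e] at this
    exact this hv

lemma mem_top {X I : E} (x : I ⟶ X) : Mem x ((discrete X).opens.top I) := by
  have e : uncurry (curry (tr (X ⊗ I))) = tr (X ⊗ I) := uncurry_curry _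
  change lift x (𝟙 I) ≫ uncurry (curry (tr (X ⊗ I))) = tr I
  rw [e, comp_tr]

lemma mem_inf {X I : E} (x : I ⟶ X) (a b : I ⟶ (discrete X).opens.obj) :
    Mem x ((discrete X).opens.inf a b) ↔ Mem x a ∧ Mem x b := by
  change lift x (𝟙 I) ≫ uncurry (curry (tAnd (uncurry a) (uncurry b))) = tr I ↔ _
  rw [uncurry_curry, comp_tAnd]
  rfl

lemma mem_openOf {P X I : E} (m : P ⟶ X) [Mono m] (x : I ⟶ X) (u : I ⟶ 𝟙_ E) :
    Mem x (u ≫ openOf m) ↔ ∃ w : I ⟶ P, w ≫ m = x := by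
  rw [mem_comp_iff]
  change lift x u ≫ uncurry (curry (fst X (𝟙_ E) ≫ χ m)) = tr I ↔ _
  rw [uncurry_curry, lift_fst_assoc, comp_χ_eq_tr]

lemma eq_of_mem_iff {X I : E} {a b : I ⟶ (discrete X).opens.obj}
    (h : ∀ ⦃T : E⦄ (u : T ⟶ I) (x : T ⟶ X), Mem x (u ≫ a) ↔ Mem x (u ≫ b)) : a = b :=
  ((discrete_le_iff a b).2 fun _ u x => (h u x).1).antisymm
    ((discrete_le_iff b a).2 fun _ u x => (h u x).2)

/-- An open of the point, that is, a truth value, holds. -/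
def Holds {I : E} (a : I ⟶ (point E).opens.obj) : Prop := Mem (toUnit I) a

lemma mem_iff_holds {I : E} (x : I ⟶ 𝟙_ E) (a : I ⟶ (point E).opens.obj) : Mem x a ↔ Holds a := by
  rw [toUnit_unique x (toUnit I)]; rfl

lemma Holds.comp {I J : E} {a : I ⟶ (point E).opens.obj} (h : Holds a) (u : J ⟶ I) :
    Holds (u ≫ a) := (mem_iff_holds _ _).1 (Mem.comp h u)

lemma point_le_iff {I : E} (a b : I ⟶ (point E).opens.obj) :
    (point E).opens.le a b ↔ ∀ ⦃T : E⦄ (u : T ⟶ I), Holds (u ≫ a) → Holds (u ≫ b) := by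
  rw [discrete_le_iff]
  simp only [mem_iff_holds]
  exact ⟨fun h T u => h u (toUnit T), fun h T u _ => h u⟩

lemma holds_top (I : E) : Holds ((point E).opens.top I) := mem_top _

lemma holds_iff_eq_top {I : E} (a : I ⟶ (point E).opens.obj) :
    Holds a ↔ a = (point E).opens.top I := by
  refine ⟨fun h => top_le_iff_eq.1 ((point_le_iff _ _).2 fun T u _ => h.comp u), fun h => ?_⟩
  rw [h]
  exact holds_top I

lemma holds_inf {I : E} (a b : I ⟶ (point E).opens.obj) :
    Holds ((point E).opens.inf a b) ↔ Holds a ∧ Holds b := mem_inf _ _ _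

lemma holds_openOf {φ I : E} [Mono (toUnit φ)] (u : I ⟶ 𝟙_ E) :
    Holds (u ≫ openOf (toUnit φ)) ↔ Nonempty (I ⟶ φ) := by
  refine (mem_openOf (toUnit φ) (toUnit I) u).trans ?_
  exact ⟨fun ⟨w, _⟩ => ⟨w⟩, fun ⟨w⟩ => ⟨w, toUnit_unique _ _⟩⟩

lemma exists_holds_iff {I : E} (t : I ⟶ Ω E) :
    ∃ a : I ⟶ (point E).opens.obj, ∀ ⦃T : E⦄ (u : T ⟶ I), Holds (u ≫ a) ↔ u ≫ t = tr T := by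
  obtain ⟨a, ha⟩ := exists_mem_iff (X := 𝟙_ E) (snd (𝟙_ E) I ≫ t)
  exact ⟨a, fun T u => (ha u (toUnit T)).trans (by rw [lift_snd_assoc])⟩

/-- A truth value is the subobject of the stages at which it holds. -/
lemma exists_mono_holds_iff {I : E} (a : I ⟶ (point E).opens.obj) :
    ∃ (S : E) (ι : S ⟶ I), Mono ι ∧
      ∀ ⦃T : E⦄ (u : T ⟶ I), Holds (u ≫ a) ↔ ∃ w : T ⟶ S, w ≫ ι = u := by
  let t : I ⟶ Ω E := lift (toUnit I) (𝟙 I) ≫ uncurry (show I ⟶ (ihom (𝟙_ E)).obj (Ω E) from a)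
  refine ⟨equalizer t (tr I), equalizer.ι _ _, inferInstance, fun T u => ?_⟩
  have e : Holds (u ≫ a) ↔ u ≫ t = tr T := by
    refine (mem_comp_iff _ _ _).trans ?_
    have e : lift (toUnit T) u = u ≫ lift (toUnit I) (𝟙 I) := by
      rw [comp_lift, Category.comp_id, toUnit_unique (u ≫ toUnit I) (toUnit T)]
    rw [e, Category.assoc]
  rw [e]
  constructor
  · intro h
    exact ⟨equalizer.lift u (by rw [h, comp_tr]), equalizer.lift_ι _ _⟩
  · rintro ⟨w, rfl⟩
    rw [Category.assoc, equalizer.condition, comp_tr, comp_tr]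

/-- A truth value is the join of "true", indexed by the proofs of it. -/
lemma point_isJoin {S I : E} (a : I ⟶ (point E).opens.obj) (ι : S ⟶ I)
    (h : ∀ ⦃T : E⦄ (u : T ⟶ I), Holds (u ≫ a) ↔ ∃ w : T ⟶ S, w ≫ ι = u) :
    (point E).opens.IsJoin ι ((point E).opens.top S) a := by
  intro K u b
  rw [point_le_iff]
  constructor
  · intro k T p q hpq
    rw [(point E).opens.comp_top, top_le_iff_eq, ← holds_iff_eq_top]
    refine k p ?_
    rw [← Category.assoc, h]
    exact ⟨q, hpq.symm⟩
  · intro k T v hv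
    rw [← Category.assoc, h] at hv
    obtain ⟨w, hw⟩ := hv
    have := k v w hw.symm
    rw [(point E).opens.comp_top, top_le_iff_eq] at this
    rwa [holds_iff_eq_top]

/-- The generic truth value, the identity of the frame of `1`, is a join of copies of `⊤`. A frame
homomorphism preserves this join, so its value at the generic element, and hence the whole map, is
determined. -/
instance (L : LocalicSpace E) : Subsingleton (L ⟶ point E) where
  allEq f g := by
    obtain ⟨S, ι, -, h⟩ := exists_mono_holds_iff (𝟙 (point E).opens.obj)
    have hf := f.map_join _ _ _ (point_isJoin _ ι h)
    have hg := g.map_join _ _ _ (point_isJoin _ ι h)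
    rw [f.inv.top_map, Category.id_comp] at hf
    rw [g.inv.top_map, Category.id_comp] at hg
    exact LocalicSpace.hom_ext (hf.unique hg)

/-- The map is `a ↦ ⋁ {⊤ | a}`, constructed once for the generic truth value. -/
lemma exists_truth_map (L : LocalicSpace E) : ∃ m : (point E).opens.obj ⟶ L.opens.obj,
    ∀ {I : E} (a : I ⟶ (point E).opens.obj) (b : I ⟶ L.opens.obj), L.opens.le (a ≫ m) b ↔
      ∀ ⦃T : E⦄ (u : T ⟶ I), Holds (u ≫ a) → u ≫ b = L.opens.top T := by
  obtain ⟨S, ι, -, h⟩ := exists_mono_holds_iff (𝟙 (point E).opens.obj)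
  obtain ⟨m, hm⟩ := L.isFrame.exists_join ι (L.opens.top S)
  refine ⟨m, fun {I} a b => (hm a b).trans ?_⟩
  simp only [L.opens.comp_top, top_le_iff_eq]
  constructor
  · intro k T u hu
    have := (h (u ≫ a)).1 (by rwa [Category.comp_id])
    obtain ⟨w, hw⟩ := this
    exact k u w hw.symm
  · intro k T p q hpq
    refine k p ?_
    have := (h (p ≫ a)).2 ⟨q, hpq.symm⟩
    rwa [Category.comp_id] at this

/-- The frame homomorphism from truth values to the opens of a space. -/
noncomputable def truthMap (L : LocalicSpace E) : (point E).opens.obj ⟶ L.opens.obj :=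
  (exists_truth_map L).choose

lemma truthMap_le_iff (L : LocalicSpace E) {I : E} (a : I ⟶ (point E).opens.obj)
    (b : I ⟶ L.opens.obj) : L.opens.le (a ≫ truthMap L) b ↔
      ∀ ⦃T : E⦄ (u : T ⟶ I), Holds (u ≫ a) → u ≫ b = L.opens.top T :=
  (exists_truth_map L).choose_spec a b

lemma exists_holds_iff_eq {X I : E} (x y : I ⟶ X) :
    ∃ a : I ⟶ (point E).opens.obj, ∀ ⦃T : E⦄ (u : T ⟶ I), Holds (u ≫ a) ↔ u ≫ x = u ≫ y := by
  obtain ⟨a, ha⟩ := exists_holds_iff (eqv x y)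
  exact ⟨a, fun T u => (ha u).trans (comp_eqv x y u)⟩

lemma comp_truthMap_eq_top (L : LocalicSpace E) {I : E} {a : I ⟶ (point E).opens.obj}
    (h : Holds a) : a ≫ truthMap L = L.opens.top I := by
  have := (truthMap_le_iff L a _).1 (L.opens.le_refl _) (𝟙 I) (by rwa [Category.id_comp])
  rwa [Category.id_comp] at this

/-- `truthMap` has a right adjoint. -/
lemma exists_truthMap_le_iff (L : LocalicSpace E) {I : E} (b : I ⟶ L.opens.obj) :
    ∃ r : I ⟶ (point E).opens.obj, ∀ ⦃K : E⦄ (u : K ⟶ I) (a : K ⟶ (point E).opens.obj),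
      L.opens.le (a ≫ truthMap L) (u ≫ b) ↔ (point E).opens.le a (u ≫ r) := by
  obtain ⟨r, hr⟩ := exists_holds_iff_eq b (L.opens.top I)
  refine ⟨r, fun K u a => ?_⟩
  rw [truthMap_le_iff, point_le_iff]
  refine forall_congr' fun T => forall_congr' fun p => imp_congr_right fun _ => ?_
  rw [← Category.assoc, ← Category.assoc, hr, L.opens.comp_top]

/-- The inequality that is not formal uses the frame law in `L`: the image of `b` is the join of `⊤`
over the proofs of `b`, and once `b` holds, `a ⊓ b` is `a`. -/
lemma truthMap_inf (L : LocalicSpace E) {I : E} (a b : I ⟶ (point E).opens.obj) :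
    (point E).opens.inf a b ≫ truthMap L = L.opens.inf (a ≫ truthMap L) (b ≫ truthMap L) := by
  apply le.antisymm
  · rw [le_meet_iff]
    constructor
    · rw [truthMap_le_iff]
      intro T u hu
      rw [(point E).opens.comp_inf, holds_inf] at hu
      rw [← Category.assoc, comp_truthMap_eq_top L hu.1]
    · rw [truthMap_le_iff]
      intro T u hu
      rw [(point E).opens.comp_inf, holds_inf] at hu
      rw [← Category.assoc, comp_truthMap_eq_top L hu.2]
  · obtain ⟨S, ι, -, h⟩ := exists_mono_holds_iff b
    have hj : L.opens.IsJoin ι (L.opens.top S) (b ≫ truthMap L) := by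
      intro K u c
      rw [← Category.assoc, truthMap_le_iff]
      simp only [L.opens.comp_top, top_le_iff_eq]
      constructor
      · intro k T p q hpq
        refine k p ?_
        rw [← Category.assoc, h]
        exact ⟨q, hpq.symm⟩
      · intro k T v hv
        rw [← Category.assoc, h] at hv
        obtain ⟨w, hw⟩ := hv
        exact k v w hw.symm
    rw [(L.isFrame.inf_join _ _ _ (a ≫ truthMap L) hj).le_iff, L.opens.inf_top]
    have hb : Holds (ι ≫ b) := (h ι).2 ⟨𝟙 S, Category.id_comp _⟩
    have e : ι ≫ (point E).opens.inf a b = ι ≫ a := by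
      rw [(point E).opens.comp_inf, (holds_iff_eq_top _).1 hb, (point E).opens.inf_top]
    rw [← Category.assoc, ← Category.assoc, e]
    exact L.opens.le_refl _

/-- The map to the point. -/
noncomputable def toPoint (L : LocalicSpace E) : L ⟶ point E :=
  LocalicSpace.Map.ofAdjoint (truthMap L) (fun I => comp_truthMap_eq_top L (holds_top I))
    (truthMap_inf L) (exists_truthMap_le_iff L)

lemma map_eq_truthMap {L : LocalicSpace E} (f : L ⟶ point E) : f.inv.map = truthMap L := by
  rw [Subsingleton.elim f (toPoint L)]; rfl

/-- The truth value `φ` as an open of a space. -/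
noncomputable abbrev truthOpen (L : LocalicSpace E) (φ : E) [Mono (toUnit φ)] :
    𝟙_ E ⟶ L.opens.obj := openOf (toUnit φ) ≫ truthMap L

/-- Among the stages at which `φ` holds, `φ` itself is the universal one. -/
lemma truthOpen_le_iff (L : LocalicSpace E) (φ : E) [Mono (toUnit φ)] (b : 𝟙_ E ⟶ L.opens.obj) :
    L.opens.le (truthOpen L φ) b ↔ toUnit φ ≫ b = L.opens.top φ := by
  rw [truthMap_le_iff]
  simp only [holds_openOf]
  constructor
  · intro h
    exact h (toUnit φ) ⟨𝟙 φ⟩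
  · rintro h T u ⟨w⟩
    rw [toUnit_unique u (w ≫ toUnit φ), Category.assoc, h, L.opens.comp_top]

lemma truthOpen_eq_bot_iff (L : LocalicSpace E) (φ : E) [Mono (toUnit φ)] :
    truthOpen L φ = L.opens.bot (𝟙_ E) ↔ L.opens.bot φ = L.opens.top φ := by
  rw [← le_bot_iff_eq, truthOpen_le_iff, L.opens.comp_bot]

/-- `W` maps to the closed complement of `φ` in `1` if `φ` is false in `W`. -/
lemma nonempty_hom_closedOfTruth_iff (W : LocalicSpace E) (φ : E) [Mono (toUnit φ)] :
    Nonempty (W ⟶ (closedOfTruth φ).space) ↔ truthOpen W φ = W.opens.bot (𝟙_ E) := by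
  constructor
  · rintro ⟨k⟩
    have h := map_eq_bot_of_closedSubspace k
    rwa [map_eq_truthMap] at h
  · intro h
    obtain ⟨k, -⟩ := closedSubspace_lift (point E) (openOf (toUnit φ)) (toPoint W) h
    exact ⟨k⟩

lemma nonempty_hom_openOfTruth_iff (W : LocalicSpace E) (φ : E) [Mono (toUnit φ)] :
    Nonempty (W ⟶ (openOfTruth φ).space) ↔ truthOpen W φ = W.opens.top (𝟙_ E) := by
  constructor
  · rintro ⟨k⟩
    have h := map_eq_top_of_openSubspace k
    rwa [map_eq_truthMap] at h
  · intro h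
    obtain ⟨k, -⟩ := openSubspace_lift (point E) (openOf (toUnit φ)) (toPoint W) h
    exact ⟨k⟩

instance (W : LocalicSpace E) (S : Subspace (point E)) : Subsingleton (W ⟶ S.space) where
  allEq _ _ := S.mono_incl (Subsingleton.elim _ _)

lemma existsUnique_hom_of_nonempty {W : LocalicSpace E} {S : Subspace (point E)}
    (h : Nonempty (W ⟶ S.space)) : ∃! _h : W ⟶ S.space, True :=
  ⟨h.some, trivial, fun _ _ => Subsingleton.elim _ _⟩

end Topos

end PointFree

namespace PointFree

/-! ### Frames of functions, and products with discrete spaces -/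

section Functions

open MonoidalClosed InternalLattice

variable {E : Type u} [Category.{v} E] [CartesianMonoidalCategory E] [MonoidalClosed E]

/-- The internal lattice of functions from `X` to `A`. -/
noncomputable def functionLattice (X : E) (A : InternalLattice E) : InternalLattice E where
  obj := (ihom X).obj A.obj
  top I := curry (A.top (X ⊗ I))
  bot I := curry (A.bot (X ⊗ I))
  inf a b := curry (A.inf (uncurry a) (uncurry b))
  sup a b := curry (A.sup (uncurry a) (uncurry b))
  comp_top u := by rw [← curry_natural_left, A.comp_top]
  comp_bot u := by rw [← curry_natural_left, A.comp_bot]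
  comp_inf u a b := by
    rw [← curry_natural_left, A.comp_inf, uncurry_natural_left, uncurry_natural_left]
  comp_sup u a b := by
    rw [← curry_natural_left, A.comp_sup, uncurry_natural_left, uncurry_natural_left]
  inf_comm a b := congrArg curry (A.inf_comm _ _)
  sup_comm a b := congrArg curry (A.sup_comm _ _)
  inf_assoc a b c := by simp only [uncurry_curry, A.inf_assoc]
  sup_assoc a b c := by simp only [uncurry_curry, A.sup_assoc]
  inf_sup_self a b := by rw [uncurry_curry, A.inf_sup_self, curry_uncurry]
  sup_inf_self a b := by rw [uncurry_curry, A.sup_inf_self, curry_uncurry]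
  inf_sup_left a b c := by simp only [uncurry_curry, A.inf_sup_left]
  inf_top a := by rw [uncurry_curry, A.inf_top, curry_uncurry]
  sup_bot a := by rw [uncurry_curry, A.sup_bot, curry_uncurry]

variable {X : E} {A : InternalLattice E}

/-- A function with values in `A`, as a generalized element of `A`. -/
noncomputable def functionLattice.toFun {I : E}
    (a : I ⟶ (functionLattice X A).obj) : X ⊗ I ⟶ A.obj :=
  uncurry (show I ⟶ (ihom X).obj A.obj from a)

/-- A generalized element of `A`, as a function with values in `A`. -/
noncomputable def functionLattice.ofFun {I : E}
    (a : X ⊗ I ⟶ A.obj) : I ⟶ (functionLattice X A).obj :=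
  show I ⟶ (ihom X).obj A.obj from curry a

open functionLattice

lemma functionLattice.toFun_ofFun {I : E} (a : X ⊗ I ⟶ A.obj) : toFun (ofFun a) = a :=
  uncurry_curry _

lemma functionLattice.ofFun_toFun {I : E} (a : I ⟶ (functionLattice X A).obj) :
    ofFun (toFun a) = a :=
  curry_uncurry _

lemma functionLattice.toFun_injective {I : E} {a b : I ⟶ (functionLattice X A).obj}
    (h : toFun a = toFun b) : a = b := by
  rw [← ofFun_toFun a, h, ofFun_toFun]

lemma functionLattice.toFun_comp {I J : E} (u : J ⟶ I) (a : I ⟶ (functionLattice X A).obj) :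
    toFun (u ≫ a) = X ◁ u ≫ toFun a :=
  uncurry_natural_left _ _

lemma functionLattice.toFun_top (I : E) : toFun ((functionLattice X A).top I) = A.top (X ⊗ I) :=
  uncurry_curry _

lemma functionLattice.toFun_bot (I : E) : toFun ((functionLattice X A).bot I) = A.bot (X ⊗ I) :=
  uncurry_curry _

lemma functionLattice.toFun_inf {I : E} (a b : I ⟶ (functionLattice X A).obj) :
    toFun ((functionLattice X A).inf a b) = A.inf (toFun a) (toFun b) :=
  uncurry_curry _

lemma functionLattice.toFun_sup {I : E} (a b : I ⟶ (functionLattice X A).obj) :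
    toFun ((functionLattice X A).sup a b) = A.sup (toFun a) (toFun b) :=
  uncurry_curry _

lemma functionLattice.le_iff_toFun {I : E} (a b : I ⟶ (functionLattice X A).obj) :
    (functionLattice X A).le a b ↔ A.le (toFun a) (toFun b) := by
  unfold le
  rw [← toFun_inf]
  exact ⟨fun h => by rw [h], toFun_injective⟩

/-- Joins of functions are pointwise. To compare values from comparisons of functions, a point of `X
⊗ K` is split: its second component is a change of stage, and its first is the argument at which the
functions are evaluated. -/
lemma functionLattice.isJoin_of_toFun {I J : E} {f : J ⟶ I} {a : J ⟶ (functionLattice X A).obj}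
    {s : I ⟶ (functionLattice X A).obj} (h : A.IsJoin (X ◁ f) (toFun a) (toFun s)) :
    (functionLattice X A).IsJoin f a s := by
  intro K u b
  rw [le_iff_toFun, toFun_comp, h]
  simp only [le_iff_toFun, toFun_comp]
  constructor
  · intro h T p q hpq
    refine h _ _ ?_
    simp only [← MonoidalCategory.whiskerLeft_comp, hpq]
  · intro h T p q hpq
    have e1 : p ≫ fst _ _ = q ≫ fst _ _ := by
      have := congrArg (fun z => z ≫ fst _ _) hpq
      simpa using this
    have e2 : (p ≫ snd _ _) ≫ u = (q ≫ snd _ _) ≫ f := by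
      have := congrArg (fun z => z ≫ snd _ _) hpq
      simpa using this
    have h1 := (h _ _ e2).comp (lift (p ≫ fst _ _) (𝟙 T))
    have e3 : lift (p ≫ fst _ _) (𝟙 T) ≫ X ◁ (q ≫ snd _ _) = q := by
      ext <;> simp [e1]
    have e4 : lift (p ≫ fst _ _) (𝟙 T) ≫ X ◁ (p ≫ snd _ _) = p := by
      ext <;> simp
    rwa [← Category.assoc, ← Category.assoc, e3, e4] at h1

lemma functionLattice_isFrame (X : E) {A : InternalLattice E} (hA : A.IsFrame) :
    (functionLattice X A).IsFrame := by
  have key : ∀ {I J : E} (f : J ⟶ I) (a : J ⟶ (functionLattice X A).obj),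
      ∃ s : I ⟶ (functionLattice X A).obj, A.IsJoin (X ◁ f) (toFun a) (toFun s) := by
    intro I J f a
    obtain ⟨s, hs⟩ := hA.exists_join (X ◁ f) (toFun a)
    exact ⟨ofFun s, by rwa [toFun_ofFun]⟩
  refine ⟨fun f a => ?_, fun f a s c h => ?_⟩
  · obtain ⟨s, hs⟩ := key f a
    exact ⟨s, isJoin_of_toFun hs⟩
  · obtain ⟨s', hs'⟩ := key f a
    rw [h.unique (isJoin_of_toFun hs')]
    apply isJoin_of_toFun
    rw [toFun_inf, toFun_inf, toFun_comp]
    exact hA.inf_join _ _ _ _ hs'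

/-- The product of a space `W` with the discrete space `X`. -/
noncomputable def prodDiscrete (W : LocalicSpace E) (X : E) : LocalicSpace E :=
  ⟨functionLattice X W.opens, functionLattice_isFrame X W.isFrame⟩

/-- The projection from the product with a discrete space. -/
noncomputable def prodDiscreteFst (W : LocalicSpace E) (X : E) : prodDiscrete W X ⟶ W :=
  have e : ∀ {I : E} (a : I ⟶ W.opens.obj),
      toFun (a ≫ ofFun (A := W.opens) (snd X W.opens.obj)) = snd X I ≫ a := fun a => by
    rw [toFun_comp, toFun_ofFun, whiskerLeft_snd]
  { inv :=
      { map := ofFun (A := W.opens) (snd X W.opens.obj)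
        top_map := fun I => toFun_injective ((e _).trans
          ((W.opens.comp_top _).trans (toFun_top I).symm))
        bot_map := fun I => toFun_injective ((e _).trans
          ((W.opens.comp_bot _).trans (toFun_bot I).symm))
        inf_map := fun a b => toFun_injective ((e _).trans
          ((W.opens.comp_inf _ _ _).trans
            ((congrArg₂ _ (e a).symm (e b).symm).trans (toFun_inf _ _).symm)))
        sup_map := fun a b => toFun_injective ((e _).trans
          ((W.opens.comp_sup _ _ _).trans
            ((congrArg₂ _ (e a).symm (e b).symm).trans (toFun_sup _ _).symm))) }
    map_join := fun f a s h =>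
      isJoin_of_toFun ((h.whiskerLeft X).congr (e a).symm (e s).symm) }

/-- Equality of the constant functions `0` and `1` on `X`, evaluated at the generic element of `X`.
-/
lemma bot_eq_top_of_isTrivial_prodDiscrete {W : LocalicSpace E} {X : E}
    (h : (prodDiscrete W X).IsTrivial) : W.opens.bot X = W.opens.top X := by
  have h1 : toFun ((functionLattice X W.opens).bot (𝟙_ E)) =
      toFun ((functionLattice X W.opens).top (𝟙_ E)) := congrArg _ (h (𝟙_ E))
  rw [toFun_bot, toFun_top] at h1
  exact bot_eq_top_comp h1 (lift (𝟙 X) (toUnit X))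

end Functions

/-! ### Exponentials of discrete spaces, and double negation -/

section Topos

open HasSubobjectClassifier MonoidalClosed InternalLattice functionLattice

variable {E : Type u} [Category.{v} E] [CartesianMonoidalCategory E] [HasFiniteLimits E]
  [HasSubobjectClassifier E] [MonoidalClosed E]

lemma exists_mono_mem_iff {X I : E} (a : I ⟶ (discrete X).opens.obj) :
    ∃ (S : E) (ι : S ⟶ X ⊗ I), Mono ι ∧
      ∀ ⦃T : E⦄ (u : T ⟶ I) (x : T ⟶ X), Mem x (u ≫ a) ↔ ∃ w : T ⟶ S, w ≫ ι = lift x u := by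
  let t : X ⊗ I ⟶ Ω E := uncurry (show I ⟶ (ihom X).obj (Ω E) from a)
  refine ⟨equalizer t (tr _), equalizer.ι _ _, inferInstance, fun T u x => ?_⟩
  rw [mem_comp_iff]
  constructor
  · intro h
    exact ⟨equalizer.lift (lift x u) (by rw [comp_tr]; exact h), equalizer.lift_ι _ _⟩
  · rintro ⟨w, hw⟩
    rw [← hw, Category.assoc]
    exact (congrArg _ (equalizer.condition t (tr _))).trans (by rw [comp_tr, comp_tr])

/-- The generic membership relation, as a map; it serves to define the projection to the discrete
space on `X`. -/
lemma exists_truthOf_mem (X : E) :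
    ∃ ε : X ⊗ (discrete X).opens.obj ⟶ (point E).opens.obj, ∀ {I : E} (x : I ⟶ X)
      (a : I ⟶ (discrete X).opens.obj), Holds (lift x a ≫ ε) ↔ Mem x a := by
  obtain ⟨S, ι, hι, h⟩ := exists_mono_mem_iff (𝟙 (discrete X).opens.obj)
  obtain ⟨ε, hε⟩ := exists_holds_iff (χ ι)
  refine ⟨ε, fun {I} x a => ?_⟩
  rw [hε, comp_χ_eq_tr, ← h, Category.comp_id]

/-- The other projection from the product with a discrete space. -/
lemma nonempty_hom_prodDiscrete (W : LocalicSpace E) (X : E) :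
    Nonempty (prodDiscrete W X ⟶ discrete X) := by
  obtain ⟨ε, hε⟩ := exists_truthOf_mem X
  have hε' : ∀ {I T : E} (v : T ⟶ X ⊗ I) (a : I ⟶ (discrete X).opens.obj),
      Holds (v ≫ X ◁ a ≫ ε) ↔ Mem (v ≫ fst X I) (v ≫ snd X I ≫ a) := by
    intro I T v a
    rw [← hε]
    have e : lift (v ≫ fst X I) (v ≫ snd X I ≫ a) = v ≫ X ◁ a := by ext <;> simp
    rw [e, Category.assoc]
  -- A subset of `X` is sent to the function whose value at `x` is the truth value of membership of
  -- `x`, as an open of `W`.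
  let m : (discrete X).opens.obj ⟶ (prodDiscrete W X).opens.obj :=
    ofFun (A := W.opens) (ε ≫ truthMap W)
  have hm : ∀ {I : E} (a : I ⟶ (discrete X).opens.obj),
      toFun (A := W.opens) (a ≫ m) = (X ◁ a ≫ ε) ≫ truthMap W := by
    intro I a
    have h1 := toFun_comp (A := W.opens) a m
    have h2 : toFun (A := W.opens) m = ε ≫ truthMap W := toFun_ofFun _
    rw [h2] at h1
    rw [Category.assoc]
    exact h1
  refine ⟨LocalicSpace.Map.ofAdjoint m (fun I => ?_) (fun {I} a b => ?_) (fun {I} b => ?_)⟩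
  · refine toFun_injective ((hm _).trans (Eq.trans ?_ (toFun_top (X := X) (A := W.opens) I).symm))
    refine comp_truthMap_eq_top W ?_
    have h := (hε' (𝟙 (X ⊗ I)) ((discrete X).opens.top I)).2 (by
      rw [Category.id_comp, Category.id_comp, (discrete X).opens.comp_top]; exact mem_top _)
    rwa [Category.id_comp] at h
  · refine toFun_injective ((hm _).trans (Eq.trans ?_ (toFun_inf (A := W.opens) (a ≫ m) (b ≫ m)).symm))
    rw [hm a, hm b, ← truthMap_inf]
    congr 1
    refine eq_of_mem_iff fun T v x => ?_
    rw [mem_iff_holds, mem_iff_holds, hε', (point E).opens.comp_inf, holds_inf, hε', hε',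
      (discrete X).opens.comp_inf, (discrete X).opens.comp_inf, mem_inf]
  -- The right adjoint sends a function `b` to the subset of `X` where `b` takes the value `⊤`.
  · obtain ⟨r, hr⟩ := exists_mem_iff (eqv (toFun (A := W.opens) b) (W.opens.top (X ⊗ I)))
    refine ⟨r, fun K u a => ?_⟩
    refine (le_iff_toFun (A := W.opens) (a ≫ m) (u ≫ b)).trans ((iff_of_eq
      (congrArg₂ W.opens.le (hm a) (toFun_comp (A := W.opens) u b))).trans ?_)
    rw [truthMap_le_iff, discrete_le_iff]
    simp only [hε']
    have h2 : ∀ {T : E} (p : T ⟶ K) (x : T ⟶ X), Mem x (p ≫ u ≫ r) ↔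
        lift x p ≫ X ◁ u ≫ toFun (A := W.opens) b = W.opens.top T := by
      intro T p x
      rw [← Category.assoc, hr, comp_eqv, W.opens.comp_top]
      have e : lift x (p ≫ u) = lift x p ≫ X ◁ u := by simp
      rw [e, Category.assoc]
    simp only [h2]
    constructor
    · intro h T p x hx
      exact h (lift x p) (by simpa using hx)
    · intro h T v hv
      have := h (v ≫ snd X K) (v ≫ fst X K) (by simpa using hv)
      have e : lift (v ≫ fst X K) (v ≫ snd X K) = v := by ext <;> simp
      rwa [e] at this

lemma comp_truthOpen (L : LocalicSpace E) {φ I : E} [Mono (toUnit φ)] (w : I ⟶ φ)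
    (u : I ⟶ 𝟙_ E) : u ≫ truthOpen L φ = L.opens.top I := by
  rw [← Category.assoc]
  exact comp_truthMap_eq_top L ((holds_openOf u).2 ⟨w⟩)

lemma truthOpen_map {L M : LocalicSpace E} (f : L ⟶ M) (φ : E) [Mono (toUnit φ)] :
    truthOpen M φ ≫ f.inv.map = truthOpen L φ := by
  rw [truthOpen, truthOpen, ← map_eq_truthMap (f ≫ toPoint M), ← map_eq_truthMap (toPoint M),
    Category.assoc]
  rfl

lemma truthOpen_discrete {X φ : E} [Mono (toUnit φ)] (e : X ⟶ φ) :
    truthOpen (discrete X) φ = (discrete X).opens.top (𝟙_ E) := by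
  refine eq_of_mem_iff fun T u x => ?_
  rw [comp_truthOpen _ (x ≫ e), (discrete X).opens.comp_top]

lemma truthOpen_eq_top_of_hom {T : LocalicSpace E} {X φ : E} [Mono (toUnit φ)] (e : X ⟶ φ)
    (f : T ⟶ discrete X) : truthOpen T φ = T.opens.top (𝟙_ E) := by
  rw [← truthOpen_map f, truthOpen_discrete e, f.inv.top_map]

/-- The exponential `0 ^ X` for a discrete space `X`. -/
lemma isExponential_discrete {X φ : E} [Mono (toUnit φ)] (e : X ⟶ φ)
    (hφ : ∀ (ψ : E) [Mono (toUnit ψ)], (X ⟶ ψ) → Nonempty (φ ⟶ ψ)) :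
    IsExponential (discrete X) (emptySpace E) (closedOfTruth φ).space := by
  rw [isExponential_emptySpace_iff]
  refine ⟨fun T z x => ?_, fun W hW => existsUnique_hom_of_nonempty ?_⟩
  · have h1 := (nonempty_hom_closedOfTruth_iff T φ).1 ⟨z⟩
    exact LocalicSpace.isTrivial_of_bot_eq_top (h1.symm.trans (truthOpen_eq_top_of_hom e x))
  · rw [nonempty_hom_closedOfTruth_iff, truthOpen_eq_bot_iff]
    -- Only the existence of a space over `W` and the discrete `X` is used here, not its universal
    -- property as a product.
    have h := bot_eq_top_of_isTrivial_prodDiscrete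
      (hW _ (prodDiscreteFst W X) (nonempty_hom_prodDiscrete W X).some)
    rw [bot_eq_top_iff_nonempty] at h ⊢
    exact hφ _ h.some

/-- A truth value pulls back to a constant subset: the constant subset `c` bounds the pulled-back
open from above, so membership of any point forces `a`. -/
lemma mem_comp_truthMap {X I : E} (x : I ⟶ X) (a : I ⟶ (point E).opens.obj) :
    Mem x (a ≫ truthMap (discrete X)) ↔ Holds a := by
  constructor
  · intro h
    obtain ⟨S, ι, hι, hS⟩ := exists_mono_holds_iff a
    obtain ⟨c, hc⟩ := exists_mem_iff (X := X) (snd X I ≫ χ ι)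
    have hc' : ∀ {T : E} (u : T ⟶ I) (x : T ⟶ X), Mem x (u ≫ c) ↔ Holds (u ≫ a) := by
      intro T u x
      rw [hc, lift_snd_assoc, comp_χ_eq_tr, hS]
    have h1 : (discrete X).opens.le (a ≫ truthMap (discrete X)) c := by
      rw [truthMap_le_iff]
      intro T u hu
      refine eq_of_mem_iff fun K w y => ?_
      rw [← Category.assoc, hc', (discrete X).opens.comp_top]
      refine iff_of_true ?_ (mem_top _)
      rw [Category.assoc]
      exact hu.comp w
    have h2 := (discrete_le_iff _ _).1 h1 (𝟙 I) x (by rwa [Category.id_comp])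
    rwa [hc', Category.id_comp] at h2
  · intro h
    rw [comp_truthMap_eq_top _ h]
    exact mem_top _

/-- The discrete space on a truth value is the open subspace of the point that it gives. -/
lemma nonempty_discrete_iso_openOfTruth (φ : E) [Mono (toUnit φ)] :
    Nonempty (discrete φ ≅ (openOfTruth φ).space) := by
  obtain ⟨k⟩ := (nonempty_hom_openOfTruth_iff (discrete φ) φ).2 (truthOpen_discrete (𝟙 φ))
  obtain ⟨S, ι, hι, h⟩ := exists_mono_mem_iff (𝟙 (discrete φ).opens.obj)
  -- A subset of `φ` is inhabited by at most one element, since `φ` is a subobject of `1`. So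
  -- "inhabited" is classified by the membership relation itself; this truth value provides the
  -- inverse of `k`.
  have hmono : Mono (ι ≫ snd φ _) := ⟨fun a b hab => by
    rw [← cancel_mono ι]
    have e : ∀ {K : E} (x y : K ⟶ φ), x = y := fun x y => by
      rw [← cancel_mono (toUnit φ)]; exact toUnit_unique _ _
    ext
    · exact e _ _
    · simpa using hab⟩
  obtain ⟨m, hm⟩ := exists_holds_iff (χ (ι ≫ snd φ _))
  have hm' : ∀ {T : E} (u : T ⟶ (discrete φ).opens.obj),
      Holds (u ≫ m) ↔ ∃ x : T ⟶ φ, Mem x u := by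
    intro T u
    rw [hm, comp_χ_eq_tr]
    constructor
    · rintro ⟨w, hw⟩
      have := (h u (w ≫ ι ≫ fst _ _)).2 ⟨w, by rw [← hw]; ext <;> simp⟩
      rw [Category.comp_id] at this
      exact ⟨_, this⟩
    · rintro ⟨x, hx⟩
      obtain ⟨w, hw⟩ := (h u x).1 (by rwa [Category.comp_id])
      exact ⟨w, by rw [← Category.assoc, hw, lift_snd]⟩
  have := (openOfTruth φ).epi
  have e : (openOfTruth φ).incl.inv.map ≫ k.inv.map = truthMap (discrete φ) :=
    map_eq_truthMap (k ≫ (openOfTruth φ).incl)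
  have h1 : k.inv.map ≫ m ≫ (openOfTruth φ).incl.inv.map = 𝟙 _ := by
    rw [← cancel_epi (openOfTruth φ).incl.inv.map, ← Category.assoc, e, Category.comp_id,
      ← Category.assoc]
    refine Eq.trans ?_ (Category.id_comp _)
    refine (openSubspace_incl_eq_iff (point E) (openOf (toUnit φ)) _ _).2 ?_
    refine eq_of_mem_iff fun T u x => ?_
    rw [mem_iff_holds, mem_iff_holds, (point E).opens.comp_inf, (point E).opens.comp_inf,
      holds_inf, holds_inf, comp_constAt, holds_openOf, ← Category.assoc, hm', Category.comp_id]
    constructor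
    · rintro ⟨⟨x, hx⟩, hw⟩
      exact ⟨(mem_comp_truthMap x u).1 hx, hw⟩
    · rintro ⟨hu, ⟨w⟩⟩
      exact ⟨⟨w, (mem_comp_truthMap w u).2 hu⟩, ⟨w⟩⟩
  have h2 : (m ≫ (openOfTruth φ).incl.inv.map) ≫ k.inv.map = 𝟙 _ := by
    rw [Category.assoc, e]
    refine eq_of_mem_iff fun T u x => ?_
    rw [← Category.assoc, mem_comp_truthMap, hm', Category.comp_id]
    refine ⟨fun ⟨y, hy⟩ => ?_, fun hx => ⟨x, hx⟩⟩
    have : x = y := by rw [← cancel_mono (toUnit φ)]; exact toUnit_unique _ _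
    rwa [this]
  exact ⟨⟨k, LocalicSpace.inverse k _ h1 h2, LocalicSpace.comp_inverse _ _ _ _,
    LocalicSpace.inverse_comp _ _ _ _⟩⟩

lemma existsUnique_hom_discrete_of_eq_top {W : LocalicSpace E} {φ : E} [Mono (toUnit φ)]
    (h : truthOpen W φ = W.opens.top (𝟙_ E)) : ∃! _h : W ⟶ discrete φ, True := by
  obtain ⟨i⟩ := nonempty_discrete_iso_openOfTruth φ
  obtain ⟨k⟩ := (nonempty_hom_openOfTruth_iff W φ).2 h
  refine ⟨k ≫ i.inv, trivial, fun l _ => ?_⟩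
  rw [← cancel_mono i.hom]
  exact Subsingleton.elim _ _

/-- The exponential `0 ^ Z` for the closed complement `Z` of a truth value. -/
lemma isExponential_closedOfTruth (φ : E) [Mono (toUnit φ)] :
    IsExponential (closedOfTruth φ).space (emptySpace E) (discrete φ) := by
  rw [isExponential_emptySpace_iff]
  refine ⟨fun T x z => ?_, fun W hW => existsUnique_hom_discrete_of_eq_top ?_⟩
  · have h1 := (nonempty_hom_closedOfTruth_iff T φ).1 ⟨z⟩
    exact LocalicSpace.isTrivial_of_bot_eq_top
      (h1.symm.trans (truthOpen_eq_top_of_hom (𝟙 φ) x))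
  -- The test space is the closed complement of `φ` in `W`. It maps to `W` and, as `φ` is `⊥` in it,
  -- to the closed complement of `φ` in `1`.
  · let C := closedSubspace W (truthOpen W φ)
    refine (isTrivial_closedSubspace_iff W (truthOpen W φ)).1 (hW C.space C.incl ?_)
    refine Nonempty.some ((nonempty_hom_closedOfTruth_iff _ φ).2 ?_)
    rw [← truthOpen_map C.incl]
    exact closedSubspace_incl_eq_bot W (truthOpen W φ)

/-- Double negation for the spatial exponential. -/
lemma nonempty_iso_of_isExponential (φ : E) [Mono (toUnit φ)] {N M : LocalicSpace E}
    (hN : IsExponential (discrete φ) (emptySpace E) N)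
    (hM : IsExponential N (emptySpace E) M) : Nonempty (M ≅ discrete φ) := by
  obtain ⟨i⟩ := hN.iso_of_hom (𝟙 _) (𝟙 _)
    (isExponential_discrete (𝟙 φ) fun ψ _ w => ⟨w⟩)
  exact hM.iso_of_hom i.hom i.inv (isExponential_closedOfTruth φ)

end Topos

end PointFree

namespace PointFree

/-! ### The quotient of `2` by a truth value, and the Boolean algebra of the exponential -/

section Sublattices

open InternalLattice

variable {E : Type u} [Category.{v} E]

namespace InternalLattice

/-- The dual of an internal lattice. -/
def dual (A : InternalLattice E) : InternalLattice E where
  obj := A.obj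
  top := A.bot
  bot := A.top
  inf := A.sup
  sup := A.inf
  comp_top := A.comp_bot
  comp_bot := A.comp_top
  comp_inf := A.comp_sup
  comp_sup := A.comp_inf
  inf_comm := A.sup_comm
  sup_comm := A.inf_comm
  inf_assoc := A.sup_assoc
  sup_assoc := A.inf_assoc
  inf_sup_self := A.sup_inf_self
  sup_inf_self := A.inf_sup_self
  inf_sup_left := sup_inf_left
  inf_top := A.sup_bot
  sup_bot := A.inf_top

variable (A : InternalLattice E) {S : E} (ι : S ⟶ A.obj) [Mono ι]
  (htop : ∀ I, ∃ w : I ⟶ S, w ≫ ι = A.top I)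
  (hbot : ∀ I, ∃ w : I ⟶ S, w ≫ ι = A.bot I)
  (hinf : ∀ {I} (a b : I ⟶ S), ∃ w : I ⟶ S, w ≫ ι = A.inf (a ≫ ι) (b ≫ ι))
  (hsup : ∀ {I} (a b : I ⟶ S), ∃ w : I ⟶ S, w ≫ ι = A.sup (a ≫ ι) (b ≫ ι))

/-- A subobject of an internal lattice that is closed under the operations. -/
noncomputable def sublattice : InternalLattice E :=
  have et := fun I => (htop I).choose_spec
  have eb := fun I => (hbot I).choose_spec
  have ei := fun {I} (a b : I ⟶ S) => (hinf a b).choose_spec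
  have es := fun {I} (a b : I ⟶ S) => (hsup a b).choose_spec
  { obj := S
    top := fun I => (htop I).choose
    bot := fun I => (hbot I).choose
    inf := fun a b => (hinf a b).choose
    sup := fun a b => (hsup a b).choose
    comp_top := fun u => by rw [← cancel_mono ι, Category.assoc, et, et, A.comp_top]
    comp_bot := fun u => by rw [← cancel_mono ι, Category.assoc, eb, eb, A.comp_bot]
    comp_inf := fun u a b => by
      rw [← cancel_mono ι, Category.assoc, ei, ei, A.comp_inf, Category.assoc, Category.assoc]
    comp_sup := fun u a b => by
      rw [← cancel_mono ι, Category.assoc, es, es, A.comp_sup, Category.assoc, Category.assoc]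
    inf_comm := fun a b => by rw [← cancel_mono ι, ei, ei, A.inf_comm]
    sup_comm := fun a b => by rw [← cancel_mono ι, es, es, A.sup_comm]
    inf_assoc := fun a b c => by rw [← cancel_mono ι, ei, ei, ei, ei, A.inf_assoc]
    sup_assoc := fun a b c => by rw [← cancel_mono ι, es, es, es, es, A.sup_assoc]
    inf_sup_self := fun a b => by rw [← cancel_mono ι, ei, es, A.inf_sup_self]
    sup_inf_self := fun a b => by rw [← cancel_mono ι, es, ei, A.sup_inf_self]
    inf_sup_left := fun a b c => by rw [← cancel_mono ι, ei, es, es, ei, ei, A.inf_sup_left]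
    inf_top := fun a => by rw [← cancel_mono ι, ei, et, A.inf_top]
    sup_bot := fun a => by rw [← cancel_mono ι, es, eb, A.sup_bot] }

/-- The inclusion of a sublattice. -/
noncomputable def sublatticeHom : Hom (A.sublattice ι htop hbot hinf hsup) A where
  map := ι
  top_map I := (htop I).choose_spec
  bot_map I := (hbot I).choose_spec
  inf_map a b := (hinf a b).choose_spec
  sup_map a b := (hsup a b).choose_spec

end InternalLattice

end Sublattices

section Topos

open HasSubobjectClassifier MonoidalClosed InternalLattice

variable {E : Type u} [Category.{v} E] [CartesianMonoidalCategory E] [HasFiniteLimits E]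
  [HasSubobjectClassifier E] [MonoidalClosed E]

lemma comp_eqv' {X I J : E} (u : J ⟶ I) (x y : I ⟶ X) : u ≫ eqv x y = eqv (u ≫ x) (u ≫ y) := by
  apply truth_ext
  intro K v
  rw [← Category.assoc, comp_eqv, comp_eqv, Category.assoc, Category.assoc]

lemma eqv_eq_tr_iff {X I : E} (x y : I ⟶ X) : eqv x y = tr I ↔ x = y := by
  have := comp_eqv x y (𝟙 I)
  simpa only [Category.id_comp] using this

namespace InternalLattice

variable {A B C : InternalLattice E}

/-- The generalized element `a` is covered by the two cases `a = 0` and `a = 1`. -/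
def IsBit {I : E} (a : I ⟶ A.obj) : Prop :=
  tOr (eqv a (A.bot I)) (eqv a (A.top I)) = tr I

/-- Being covered by the two cases is a truth value stable under change of stage, so it cuts out a
subobject of the lattice. -/
lemma isBit_comp_iff {I J : E} (u : J ⟶ I) (a : I ⟶ A.obj) :
    IsBit (u ≫ a) ↔ u ≫ tOr (eqv a (A.bot I)) (eqv a (A.top I)) = tr J := by
  rw [comp_tOr, comp_eqv', comp_eqv', A.comp_bot, A.comp_top]
  rfl

lemma IsBit.comp {I J : E} {a : I ⟶ A.obj} (h : IsBit a) (u : J ⟶ I) : IsBit (u ≫ a) := by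
  rw [isBit_comp_iff]
  exact (congrArg _ h).trans (comp_tr u)

lemma isBit_bot (I : E) : IsBit (A.bot I) := by
  have h := ((tOr_le_iff (eqv (A.bot I) (A.bot I)) (eqv (A.bot I) (A.top I)) _).1
    fun _ _ h => h).1 (𝟙 I)
  rw [Category.id_comp, Category.id_comp] at h
  exact h ((eqv_eq_tr_iff _ _).2 rfl)

lemma isBit_top (I : E) : IsBit (A.top I) := by
  have h := ((tOr_le_iff (eqv (A.top I) (A.bot I)) (eqv (A.top I) (A.top I)) _).1
    fun _ _ h => h).2 (𝟙 I)
  rw [Category.id_comp, Category.id_comp] at h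
  exact h ((eqv_eq_tr_iff _ _).2 rfl)

/-- Proof by cases of a truth value. -/
lemma IsBit.elim {I : E} {a : I ⟶ A.obj} (h : IsBit a) {t : I ⟶ Ω E}
    (h0 : ∀ ⦃T : E⦄ (u : T ⟶ I), u ≫ a = A.bot T → u ≫ t = tr T)
    (h1 : ∀ ⦃T : E⦄ (u : T ⟶ I), u ≫ a = A.top T → u ≫ t = tr T) : t = tr I := by
  have k := (tOr_le_iff (eqv a (A.bot I)) (eqv a (A.top I)) t).2
    ⟨fun T u hu => h0 u (by rwa [comp_eqv, A.comp_bot] at hu),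
      fun T u hu => h1 u (by rwa [comp_eqv, A.comp_top] at hu)⟩ (𝟙 I)
  rw [Category.id_comp, Category.id_comp] at k
  exact k h

/-- Proof by cases of an equality. -/
lemma IsBit.ext {I X : E} {a : I ⟶ A.obj} (h : IsBit a) {x y : I ⟶ X}
    (h0 : ∀ ⦃T : E⦄ (u : T ⟶ I), u ≫ a = A.bot T → u ≫ x = u ≫ y)
    (h1 : ∀ ⦃T : E⦄ (u : T ⟶ I), u ≫ a = A.top T → u ≫ x = u ≫ y) : x = y := by
  rw [← eqv_eq_tr_iff]
  exact h.elim (fun T u hu => (comp_eqv _ _ _).2 (h0 u hu))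
    fun T u hu => (comp_eqv _ _ _).2 (h1 u hu)

lemma IsBit.of_cases {I : E} {a : I ⟶ A.obj} (h : IsBit a) {b : I ⟶ B.obj}
    (h0 : ∀ ⦃T : E⦄ (u : T ⟶ I), u ≫ a = A.bot T → IsBit (u ≫ b))
    (h1 : ∀ ⦃T : E⦄ (u : T ⟶ I), u ≫ a = A.top T → IsBit (u ≫ b)) : IsBit b :=
  h.elim (fun _ u hu => (isBit_comp_iff u b).1 (h0 u hu))
    fun _ u hu => (isBit_comp_iff u b).1 (h1 u hu)

lemma bot_inf {I : E} (a : I ⟶ A.obj) : A.inf (A.bot I) a = A.bot I := by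
  rw [A.inf_comm, inf_bot]

lemma top_inf {I : E} (a : I ⟶ A.obj) : A.inf (A.top I) a = a := by
  rw [A.inf_comm, A.inf_top]

lemma bot_sup {I : E} (a : I ⟶ A.obj) : A.sup (A.bot I) a = a := by
  rw [A.sup_comm, A.sup_bot]

lemma top_sup {I : E} (a : I ⟶ A.obj) : A.sup (A.top I) a = A.top I := by
  rw [A.sup_comm, sup_top]

lemma IsBit.inf {I : E} {a b : I ⟶ A.obj} (ha : IsBit a) (hb : IsBit b) :
    IsBit (A.inf a b) :=
  ha.of_cases (fun T u hu => by rw [A.comp_inf, hu, bot_inf]; exact isBit_bot T)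
    fun T u hu => by rw [A.comp_inf, hu, top_inf]; exact hb.comp u

lemma IsBit.sup {I : E} {a b : I ⟶ A.obj} (ha : IsBit a) (hb : IsBit b) :
    IsBit (A.sup a b) :=
  ha.of_cases (fun T u hu => by rw [A.comp_sup, hu, bot_sup]; exact hb.comp u)
    fun T u hu => by rw [A.comp_sup, hu, top_sup]; exact isBit_top T

lemma exists_mono_isBit_iff (A : InternalLattice E) :
    ∃ (S : E) (ι : S ⟶ A.obj), Mono ι ∧
      ∀ {I : E} (a : I ⟶ A.obj), IsBit a ↔ ∃ w : I ⟶ S, w ≫ ι = a := by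
  refine ⟨_, equalizer.ι (tOr (eqv (𝟙 A.obj) (A.bot _)) (eqv (𝟙 A.obj) (A.top _))) (tr _),
    inferInstance, fun {I} a => ?_⟩
  have h := isBit_comp_iff a (𝟙 A.obj)
  rw [Category.comp_id] at h
  rw [h]
  constructor
  · intro h
    exact ⟨equalizer.lift a (by rw [h, comp_tr]), equalizer.lift_ι _ _⟩
  · rintro ⟨w, rfl⟩
    rw [Category.assoc, equalizer.condition, comp_tr, comp_tr]

/-- The elements `0` and `1` of an internal lattice form a sublattice. -/
lemma exists_isQuotientOfTwo {φ : E} (hA : ∀ I : E, A.bot I = A.top I ↔ Nonempty (I ⟶ φ)) :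
    ∃ B : InternalLattice E, IsQuotientOfTwo φ B ∧ Nonempty (Hom B A) := by
  obtain ⟨S, ι, hι, h⟩ := exists_mono_isBit_iff A
  have hb : ∀ {I : E} (w : I ⟶ S), IsBit (w ≫ ι) := fun w => (h _).2 ⟨w, rfl⟩
  let B := A.sublattice ι (fun I => (h _).1 (isBit_top I)) (fun I => (h _).1 (isBit_bot I))
    (fun a b => (h _).1 ((hb a).inf (hb b))) (fun a b => (h _).1 ((hb a).sup (hb b)))
  let i : Hom B A := A.sublatticeHom ι _ _ _ _
  refine ⟨B, ⟨fun {Z} g k h0 h1 => ?_, fun I => ?_⟩, ⟨i⟩⟩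
  · have hι' : IsBit (A := A) ι := (h ι).2 ⟨𝟙 S, Category.id_comp _⟩
    have h0' : ∀ T, B.bot T ≫ g = B.bot T ≫ k := fun T => by
      rw [← B.comp_bot (toUnit T), Category.assoc, h0, Category.assoc]
    have h1' : ∀ T, B.top T ≫ g = B.top T ≫ k := fun T => by
      rw [← B.comp_top (toUnit T), Category.assoc, h1, Category.assoc]
    refine hι'.ext (fun T u hu => ?_) fun T u hu => ?_
    · have e : u = B.bot T := (cancel_mono ι).1 (hu.trans (i.bot_map T).symm)
      exact (congrArg (· ≫ g) e).trans ((h0' T).trans (congrArg (· ≫ k) e.symm))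
    · have e : u = B.top T := (cancel_mono ι).1 (hu.trans (i.top_map T).symm)
      exact (congrArg (· ≫ g) e).trans ((h1' T).trans (congrArg (· ≫ k) e.symm))
  · rw [← hA, ← i.bot_map, ← i.top_map]
    exact (cancel_mono ι).symm

end InternalLattice

namespace IsQuotientOfTwo

variable {φ : E} {B C : InternalLattice E} (hB : IsQuotientOfTwo φ B)

include hB

/-- For the generic element this is an equation between two maps from `B` to `Ω`, which joint
epimorphy reduces to `0` and `1`. -/
lemma isBit {I : E} (b : I ⟶ B.obj) : IsBit b := by
  have h : IsBit (𝟙 B.obj) := by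
    refine hB.jointly_epi _ _ ?_ ?_
    · rw [comp_tr, ← isBit_comp_iff, Category.comp_id]
      exact isBit_bot _
    · rw [comp_tr, ← isBit_comp_iff, Category.comp_id]
      exact isBit_top _
  simpa using h.comp b

/-- Unique choice: a subobject that contains `0` and `1` is everything. -/
lemma isIso {P : E} (m : P ⟶ B.obj) [Mono m] (h0 : ∃ w, w ≫ m = B.bot (𝟙_ E))
    (h1 : ∃ w, w ≫ m = B.top (𝟙_ E)) : IsIso m := by
  have : Epi m := ⟨fun g k hgk => by
    obtain ⟨w0, h0⟩ := h0
    obtain ⟨w1, h1⟩ := h1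
    refine hB.jointly_epi g k ?_ ?_
    · rw [← h0, Category.assoc, hgk, Category.assoc]
    · rw [← h1, Category.assoc, hgk, Category.assoc]⟩
  exact isIso_of_mono_of_epi m

/-- The map is given by its graph, the relation `(b = 0 ⇒ c = 0) ∧ (b = 1 ⇒ c = 1)`. It is
single-valued because every `b` is covered by the two cases. It is defined at `0` and `1` because
where they coincide in `B` they also coincide in `C`. So its projection to `B` is an isomorphism. -/
lemma exists_map (hC : C.bot φ = C.top φ) : ∃ h : B.obj ⟶ C.obj,
    B.bot (𝟙_ E) ≫ h = C.bot (𝟙_ E) ∧ B.top (𝟙_ E) ≫ h = C.top (𝟙_ E) := by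
  let b := fst B.obj C.obj
  let c := snd B.obj C.obj
  let t := tAnd (tImp (eqv b (B.bot _)) (eqv c (C.bot _))) (tImp (eqv b (B.top _)) (eqv c (C.top _)))
  let ρ := equalizer.ι t (tr _)
  have hρ : ∀ {I : E} (z : I ⟶ B.obj ⊗ C.obj), (∃ w, w ≫ ρ = z) ↔
      (∀ ⦃T : E⦄ (u : T ⟶ I), u ≫ z ≫ b = B.bot T → u ≫ z ≫ c = C.bot T) ∧
      (∀ ⦃T : E⦄ (u : T ⟶ I), u ≫ z ≫ b = B.top T → u ≫ z ≫ c = C.top T) := by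
    intro I z
    have e : (∃ w, w ≫ ρ = z) ↔ z ≫ t = tr I := by
      constructor
      · rintro ⟨w, rfl⟩
        rw [Category.assoc, equalizer.condition, comp_tr, comp_tr]
      · intro h
        exact ⟨equalizer.lift z (by rw [h, comp_tr]), equalizer.lift_ι _ _⟩
    rw [e, comp_tAnd, comp_tImp, comp_tImp]
    simp only [← Category.assoc, comp_eqv]
    simp only [B.comp_bot, B.comp_top, C.comp_bot, C.comp_top]
  have hm : Mono (ρ ≫ b) := ⟨fun {I} x y hxy => by
    have hx := (hρ (x ≫ ρ)).1 ⟨x, rfl⟩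
    have hy := (hρ (y ≫ ρ)).1 ⟨y, rfl⟩
    rw [← Category.assoc, ← Category.assoc] at hxy
    rw [← cancel_mono ρ]
    ext
    · exact hxy
    · refine (hB.isBit ((x ≫ ρ) ≫ b)).ext (fun T u hu => ?_) fun T u hu => ?_
      · exact (hx.1 u hu).trans (hy.1 u (by rw [← hxy]; exact hu)).symm
      · exact (hx.2 u hu).trans (hy.2 u (by rw [← hxy]; exact hu)).symm⟩
  have key : ∀ T : E, B.bot T = B.top T → C.bot T = C.top T := fun T h => by
    obtain ⟨w⟩ := (hB.bot_eq_top_iff T).1 h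
    exact bot_eq_top_comp hC w
  obtain ⟨w0, hw0⟩ := (hρ (lift (B.bot (𝟙_ E)) (C.bot (𝟙_ E)))).2 (by
    simp only [b, c, lift_fst, lift_snd, B.comp_bot, C.comp_bot]
    exact ⟨fun _ _ _ => trivial, fun T _ h => key T h⟩)
  obtain ⟨w1, hw1⟩ := (hρ (lift (B.top (𝟙_ E)) (C.top (𝟙_ E)))).2 (by
    simp only [b, c, lift_fst, lift_snd, B.comp_top, C.comp_top]
    exact ⟨fun T _ h => (key T h.symm).symm, fun _ _ _ => trivial⟩)
  have e0 : w0 ≫ ρ ≫ b = B.bot (𝟙_ E) := by rw [← Category.assoc, hw0]; exact lift_fst _ _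
  have e1 : w1 ≫ ρ ≫ b = B.top (𝟙_ E) := by rw [← Category.assoc, hw1]; exact lift_fst _ _
  have := hB.isIso (ρ ≫ b) ⟨w0, e0⟩ ⟨w1, e1⟩
  refine ⟨inv (ρ ≫ b) ≫ ρ ≫ c, ?_, ?_⟩
  · rw [← e0, Category.assoc, IsIso.hom_inv_id_assoc, ← Category.assoc, hw0]
    exact lift_snd _ _
  · rw [← e1, Category.assoc, IsIso.hom_inv_id_assoc, ← Category.assoc, hw1]
    exact lift_snd _ _

/-- The lattice equations are checked by cases on the first argument alone. -/
lemma existsUnique_hom (hC : C.bot φ = C.top φ) : ∃! _h : Hom B C, True := by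
  obtain ⟨h, h0, h1⟩ := hB.exists_map hC
  have e0 : ∀ I, B.bot I ≫ h = C.bot I := fun I => by
    rw [← B.comp_bot (toUnit I), Category.assoc, h0, C.comp_bot]
  have e1 : ∀ I, B.top I ≫ h = C.top I := fun I => by
    rw [← B.comp_top (toUnit I), Category.assoc, h1, C.comp_top]
  refine ⟨⟨h, e1, e0, fun {I} a b => ?_, fun {I} a b => ?_⟩, trivial, fun k _ => ?_⟩
  · refine (hB.isBit a).ext (fun T u hu => ?_) fun T u hu => ?_
    · rw [C.comp_inf, ← Category.assoc, ← Category.assoc, B.comp_inf, hu, bot_inf, e0, bot_inf]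
    · rw [C.comp_inf, ← Category.assoc, ← Category.assoc, ← Category.assoc, B.comp_inf, hu,
        top_inf, e1, top_inf]
  · refine (hB.isBit a).ext (fun T u hu => ?_) fun T u hu => ?_
    · rw [C.comp_sup, ← Category.assoc, ← Category.assoc, ← Category.assoc, B.comp_sup, hu,
        bot_sup, e0, bot_sup]
    · rw [C.comp_sup, ← Category.assoc, ← Category.assoc, B.comp_sup, hu, top_sup, e1, top_sup]
  · apply Hom.ext
    refine hB.jointly_epi _ _ ?_ ?_
    · rw [k.bot_map, h0]
    · rw [k.top_map, h1]

/-- Complementation is the homomorphism from `B` to its dual, in which `0 = 1` holds at `φ` as well.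
-/
lemma isBoolean : B.IsBoolean := by
  have hd : B.dual.bot φ = B.dual.top φ := ((hB.bot_eq_top_iff φ).2 ⟨𝟙 φ⟩).symm
  obtain ⟨n, n0, n1⟩ : ∃ n : B.obj ⟶ B.obj, (∀ I, B.bot I ≫ n = B.top I) ∧
      ∀ I, B.top I ≫ n = B.bot I := by
    obtain ⟨n, -, -⟩ := hB.existsUnique_hom hd
    exact ⟨n.map, n.bot_map, n.top_map⟩
  intro I a
  refine ⟨a ≫ n, ?_, ?_⟩
  · refine (hB.isBit a).ext (fun T u hu => ?_) fun T u hu => ?_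
    · rw [B.comp_inf, ← Category.assoc, hu, bot_inf, B.comp_bot]
    · rw [B.comp_inf, ← Category.assoc, hu, n1, inf_bot, B.comp_bot]
  · refine (hB.isBit a).ext (fun T u hu => ?_) fun T u hu => ?_
    · rw [B.comp_sup, ← Category.assoc, hu, n0, sup_top, B.comp_top]
    · rw [B.comp_sup, ← Category.assoc, hu, top_sup, B.comp_top]

/-- The relation `1 ≤ 0` at stage `X` says that `X` maps to the subobject of `1` where `C`
degenerates. By `hφ` so does `φ`, and `existsUnique_hom` applies. The hypotheses `e` and `hφ`
characterize `φ` as the image of `X` in `1`. -/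
lemma isFreeOnRelations {X : E} (e : X ⟶ φ)
    (hφ : ∀ (ψ : E) [Mono (toUnit ψ)], (X ⟶ ψ) → Nonempty (φ ⟶ ψ)) : IsFreeOnRelations X B where
  isBoolean := hB.isBoolean
  rel := le_of_bot_eq_top ((hB.bot_eq_top_iff X).2 ⟨e⟩) _ _
  existsUnique_hom C _ hC := by
    refine hB.existsUnique_hom ?_
    rw [top_le_iff_eq, bot_eq_top_iff_nonempty] at hC
    rw [bot_eq_top_iff_nonempty]
    exact hφ _ hC.some

end IsQuotientOfTwo

/-- The frame of the closed complement degenerates exactly where `φ` holds, so its elements `0` and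
`1` supply the quotient of `2`, already embedded in the opens. -/
lemma closedOfTruth_bot_eq_top_iff (φ : E) [Mono (toUnit φ)] (I : E) :
    (closedOfTruth φ).space.opens.bot I = (closedOfTruth φ).space.opens.top I ↔
      Nonempty (I ⟶ φ) := by
  rw [← (closedOfTruth φ).incl.inv.bot_map, ← (closedOfTruth φ).incl.inv.top_map]
  refine (closedSubspace_incl_eq_iff (point E) (openOf (toUnit φ)) _ _).trans ?_
  rw [bot_sup, top_sup, ← holds_iff_eq_top, constAt, holds_openOf]

/-- The closed complement of a truth value is Stone. -/
lemma IsQuotientOfTwo.isSpec {φ : E} [Mono (toUnit φ)] {B : InternalLattice E}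
    (hB : IsQuotientOfTwo φ B) (η : Hom B (closedOfTruth φ).space.opens) :
    IsSpec B (closedOfTruth φ).space := by
  refine ⟨η, fun W h => ?_⟩
  have hW : W.opens.bot φ = W.opens.top φ := by
    rw [← h.bot_map, ← h.top_map, (hB.bot_eq_top_iff φ).2 ⟨𝟙 φ⟩]
  obtain ⟨g⟩ := (nonempty_hom_closedOfTruth_iff W φ).2 ((truthOpen_eq_bot_iff W φ).2 hW)
  refine ⟨g, ?_, fun _ _ => Subsingleton.elim _ _⟩
  refine hB.jointly_epi _ _ ?_ ?_
  · rw [← Category.assoc, η.bot_map, g.inv.bot_map, h.bot_map]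
  · rw [← Category.assoc, η.top_map, g.inv.top_map, h.top_map]

lemma exists_isFreeOnRelations {X φ : E} [Mono (toUnit φ)] (e : X ⟶ φ)
    (hφ : ∀ (ψ : E) [Mono (toUnit ψ)], (X ⟶ ψ) → Nonempty (φ ⟶ ψ)) :
    ∃ B : InternalLattice E, IsFreeOnRelations X B ∧ IsQuotientOfTwo φ B ∧
      IsSpec B (closedOfTruth φ).space := by
  obtain ⟨B, hB, ⟨η⟩⟩ := exists_isQuotientOfTwo (closedOfTruth_bot_eq_top_iff φ)
  exact ⟨B, hB.isFreeOnRelations e hφ, hB, hB.isSpec η⟩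

end Topos

end PointFree

namespace PointFree

/-! ### Residuals in internal frames, and subframes -/

namespace InternalLattice

section

variable {E : Type u} [Category.{v} E] {A : InternalLattice E}

/-- Internal joins are stable under change of base. -/
lemma IsJoin.of_isPullback {I J I' J' : E} {f : J ⟶ I} {f' : J' ⟶ I'} {w : J' ⟶ J} {v : I' ⟶ I}
    (hp : IsPullback w f' f v) {a : J ⟶ A.obj} {s : I ⟶ A.obj} (h : A.IsJoin f a s) :
    A.IsJoin f' (w ≫ a) (v ≫ s) := by
  intro K u b
  have h1 := h (u ≫ v) b
  rw [Category.assoc] at h1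
  rw [h1]
  constructor
  · intro h T p q hpq
    rw [← Category.assoc q]
    exact h p (q ≫ w) (by rw [← Category.assoc, hpq, Category.assoc, Category.assoc, hp.w])
  · intro h T p q hpq
    have h2 := h p (hp.lift q (p ≫ u) (by rw [← hpq, Category.assoc])) (by simp)
    rwa [hp.lift_fst_assoc] at h2

lemma inf_eq_top_iff_and {I : E} {a b : I ⟶ A.obj} :
    A.inf a b = A.top I ↔ a = A.top I ∧ b = A.top I := by
  rw [← top_le_iff_eq, le_meet_iff, top_le_iff_eq, top_le_iff_eq]

lemma inf_le_inf' {I : E} {a b c : I ⟶ A.obj} (h : A.le a b) : A.le (A.inf a c) (A.inf b c) :=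
  le_meet_iff.2 ⟨(le_meet_iff.1 (A.le_refl _)).1.trans h, (le_meet_iff.1 (A.le_refl _)).2⟩

end

section

open HasSubobjectClassifier MonoidalClosed

variable {E : Type u} [Category.{v} E] [CartesianMonoidalCategory E] [HasFiniteLimits E]
  [HasSubobjectClassifier E] [MonoidalClosed E] {A : InternalLattice E}

lemma exists_mono_iff_eq_tr {I : E} (t : I ⟶ Ω E) : ∃ (S : E) (ι : S ⟶ I), Mono ι ∧
    ∀ ⦃T : E⦄ (u : T ⟶ I), u ≫ t = tr T ↔ ∃ w : T ⟶ S, w ≫ ι = u := by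
  refine ⟨_, equalizer.ι t (tr I), inferInstance, fun T u => ?_⟩
  constructor
  · intro h
    exact ⟨equalizer.lift u (by rw [h, comp_tr]), equalizer.lift_ι _ _⟩
  · rintro ⟨w, rfl⟩
    rw [Category.assoc, equalizer.condition, comp_tr, comp_tr]

lemma comp_eqv_inf_iff {I K : E} (a b : I ⟶ A.obj) (v : K ⟶ I) :
    v ≫ eqv (A.inf a b) a = tr K ↔ A.le (v ≫ a) (v ≫ b) := by
  rw [comp_eqv, A.comp_inf]; rfl

/-- In an internal frame there are internal meets of families of implications. -/
lemma IsFrame.exists_residual (hA : A.IsFrame) {I J : E} (f : J ⟶ I) (y z : J ⟶ A.obj) :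
    ∃ w : I ⟶ A.obj, ∀ ⦃K : E⦄ (u : K ⟶ I) (x : K ⟶ A.obj), A.le x (u ≫ w) ↔
      ∀ ⦃T : E⦄ (p : T ⟶ K) (q : T ⟶ J), p ≫ u = q ≫ f →
        A.le (A.inf (p ≫ x) (q ≫ y)) (q ≫ z) := by
  let j := fst J (A.obj ⊗ I)
  let a := snd J (A.obj ⊗ I) ≫ fst A.obj I
  let i := snd J (A.obj ⊗ I) ≫ snd A.obj I
  -- `D` consists of the pairs `(a, i)` such that `a ⊓ y j ≤ z j` for all `j` over `i`; the residual
  -- at `i` is the join of these `a`.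
  obtain ⟨D, δ, -, hδ⟩ := exists_mono_iff_eq_tr (tAll (X := J) (I := A.obj ⊗ I)
    (tImp (eqv (j ≫ f) i) (eqv (A.inf (A.inf a (j ≫ y)) (j ≫ z)) (A.inf a (j ≫ y)))))
  have hδ' : ∀ {K : E} (x : K ⟶ A.obj) (u : K ⟶ I), (∃ d : K ⟶ D, d ≫ δ = lift x u) ↔
      ∀ ⦃T : E⦄ (p : T ⟶ K) (q : T ⟶ J), p ≫ u = q ≫ f →
        A.le (A.inf (p ≫ x) (q ≫ y)) (q ≫ z) := by
    intro K x u
    rw [← hδ, comp_tAll]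
    simp only [comp_tImp, ← Category.assoc, comp_eqv, A.comp_inf]
    simp only [Category.assoc, j, a, i, lift_snd_assoc, lift_fst, lift_snd]
    constructor
    · intro h T p q hpq
      have := h p q (𝟙 T) (by simp [hpq])
      simpa [le] using this
    · intro h T p q S r hr
      have := h (r ≫ p) (r ≫ q) (by simpa using hr.symm)
      simpa [le] using this
  obtain ⟨w, hw⟩ := hA.exists_join (δ ≫ snd _ _) (δ ≫ fst _ _)
  refine ⟨w, fun K u x => ⟨fun hx T p q hpq => ?_, fun hx => ?_⟩⟩
  -- The join itself satisfies the defining inequality: after base change to the stage of `q`, the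
  -- meet with `y` distributes over it.
  · have hj := hw.of_isPullback (IsPullback.of_hasPullback (δ ≫ snd _ _) (q ≫ f))
    have hj2 := hA.inf_join _ _ _ (q ≫ y) hj
    have h1 : A.le (A.inf (p ≫ x) (q ≫ y)) (A.inf (q ≫ y) ((q ≫ f) ≫ w)) := by
      rw [A.inf_comm (q ≫ y), ← hpq, Category.assoc]
      exact inf_le_inf' (hx.comp p)
    refine h1.trans ((hj2.le_iff _).2 ?_)
    rw [A.inf_comm]
    have h2 := (hδ' (pullback.fst (δ ≫ snd _ _) (q ≫ f) ≫ δ ≫ fst _ _)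
      (pullback.fst (δ ≫ snd _ _) (q ≫ f) ≫ δ ≫ snd _ _)).1
      ⟨pullback.fst (δ ≫ snd _ _) (q ≫ f), by ext <;> simp⟩ (𝟙 _)
      (pullback.snd (δ ≫ snd _ _) (q ≫ f) ≫ q) (by
        rw [Category.id_comp, pullback.condition, Category.assoc])
    rw [Category.id_comp, Category.assoc, Category.assoc] at h2
    exact h2
  · obtain ⟨d, hd⟩ := (hδ' x u).2 hx
    have h1 := (hw u (u ≫ w)).1 (A.le_refl _) (𝟙 K) d (by
      rw [Category.id_comp, ← Category.assoc, hd, lift_snd])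
    rwa [← Category.assoc, hd, lift_fst, Category.id_comp] at h1

/-- A subobject of an internal lattice which is a frame for the induced order, with the same
finite meets. -/
structure Subframe (G : InternalLattice E) where
  obj : E
  ι : obj ⟶ G.obj
  mono : Mono ι
  top : ∀ I, ∃ w : I ⟶ obj, w ≫ ι = G.top I
  inf : ∀ {I} (a b : I ⟶ obj), ∃ w : I ⟶ obj, w ≫ ι = G.inf (a ≫ ι) (b ≫ ι)
  meet : ∀ {I J : E} (f : J ⟶ I) (b : J ⟶ obj), ∃ w : I ⟶ obj, ∀ ⦃K : E⦄ (u : K ⟶ I)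
    (x : K ⟶ obj), G.le (x ≫ ι) (u ≫ w ≫ ι) ↔ ∀ ⦃T : E⦄ (p : T ⟶ K) (q : T ⟶ J),
      p ≫ u = q ≫ f → G.le (p ≫ x ≫ ι) (q ≫ b ≫ ι)
  imp : ∀ {K : E} (y z : K ⟶ obj), ∃ w : K ⟶ obj, ∀ ⦃T : E⦄ (p : T ⟶ K) (x : T ⟶ obj),
    G.le (x ≫ ι) (p ≫ w ≫ ι) ↔ G.le (G.inf (x ≫ ι) (p ≫ y ≫ ι)) (p ≫ z ≫ ι)

namespace Subframe

variable {G : InternalLattice E} (F : Subframe G)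

instance : Mono F.ι := F.mono

/-- The induced order. -/
def Le {I : E} (a b : I ⟶ F.obj) : Prop := G.le (a ≫ F.ι) (b ≫ F.ι)

variable {F}

lemma Le.comp {I J : E} {a b : I ⟶ F.obj} (h : F.Le a b) (u : J ⟶ I) : F.Le (u ≫ a) (u ≫ b) := by
  unfold Le
  rw [Category.assoc, Category.assoc]
  exact le.comp h u

lemma Le.antisymm {I : E} {a b : I ⟶ F.obj} (h : F.Le a b) (k : F.Le b a) : a = b := by
  rw [← cancel_mono F.ι]
  exact le.antisymm h k

lemma eq_of_forall {I : E} {a b : I ⟶ F.obj} (h : ∀ c, F.Le a c ↔ F.Le b c) : a = b :=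
  Le.antisymm ((h b).2 (G.le_refl _)) ((h a).1 (G.le_refl _))

variable (F)

/-- The meet of the elements with a given property. -/
lemma exists_least {I : E} (t : F.obj ⊗ I ⟶ Ω E) : ∃ s : I ⟶ F.obj,
    ∀ ⦃K : E⦄ (u : K ⟶ I) (z : K ⟶ F.obj), F.Le z (u ≫ s) ↔
      ∀ ⦃T : E⦄ (p : T ⟶ K) (b : T ⟶ F.obj), lift b (p ≫ u) ≫ t = tr T → F.Le (p ≫ z) b := by
  obtain ⟨D, δ, -, hδ⟩ := exists_mono_iff_eq_tr t
  obtain ⟨s, hs⟩ := F.meet (δ ≫ snd _ _) (δ ≫ fst _ _)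
  refine ⟨s, fun K u z => ?_⟩
  unfold Le
  simp only [Category.assoc] at hs ⊢
  rw [hs]
  simp only [hδ]
  constructor
  · rintro h T p b ⟨d, hd⟩
    have h1 := h p d (by rw [← Category.assoc, hd, lift_snd])
    rwa [← Category.assoc d, hd, lift_fst_assoc] at h1
  · intro h T p q hpq
    have h1 := h p (q ≫ δ ≫ fst _ _) ⟨q, by ext <;> simp [hpq]⟩
    simpa using h1

/-- Joins of families, from joins in the order-theoretic sense: the least upper bound for an
upper bound property that is stable under change of base. -/
lemma exists_lub {I : E} (t : F.obj ⊗ I ⟶ Ω E)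
    (P : ∀ {K : E}, (K ⟶ F.obj) → (K ⟶ I) → Prop)
    (hP : ∀ {K : E} (b : K ⟶ F.obj) (u : K ⟶ I), lift b u ≫ t = tr K ↔ P b u)
    (hP' : ∀ (s : I ⟶ F.obj), (∀ ⦃K : E⦄ (u : K ⟶ I) (z : K ⟶ F.obj), F.Le z (u ≫ s) ↔
      ∀ ⦃T : E⦄ (p : T ⟶ K) (b : T ⟶ F.obj), P b (p ≫ u) → F.Le (p ≫ z) b) →
      ∀ {K : E} (u : K ⟶ I) (b : K ⟶ F.obj), F.Le (u ≫ s) b → P b u) :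
    ∃ s : I ⟶ F.obj, ∀ ⦃K : E⦄ (u : K ⟶ I) (b : K ⟶ F.obj), F.Le (u ≫ s) b ↔ P b u := by
  obtain ⟨s, hs⟩ := F.exists_least t
  simp only [hP] at hs
  refine ⟨s, fun K u b => ⟨hP' s hs u b, fun h => ?_⟩⟩
  have := (hs u (u ≫ s)).1 (G.le_refl _) (𝟙 K) b (by rwa [Category.id_comp])
  rwa [Category.id_comp] at this

lemma comp_leT_iff {I K : E} (a b : I ⟶ F.obj) (v : K ⟶ I) :
    v ≫ eqv (G.inf (a ≫ F.ι) (b ≫ F.ι)) (a ≫ F.ι) = tr K ↔ F.Le (v ≫ a) (v ≫ b) := by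
  rw [comp_eqv_inf_iff, Le, Category.assoc, Category.assoc]

/-- Joins in a subframe need not be those of the ambient frame. Empty, binary and indexed joins are
each obtained as the meet of all upper bounds, with "upper bound" expressed as a truth value. -/
lemma exists_bot (I : E) : ∃ s : I ⟶ F.obj, ∀ ⦃K : E⦄ (u : K ⟶ I) (b : K ⟶ F.obj),
    F.Le (u ≫ s) b := by
  obtain ⟨s, hs⟩ := F.exists_lub (I := I) (tr _) (fun _ _ => True)
    (fun b u => iff_true_intro (comp_tr _)) (fun _ _ _ _ _ _ => trivial)
  exact ⟨s, fun K u b => (hs u b).2 trivial⟩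

lemma exists_sup {I : E} (x y : I ⟶ F.obj) : ∃ s : I ⟶ F.obj, ∀ ⦃K : E⦄ (u : K ⟶ I)
    (b : K ⟶ F.obj), F.Le (u ≫ s) b ↔ F.Le (u ≫ x) b ∧ F.Le (u ≫ y) b := by
  let b := fst F.obj I
  let i := snd F.obj I
  refine F.exists_lub (tAnd (eqv (G.inf ((i ≫ x) ≫ F.ι) (b ≫ F.ι)) ((i ≫ x) ≫ F.ι))
    (eqv (G.inf ((i ≫ y) ≫ F.ι) (b ≫ F.ι)) ((i ≫ y) ≫ F.ι)))
    (fun b u => F.Le (u ≫ x) b ∧ F.Le (u ≫ y) b) (fun c u => ?_) fun s hs K u b h => ?_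
  · rw [comp_tAnd, comp_leT_iff, comp_leT_iff]
    simp only [b, i, lift_fst, lift_snd_assoc]
  · constructor
    · refine le.trans ((hs u (u ≫ x)).2 fun T p b hb => ?_) h
      simpa using hb.1
    · refine le.trans ((hs u (u ≫ y)).2 fun T p b hb => ?_) h
      simpa using hb.2

lemma exists_join {I J : E} (f : J ⟶ I) (x : J ⟶ F.obj) : ∃ s : I ⟶ F.obj, ∀ ⦃K : E⦄ (u : K ⟶ I)
    (b : K ⟶ F.obj), F.Le (u ≫ s) b ↔ ∀ ⦃T : E⦄ (p : T ⟶ K) (q : T ⟶ J), p ≫ u = q ≫ f →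
      F.Le (q ≫ x) (p ≫ b) := by
  let j := fst J (F.obj ⊗ I)
  let b := snd J (F.obj ⊗ I) ≫ fst F.obj I
  let i := snd J (F.obj ⊗ I) ≫ snd F.obj I
  refine F.exists_lub (tAll (X := J) (I := F.obj ⊗ I) (tImp (eqv (j ≫ f) i)
    (eqv (G.inf ((j ≫ x) ≫ F.ι) (b ≫ F.ι)) ((j ≫ x) ≫ F.ι))))
    (fun {K} b u => ∀ ⦃T : E⦄ (p : T ⟶ K) (q : T ⟶ J), p ≫ u = q ≫ f →
      F.Le (q ≫ x) (p ≫ b)) (fun {K} c u => ?_) fun s hs K u b h T p q hpq => ?_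
  · rw [comp_tAll]
    simp only [comp_tImp, ← Category.assoc, comp_eqv, G.comp_inf]
    simp only [Category.assoc, j, b, i, lift_snd_assoc, lift_fst, lift_snd]
    constructor
    · intro h T p q hpq
      have := h p q (𝟙 T) (by simp [hpq])
      simpa [Le, le] using this
    · intro h T p q S r hr
      have := h (r ≫ p) (r ≫ q) (by simpa using hr.symm)
      simpa [Le, le] using this
  · refine le.trans ?_ (Le.comp h p)
    have h1 := (hs (q ≫ f) (q ≫ x)).2 fun S r c hc => by
      have := hc (𝟙 S) (r ≫ q) (by simp)
      simpa using this
    rw [← hpq, Category.assoc] at h1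
    exact h1

lemma exists_sup_choose_le {I : E} (x y b : I ⟶ F.obj) :
    F.Le (F.exists_sup x y).choose b ↔ F.Le x b ∧ F.Le y b := by
  have h := (F.exists_sup x y).choose_spec (𝟙 I) b
  rwa [Category.id_comp, Category.id_comp, Category.id_comp] at h

lemma exists_imp {K : E} (y z : K ⟶ F.obj) : ∃ w : K ⟶ F.obj, ∀ ⦃T : E⦄ (p : T ⟶ K)
    (x : T ⟶ F.obj), F.Le x (p ≫ w) ↔
      G.le (G.inf (x ≫ F.ι) ((p ≫ y) ≫ F.ι)) ((p ≫ z) ≫ F.ι) := by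
  simpa only [Le, Category.assoc] using F.imp y z

/-- The frame structure on a subframe, as an external lattice of generalized elements. -/
def El (I : E) : Type v := I ⟶ F.obj

noncomputable instance (I : E) : DistribLattice (F.El I) :=
  letI _L : Lattice (F.El I) :=
    { le := fun a b => F.Le (I := I) a b
      le_refl := fun _ => G.le_refl _
      le_trans := fun _ _ _ h k => le.trans h k
      le_antisymm := fun _ _ h k => Le.antisymm h k
      sup := fun a b => (F.exists_sup (I := I) a b).choose
      inf := fun a b => (F.inf (I := I) a b).choose
      le_sup_left := fun a b => ((F.exists_sup_choose_le (I := I) a b _).1 (G.le_refl _)).1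
      le_sup_right := fun a b => ((F.exists_sup_choose_le (I := I) a b _).1 (G.le_refl _)).2
      sup_le := fun a b c h k => (F.exists_sup_choose_le (I := I) a b c).2 ⟨h, k⟩
      inf_le_left := fun a b => by
        change G.le ((F.inf (I := I) a b).choose ≫ F.ι) _
        rw [(F.inf (I := I) a b).choose_spec]
        exact (le_meet_iff.1 (G.le_refl _)).1
      inf_le_right := fun a b => by
        change G.le ((F.inf (I := I) a b).choose ≫ F.ι) _
        rw [(F.inf (I := I) a b).choose_spec]
        exact (le_meet_iff.1 (G.le_refl _)).2
      le_inf := fun a b c h k => by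
        change G.le _ ((F.inf (I := I) b c).choose ≫ F.ι)
        rw [(F.inf (I := I) b c).choose_spec]
        exact le_meet_iff.2 ⟨h, k⟩ }
  DistribLattice.ofInfSupLe fun a b c => by
    -- Distributivity follows from implication: meeting with `a` has a right adjoint.
    obtain ⟨w, hw⟩ := F.imp (K := I) a ((a ⊓ b) ⊔ (a ⊓ c) : F.El I)
    have hw' : ∀ x : F.El I, x ≤ (show F.El I from w) ↔ x ⊓ a ≤ (a ⊓ b) ⊔ (a ⊓ c) := fun x => by
      have h := hw (𝟙 I) x
      rw [Category.id_comp, Category.id_comp, Category.id_comp] at h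
      refine h.trans (iff_of_eq ?_)
      change _ = G.le ((F.inf (I := I) x a).choose ≫ F.ι) _
      rw [(F.inf (I := I) x a).choose_spec]
    rw [_root_.inf_comm, ← hw']
    refine sup_le ((hw' b).2 ?_) ((hw' c).2 ?_)
    · rw [_root_.inf_comm]
      exact le_sup_left
    · rw [_root_.inf_comm]
      exact le_sup_right

/-- A subframe, as an internal lattice. -/
noncomputable def lattice : InternalLattice E where
  obj := F.obj
  top I := (F.top I).choose
  bot I := (F.exists_bot I).choose
  inf a b := (F.inf a b).choose
  sup a b := (F.exists_sup a b).choose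
  comp_top {I J} u := by
    rw [← cancel_mono F.ι, Category.assoc, (F.top I).choose_spec, (F.top J).choose_spec,
      G.comp_top]
  comp_bot {I J} u := by
    refine Le.antisymm ((F.exists_bot I).choose_spec u _) ?_
    have := (F.exists_bot J).choose_spec (𝟙 J) (u ≫ (F.exists_bot I).choose)
    rwa [Category.id_comp] at this
  comp_inf u a b := by
    rw [← cancel_mono F.ι, Category.assoc, (F.inf _ _).choose_spec, (F.inf _ _).choose_spec,
      G.comp_inf, Category.assoc, Category.assoc]
  comp_sup u a b := eq_of_forall fun c => by
    rw [(F.exists_sup a b).choose_spec, F.exists_sup_choose_le]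
  inf_comm {I} a b := _root_.inf_comm (α := F.El I) a b
  sup_comm {I} a b := _root_.sup_comm (α := F.El I) a b
  inf_assoc {I} a b c := _root_.inf_assoc (α := F.El I) a b c
  sup_assoc {I} a b c := _root_.sup_assoc (α := F.El I) a b c
  inf_sup_self {I} a b := _root_.inf_sup_self (α := F.El I) (a := a) (b := b)
  sup_inf_self {I} a b := _root_.sup_inf_self (α := F.El I) (a := a) (b := b)
  inf_sup_left {I} a b c := _root_.inf_sup_left (α := F.El I) a b c
  inf_top a := by
    rw [← cancel_mono F.ι, (F.inf _ _).choose_spec, (F.top _).choose_spec, G.inf_top]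
  sup_bot {I} a := _root_.sup_eq_left (α := F.El I) |>.2 (by
    have := (F.exists_bot I).choose_spec (𝟙 I) a
    rwa [Category.id_comp] at this)

lemma lattice_le_iff {I : E} (a b : I ⟶ F.obj) :
    F.lattice.le a b ↔ G.le (a ≫ F.ι) (b ≫ F.ι) :=
  _root_.inf_eq_left (α := F.El I) (a := a) (b := b)

lemma lattice_top_ι (I : E) : F.lattice.top I ≫ F.ι = G.top I := (F.top I).choose_spec

lemma lattice_inf_ι {I : E} (a b : I ⟶ F.obj) :
    F.lattice.inf a b ≫ F.ι = G.inf (a ≫ F.ι) (b ≫ F.ι) := (F.inf a b).choose_spec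

lemma lattice_isFrame : F.lattice.IsFrame where
  exists_join {I J} f a := by
    obtain ⟨s, hs⟩ := F.exists_join f a
    refine ⟨s, fun K u b => (F.lattice_le_iff _ _).trans ((hs u b).trans ?_)⟩
    exact forall_congr' fun T => forall_congr' fun p => forall_congr' fun q =>
      imp_congr_right fun _ => (F.lattice_le_iff _ _).symm
  inf_join := F.lattice.inf_join_of_imp fun y z => by
    obtain ⟨w, hw⟩ := F.exists_imp y z
    exact ⟨w, fun {T} p x => (F.lattice_le_iff _ _).trans ((hw p x).trans (Iff.trans
      (iff_of_eq (congrArg₂ G.le (F.lattice_inf_ι _ _).symm rfl)) (F.lattice_le_iff _ _).symm))⟩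

/-- The space of a subframe. -/
noncomputable def space : LocalicSpace E := ⟨F.lattice, F.lattice_isFrame⟩

end Subframe

end

end InternalLattice

end PointFree

namespace PointFree

/-! ### Ideals with values in a frame -/

section Ideals

open HasSubobjectClassifier MonoidalClosed InternalLattice functionLattice

variable {E : Type u} [Category.{v} E] [CartesianMonoidalCategory E] [MonoidalClosed E]

namespace functionLattice

variable {X : E} {O : InternalLattice E}

/-- The value of a function at an element. -/
noncomputable def applyAt {I : E} (a : I ⟶ X) (x : I ⟶ (functionLattice X O).obj) : I ⟶ O.obj :=
  lift a (𝟙 I) ≫ toFun x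

lemma lift_toFun {I J : E} (a : J ⟶ X) (u : J ⟶ I) (x : I ⟶ (functionLattice X O).obj) :
    lift a u ≫ toFun x = applyAt a (u ≫ x) := by
  rw [applyAt, toFun_comp, ← Category.assoc]
  congr 1
  simp

lemma comp_applyAt {I J : E} (u : J ⟶ I) (a : I ⟶ X) (x : I ⟶ (functionLattice X O).obj) :
    u ≫ applyAt a x = applyAt (u ≫ a) (u ≫ x) := by
  rw [← lift_toFun, applyAt, ← Category.assoc, comp_lift, Category.comp_id]

lemma applyAt_ofFun {I J : E} (a : J ⟶ X) (u : J ⟶ I) (k : X ⊗ I ⟶ O.obj) :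
    applyAt a (u ≫ ofFun k) = lift a u ≫ k := by
  rw [← lift_toFun, toFun_ofFun]

lemma applyAt_top {I : E} (a : I ⟶ X) : applyAt a ((functionLattice X O).top I) = O.top I := by
  rw [applyAt, toFun_top, O.comp_top]

lemma applyAt_inf {I : E} (a : I ⟶ X) (x y : I ⟶ (functionLattice X O).obj) :
    applyAt a ((functionLattice X O).inf x y) = O.inf (applyAt a x) (applyAt a y) := by
  rw [applyAt, toFun_inf, O.comp_inf]; rfl

lemma le_iff_applyAt {I : E} (x y : I ⟶ (functionLattice X O).obj) :
    (functionLattice X O).le x y ↔ ∀ ⦃T : E⦄ (u : T ⟶ I) (a : T ⟶ X),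
      O.le (applyAt a (u ≫ x)) (applyAt a (u ≫ y)) := by
  rw [le_iff_toFun]
  constructor
  · intro h T u a
    rw [← lift_toFun, ← lift_toFun]
    exact h.comp _
  · intro h
    have h1 := h (snd X I) (fst X I)
    rw [← lift_toFun, ← lift_toFun, lift_fst_snd, Category.id_comp, Category.id_comp] at h1
    exact h1

end functionLattice

/-- A function on `A` with values in `O` is an ideal of `A`, with values in `O`. -/
structure IsIdeal {A O : InternalLattice E} {I : E} (x : I ⟶ (functionLattice A.obj O).obj) :
    Prop where
  apply_bot : ∀ ⦃T : E⦄ (u : T ⟶ I), applyAt (A.bot T) (u ≫ x) = O.top T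
  apply_sup : ∀ ⦃T : E⦄ (u : T ⟶ I) (a b : T ⟶ A.obj),
    applyAt (A.sup a b) (u ≫ x) = O.inf (applyAt a (u ≫ x)) (applyAt b (u ≫ x))

namespace IsIdeal

variable {A O : InternalLattice E} {I : E}

lemma comp {x : I ⟶ (functionLattice A.obj O).obj} (h : IsIdeal x) {J : E} (u : J ⟶ I) :
    IsIdeal (u ≫ x) where
  apply_bot T v := by rw [← Category.assoc, h.apply_bot]
  apply_sup T v a b := by rw [← Category.assoc, h.apply_sup]

lemma antitone {x : I ⟶ (functionLattice A.obj O).obj} (h : IsIdeal x) {a b : I ⟶ A.obj}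
    (hab : A.le a b) : O.le (applyAt b x) (applyAt a x) := by
  have h1 := h.apply_sup (𝟙 I) b a
  rw [sup_eq_iff_le.2 hab, Category.id_comp] at h1
  rw [h1]
  exact (le_meet_iff.1 (O.le_refl _)).2

lemma top (I : E) : IsIdeal ((functionLattice A.obj O).top I) where
  apply_bot T u := by rw [(functionLattice A.obj O).comp_top, applyAt_top]
  apply_sup T u a b := by
    rw [(functionLattice A.obj O).comp_top, applyAt_top, applyAt_top, applyAt_top, O.inf_top]

lemma inf {x y : I ⟶ (functionLattice A.obj O).obj} (hx : IsIdeal x) (hy : IsIdeal y) :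
    IsIdeal ((functionLattice A.obj O).inf x y) where
  apply_bot T u := by
    rw [(functionLattice A.obj O).comp_inf, applyAt_inf, hx.apply_bot, hy.apply_bot, O.inf_top]
  apply_sup T u a b := by
    rw [(functionLattice A.obj O).comp_inf, applyAt_inf, applyAt_inf, applyAt_inf, hx.apply_sup,
      hy.apply_sup]
    exact inf_inf_inf_comm (α := O.El T) _ _ _ _

end IsIdeal

variable [HasFiniteLimits E] [HasSubobjectClassifier E]

/-- The ideal conditions quantify over all stages, but they are equations about generic elements, so
they are expressed by one truth value on the object of functions. -/
lemma exists_mono_isIdeal_iff (A O : InternalLattice E) :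
    ∃ (F : E) (ι : F ⟶ (functionLattice A.obj O).obj), Mono ι ∧
      ∀ ⦃I : E⦄ (x : I ⟶ (functionLattice A.obj O).obj),
        IsIdeal x ↔ ∃ w : I ⟶ F, w ≫ ι = x := by
  let G := (functionLattice A.obj O).obj
  let a := fst (A.obj ⊗ A.obj) G ≫ fst A.obj A.obj
  let b := fst (A.obj ⊗ A.obj) G ≫ snd A.obj A.obj
  let z : (A.obj ⊗ A.obj) ⊗ G ⟶ G := snd (A.obj ⊗ A.obj) G
  let s : (A.obj ⊗ A.obj) ⊗ G ⟶ Ω E :=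
    eqv (applyAt (A.sup a b) z) (O.inf (applyAt a z) (applyAt b z))
  have hs : ∀ {T : E} (c d : T ⟶ A.obj) (x : T ⟶ G), lift (lift c d) x ≫ s = tr T ↔
      applyAt (A.sup c d) x = O.inf (applyAt c x) (applyAt d x) := by
    intro T c d x
    have ea : lift (lift c d) x ≫ a = c := by simp [a]
    have eb : lift (lift c d) x ≫ b = d := by simp [b]
    have ez : lift (lift c d) x ≫ z = x := by simp [z]
    rw [comp_eqv, O.comp_inf, comp_applyAt, comp_applyAt, comp_applyAt, A.comp_sup, ea, eb, ez]
  obtain ⟨F, ι, hι, h⟩ := exists_mono_iff_eq_tr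
    (tAnd (eqv (applyAt (A.bot G) (𝟙 G)) (O.top G)) (tAll s))
  refine ⟨F, ι, hι, fun I x => ?_⟩
  rw [← h, comp_tAnd, comp_eqv, comp_tAll, comp_applyAt, A.comp_bot, O.comp_top, Category.comp_id]
  constructor
  · intro hx
    refine ⟨by simpa using hx.apply_bot (𝟙 I), fun T w c => ?_⟩
    have e : c = lift (c ≫ fst _ _) (c ≫ snd _ _) := by ext <;> simp
    rw [e, hs]
    exact hx.apply_sup w _ _
  · rintro ⟨h0, h1⟩
    refine ⟨fun T u => ?_, fun T u c d => (hs _ _ _).1 (h1 u (lift c d))⟩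
    rw [← A.comp_bot u, ← comp_applyAt, h0, O.comp_top]

/-- Functions given by meets of families of implications. -/
lemma exists_applyAt_le_iff (X : E) {O : InternalLattice E} (hO : O.IsFrame) {I J : E}
    (g : J ⟶ X ⊗ I) (y z : J ⟶ O.obj) : ∃ w : I ⟶ (functionLattice X O).obj,
      ∀ ⦃T : E⦄ (u : T ⟶ I) (a : T ⟶ X) (c : T ⟶ O.obj), O.le c (applyAt a (u ≫ w)) ↔
        ∀ ⦃S : E⦄ (p : S ⟶ T) (q : S ⟶ J), p ≫ lift a u = q ≫ g →
          O.le (O.inf (p ≫ c) (q ≫ y)) (q ≫ z) := by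
  obtain ⟨w, hw⟩ := hO.exists_residual g y z
  refine ⟨ofFun w, fun T u a c => ?_⟩
  rw [applyAt_ofFun, hw]

lemma exists_meet_isIdeal {A O : InternalLattice E} (hO : O.IsFrame) {I J : E} (f : J ⟶ I)
    (y : J ⟶ (functionLattice A.obj O).obj) (hy : IsIdeal y) :
    ∃ w : I ⟶ (functionLattice A.obj O).obj, IsIdeal w ∧
      ∀ ⦃K : E⦄ (u : K ⟶ I) (x : K ⟶ (functionLattice A.obj O).obj),
        (functionLattice A.obj O).le x (u ≫ w) ↔ ∀ ⦃T : E⦄ (p : T ⟶ K) (q : T ⟶ J),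
          p ≫ u = q ≫ f → (functionLattice A.obj O).le (p ≫ x) (q ≫ y) := by
  -- With premise `⊤` the implications disappear and `w` is the pointwise meet of the family.
  obtain ⟨w, hw⟩ := exists_applyAt_le_iff A.obj hO (A.obj ◁ f) (O.top _) (toFun y)
  have hw' : ∀ ⦃T : E⦄ (u : T ⟶ I) (a : T ⟶ A.obj) (c : T ⟶ O.obj),
      O.le c (applyAt a (u ≫ w)) ↔ ∀ ⦃S : E⦄ (p : S ⟶ T) (q : S ⟶ J), p ≫ u = q ≫ f →
        O.le (p ≫ c) (applyAt (p ≫ a) (q ≫ y)) := by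
    intro T u a c
    rw [hw]
    simp only [O.comp_top, O.inf_top]
    constructor
    · intro h S p q hpq
      rw [← lift_toFun]
      exact h p (lift (p ≫ a) q) (by simp [hpq])
    · intro h S p q hpq
      have e1 : p ≫ a = q ≫ fst _ _ := by
        have := congrArg (· ≫ fst _ _) hpq
        simpa using this
      have e2 : p ≫ u = (q ≫ snd _ _) ≫ f := by
        have := congrArg (· ≫ snd _ _) hpq
        simpa using this
      have h1 := h p (q ≫ snd _ _) e2
      have e3 : lift (q ≫ fst _ _) (q ≫ snd _ _) = q := by ext <;> simp
      rwa [← lift_toFun, e1, e3] at h1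
  refine ⟨w, ⟨fun T u => ?_, fun T u a b => ?_⟩, fun K u x => ?_⟩
  · rw [← top_le_iff_eq, hw']
    intro S p q _
    rw [A.comp_bot, hy.apply_bot]
    exact le_top _
  · refine eq_of_forall_le_iff' fun c => ?_
    simp only [le_meet_iff, hw', A.comp_sup, hy.apply_sup]
    exact ⟨fun h => ⟨fun S p q hpq => (h p q hpq).1, fun S p q hpq => (h p q hpq).2⟩,
      fun h S p q hpq => ⟨h.1 p q hpq, h.2 p q hpq⟩⟩
  · simp only [le_iff_applyAt]
    constructor
    · intro h T p q hpq S v a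
      have h1 := (hw' ((v ≫ p) ≫ u) a _).1 (by
        have := h (v ≫ p) a
        rwa [← Category.assoc] at this) (𝟙 S) (v ≫ q) (by
          rw [Category.id_comp, Category.assoc, hpq, Category.assoc])
      simpa using h1
    · intro h T v a
      rw [← Category.assoc, hw']
      intro S p q hpq
      have h1 := h (p ≫ v) q (by rw [Category.assoc, hpq]) (𝟙 S) (p ≫ a)
      rw [comp_applyAt]
      simpa using h1

/-- The implication is `a ↦ ⋀ c, (y c ⇒ z (a ⊓ c))`. Pointwise implication need not be an ideal, but
this is one: `z` is an ideal and `A` is distributive. -/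
lemma exists_imp_isIdeal {A O : InternalLattice E} (hO : O.IsFrame) {I : E}
    (y z : I ⟶ (functionLattice A.obj O).obj) (hy : IsIdeal y) (hz : IsIdeal z) :
    ∃ w : I ⟶ (functionLattice A.obj O).obj, IsIdeal w ∧
      ∀ ⦃K : E⦄ (u : K ⟶ I) (x : K ⟶ (functionLattice A.obj O).obj), IsIdeal x →
        ((functionLattice A.obj O).le x (u ≫ w) ↔
          (functionLattice A.obj O).le ((functionLattice A.obj O).inf x (u ≫ y)) (u ≫ z)) := by
  let c := fst A.obj (A.obj ⊗ I)
  let a := snd A.obj (A.obj ⊗ I) ≫ fst A.obj I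
  let i := snd A.obj (A.obj ⊗ I) ≫ snd A.obj I
  obtain ⟨w, hw⟩ := exists_applyAt_le_iff A.obj hO (snd A.obj (A.obj ⊗ I))
    (applyAt c (i ≫ y)) (applyAt (A.inf a c) (i ≫ z))
  have hw' : ∀ ⦃T : E⦄ (u : T ⟶ I) (a : T ⟶ A.obj) (d : T ⟶ O.obj),
      O.le d (applyAt a (u ≫ w)) ↔ ∀ ⦃S : E⦄ (p : S ⟶ T) (c : S ⟶ A.obj),
        O.le (O.inf (p ≫ d) (applyAt c (p ≫ u ≫ y)))
          (applyAt (A.inf (p ≫ a) c) (p ≫ u ≫ z)) := by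
    intro T u b d
    rw [hw]
    simp only [comp_applyAt, A.comp_inf]
    constructor
    · intro h S p e
      have h1 := h p (lift e (p ≫ lift b u)) (by rw [lift_snd])
      simpa [c, a, i] using h1
    · intro h S p q hpq
      have e1 : q ≫ a = p ≫ b := by
        have := congrArg (· ≫ fst _ _) hpq
        simpa [a] using this.symm
      have e2 : q ≫ i = p ≫ u := by
        have := congrArg (· ≫ snd _ _) hpq
        simpa [i] using this.symm
      have h1 := h p (q ≫ c)
      rw [← Category.assoc q i, ← Category.assoc q i, e1, e2, Category.assoc, Category.assoc]
      exact h1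
  refine ⟨w, ⟨fun T u => ?_, fun T u a b => ?_⟩, fun K u x hx => ?_⟩
  · rw [← top_le_iff_eq, hw']
    intro S p c
    rw [A.comp_bot, bot_inf, ← Category.assoc p u z, hz.apply_bot]
    exact le_top _
  · refine eq_of_forall_le_iff' fun d => ?_
    simp only [le_meet_iff, hw', A.comp_sup, A.inf_sup_distrib]
    simp only [← Category.assoc _ u z, hz.apply_sup, le_meet_iff]
    exact ⟨fun h => ⟨fun S p c => (h p c).1, fun S p c => (h p c).2⟩,
      fun h S p c => ⟨h.1 p c, h.2 p c⟩⟩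
  · simp only [le_iff_applyAt, (functionLattice A.obj O).comp_inf, applyAt_inf]
    constructor
    · intro h T v a
      have h1 := h v a
      rw [← Category.assoc, hw'] at h1
      -- The instance `c = a` suffices in this direction.
      have h2 := h1 (𝟙 T) a
      simp only [Category.id_comp, Category.assoc, inf_self] at h2
      exact h2
    · intro h T v a
      rw [← Category.assoc, hw']
      intro S p c
      rw [comp_applyAt]
      -- Ideals reverse the order, so `x a ⊓ y c ≤ x (a ⊓ c) ⊓ y (a ⊓ c) ≤ z (a ⊓ c)`.
      have h1 := h (p ≫ v) (A.inf (p ≫ a) c)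
      simp only [Category.assoc] at h1 ⊢
      refine le.trans (le_meet_iff.2 ⟨?_, ?_⟩) h1
      · refine (le_meet_iff.1 (O.le_refl _)).1.trans ?_
        rw [← Category.assoc]
        exact (hx.comp _).antitone (le_meet_iff.1 (A.le_refl _)).1
      · refine (le_meet_iff.1 (O.le_refl _)).2.trans ?_
        rw [← Category.assoc, ← Category.assoc]
        exact (hy.comp _).antitone (le_meet_iff.1 (A.le_refl _)).2

/-- The frame of ideals of `A` with values in the frame `O`. -/
noncomputable def idealSubframe (A : InternalLattice E) {O : InternalLattice E} (hO : O.IsFrame) :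
    Subframe (functionLattice A.obj O) :=
  have h := exists_mono_isIdeal_iff A O
  have hι := h.choose_spec.choose_spec.2
  have hw : ∀ {I : E} (w : I ⟶ h.choose), IsIdeal (w ≫ h.choose_spec.choose) :=
    fun w => (hι _).2 ⟨w, rfl⟩
  { obj := h.choose
    ι := h.choose_spec.choose
    mono := h.choose_spec.choose_spec.1
    top := fun I => (hι _).1 (IsIdeal.top I)
    inf := fun a b => (hι _).1 ((hw a).inf (hw b))
    meet := fun f b => by
      obtain ⟨w, h1, h2⟩ := exists_meet_isIdeal hO f _ (hw b)
      obtain ⟨w, rfl⟩ := (hι w).1 h1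
      exact ⟨w, fun K u x => h2 u _⟩
    imp := fun y z => by
      obtain ⟨w, h1, h2⟩ := exists_imp_isIdeal hO _ _ (hw y) (hw z)
      obtain ⟨w, rfl⟩ := (hι w).1 h1
      exact ⟨w, fun T p x => h2 p _ (hw x)⟩ }

lemma isIdeal_iff (A : InternalLattice E) {O : InternalLattice E} (hO : O.IsFrame) {I : E}
    (x : I ⟶ (functionLattice A.obj O).obj) :
    IsIdeal x ↔ ∃ w : I ⟶ (idealSubframe A hO).obj, w ≫ (idealSubframe A hO).ι = x :=
  (exists_mono_isIdeal_iff A O).choose_spec.choose_spec.2 x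

end Ideals

end PointFree

namespace PointFree

/-! ### Products with a spectrum, and exponentials of Stone spaces -/

section Stone

open HasSubobjectClassifier MonoidalClosed InternalLattice functionLattice

variable {E : Type u} [Category.{v} E] [CartesianMonoidalCategory E] [HasFiniteLimits E]
  [HasSubobjectClassifier E] [MonoidalClosed E]

/-- The space whose opens are the ideals of `A` with values in the opens of `W`; this is the
product of `W` and the spectrum of `A`. -/
noncomputable def idealSpace (A : InternalLattice E) (W : LocalicSpace E) : LocalicSpace E :=
  (idealSubframe A W.isFrame).space

namespace idealSpace

variable {A : InternalLattice E} {W : LocalicSpace E}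

/-- The function given by an ideal. -/
noncomputable def toFunction {I : E} (x : I ⟶ (idealSpace A W).opens.obj) :
    I ⟶ (functionLattice A.obj W.opens).obj :=
  (show I ⟶ (idealSubframe A W.isFrame).obj from x) ≫ (idealSubframe A W.isFrame).ι

lemma toFunction_comp {I J : E} (u : J ⟶ I) (x : I ⟶ (idealSpace A W).opens.obj) :
    toFunction (u ≫ x) = u ≫ toFunction x := Category.assoc _ _ _

lemma isIdeal_toFunction {I : E} (x : I ⟶ (idealSpace A W).opens.obj) :
    IsIdeal (toFunction x) := (isIdeal_iff A W.isFrame _).2 ⟨x, rfl⟩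

lemma exists_toFunction_eq {I : E} (y : I ⟶ (functionLattice A.obj W.opens).obj)
    (hy : IsIdeal y) : ∃ x : I ⟶ (idealSpace A W).opens.obj, toFunction x = y :=
  (isIdeal_iff A W.isFrame y).1 hy

lemma le_iff {I : E} (x y : I ⟶ (idealSpace A W).opens.obj) :
    (idealSpace A W).opens.le x y ↔
      ∀ ⦃T : E⦄ (u : T ⟶ I) (a : T ⟶ A.obj), W.opens.le (applyAt a (toFunction (u ≫ x)))
        (applyAt a (toFunction (u ≫ y))) := by
  simp only [toFunction_comp]
  exact ((idealSubframe A W.isFrame).lattice_le_iff x y).trans (le_iff_applyAt _ _)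

lemma applyAt_top' {I : E} (a : I ⟶ A.obj) :
    applyAt a (toFunction ((idealSpace A W).opens.top I)) = W.opens.top I :=
  (congrArg _ ((idealSubframe A W.isFrame).lattice_top_ι I)).trans (applyAt_top a)

lemma applyAt_inf' {I : E} (a : I ⟶ A.obj) (x y : I ⟶ (idealSpace A W).opens.obj) :
    applyAt a (toFunction ((idealSpace A W).opens.inf x y)) =
      W.opens.inf (applyAt a (toFunction x)) (applyAt a (toFunction y)) :=
  (congrArg _ ((idealSubframe A W.isFrame).lattice_inf_ι x y)).trans (applyAt_inf a _ _)

lemma ext {I : E} {x y : I ⟶ (idealSpace A W).opens.obj} (h : ∀ ⦃T : E⦄ (u : T ⟶ I)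
    (a : T ⟶ A.obj), applyAt a (toFunction (u ≫ x)) = applyAt a (toFunction (u ≫ y))) : x = y :=
  le.antisymm ((le_iff _ _).2 fun _ u a => h u a ▸ W.opens.le_refl _)
    ((le_iff _ _).2 fun _ u a => h u a ▸ W.opens.le_refl _)

lemma exists_applyAt_eq {I : E} (k : A.obj ⊗ I ⟶ W.opens.obj)
    (h0 : ∀ ⦃T : E⦄ (u : T ⟶ I), lift (A.bot T) u ≫ k = W.opens.top T)
    (h1 : ∀ ⦃T : E⦄ (u : T ⟶ I) (a b : T ⟶ A.obj),
      lift (A.sup a b) u ≫ k = W.opens.inf (lift a u ≫ k) (lift b u ≫ k)) :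
    ∃ x : I ⟶ (idealSpace A W).opens.obj, ∀ ⦃T : E⦄ (u : T ⟶ I) (a : T ⟶ A.obj),
      applyAt a (toFunction (u ≫ x)) = lift a u ≫ k := by
  obtain ⟨x, hx⟩ := exists_toFunction_eq (A := A) (W := W) (ofFun k)
    ⟨fun T u => by rw [applyAt_ofFun, h0], fun T u a b => by
      rw [applyAt_ofFun, applyAt_ofFun, applyAt_ofFun, h1]⟩
  exact ⟨x, fun T u a => by rw [toFunction_comp, hx, applyAt_ofFun]⟩

variable (A W)

/-- The principal ideals. -/
lemma exists_principal : ∃ η : A.obj ⟶ (idealSpace A W).opens.obj,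
    ∀ ⦃I : E⦄ (a c : I ⟶ A.obj) (r : I ⟶ (point E).opens.obj),
      (∀ ⦃T : E⦄ (u : T ⟶ I), Holds (u ≫ r) ↔ A.le (u ≫ c) (u ≫ a)) →
      applyAt c (toFunction (a ≫ η)) = r ≫ truthMap W := by
  -- `h` is the truth value of `c ≤ a`; the principal ideal of `a` is `c ↦ (c ≤ a)`, read in the
  -- opens of `W`.
  obtain ⟨h, hh⟩ := exists_holds_iff_eq (A.inf (fst A.obj A.obj) (snd A.obj A.obj))
    (fst A.obj A.obj)
  have hh' : ∀ {I : E} (c a : I ⟶ A.obj), Holds (lift c a ≫ h) ↔ A.le c a := by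
    intro I c a
    rw [hh, A.comp_inf, lift_fst, lift_snd]
    rfl
  have hu : ∀ {I T : E} (u : T ⟶ I) (c a : I ⟶ A.obj),
      Holds (u ≫ lift c a ≫ h) ↔ A.le (u ≫ c) (u ≫ a) := by
    intro I T u c a
    rw [← Category.assoc, comp_lift, hh']
  obtain ⟨η, hη⟩ := exists_applyAt_eq (A := A) (W := W) (h ≫ truthMap W) (fun T u => by
      rw [← Category.assoc]
      exact comp_truthMap_eq_top W ((hh' _ _).2 (bot_le u))) (fun T u a b => by
      rw [← Category.assoc, ← Category.assoc, ← Category.assoc, ← truthMap_inf]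
      congr 1
      refine eq_of_mem_iff fun S v x => ?_
      rw [mem_iff_holds, mem_iff_holds, (point E).opens.comp_inf, holds_inf, hu, hu, hu,
        A.comp_sup, join_le_iff])
  refine ⟨η, fun I a c r hr => ?_⟩
  rw [hη, ← Category.assoc]
  congr 1
  refine eq_of_mem_iff fun S v x => ?_
  rw [mem_iff_holds, mem_iff_holds, hu, hr]

/-- The lattice homomorphism to the opens of the space of ideals, with the Yoneda lemma. -/
lemma exists_hom : ∃ η : Hom A (idealSpace A W).opens,
    ∀ ⦃I : E⦄ (a c : I ⟶ A.obj) (r : I ⟶ (point E).opens.obj),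
      (∀ ⦃T : E⦄ (u : T ⟶ I), Holds (u ≫ r) ↔ A.le (u ≫ c) (u ≫ a)) →
      applyAt c (toFunction (a ≫ η.map)) = r ≫ truthMap W := by
  obtain ⟨η, hη⟩ := exists_principal A W
  have hr : ∀ {I : E} (a c : I ⟶ A.obj), ∃ r : I ⟶ (point E).opens.obj,
      ∀ ⦃T : E⦄ (u : T ⟶ I), Holds (u ≫ r) ↔ A.le (u ≫ c) (u ≫ a) := by
    intro I a c
    obtain ⟨r, hr⟩ := exists_holds_iff_eq (A.inf c a) c
    exact ⟨r, fun T u => by rw [hr, A.comp_inf]; rfl⟩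
  have apply_top : ∀ {I : E} (a c : I ⟶ A.obj), A.le c a →
      applyAt c (toFunction (a ≫ η)) = W.opens.top I := by
    intro I a c hca
    obtain ⟨r, h⟩ := hr a c
    rw [hη a c r h]
    refine comp_truthMap_eq_top W ?_
    have := (h (𝟙 I)).2 (hca.comp _)
    rwa [Category.id_comp] at this
  -- The principal ideal of `a` is the least ideal with value `⊤` at `a`. Preservation of `0` and of
  -- binary joins then follows from the ideal laws for `y`, without a formula for joins of ideals.
  have yoneda : ∀ {I : E} (a : I ⟶ A.obj) (y : I ⟶ (idealSpace A W).opens.obj),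
      (idealSpace A W).opens.le (a ≫ η) y ↔ applyAt a (toFunction y) = W.opens.top I := by
    intro I a y
    rw [le_iff]
    constructor
    · intro h
      have h1 := h (𝟙 I) a
      rwa [Category.id_comp, Category.id_comp, apply_top a a (A.le_refl a), top_le_iff_eq] at h1
    · intro h T u c
      rw [← Category.assoc]
      obtain ⟨r, hr⟩ := hr (u ≫ a) c
      rw [hη _ _ r hr, truthMap_le_iff]
      intro S v hv
      rw [hr] at hv
      rw [comp_applyAt, ← top_le_iff_eq, ← toFunction_comp]
      refine le.trans ?_ ((isIdeal_toFunction _).antitone hv)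
      rw [← Category.assoc, ← Category.assoc, toFunction_comp, ← comp_applyAt, h,
        W.opens.comp_top]
      exact W.opens.le_refl _
  have key0 : ∀ {I : E} (y : I ⟶ (idealSpace A W).opens.obj),
      applyAt (A.bot I) (toFunction y) = W.opens.top I := by
    intro I y
    have := (isIdeal_toFunction y).apply_bot (𝟙 I)
    rwa [Category.id_comp] at this
  have key1 : ∀ {I : E} (a b : I ⟶ A.obj) (y : I ⟶ (idealSpace A W).opens.obj),
      applyAt (A.sup a b) (toFunction y) =
        W.opens.inf (applyAt a (toFunction y)) (applyAt b (toFunction y)) := by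
    intro I a b y
    have := (isIdeal_toFunction y).apply_sup (𝟙 I) a b
    rwa [Category.id_comp] at this
  refine ⟨⟨η, fun I => ?_, fun I => ?_, fun {I} a b => ?_, fun {I} a b => ?_⟩, hη⟩
  · refine ext fun T u c => ?_
    rw [← Category.assoc, A.comp_top, apply_top _ _ (le_top c), (idealSpace A W).opens.comp_top,
      applyAt_top']
  · refine eq_of_forall_le_iff fun y => ?_
    rw [yoneda, key0]
    exact iff_of_true rfl (bot_le y)
  · refine ext fun T u c => ?_
    rw [← Category.assoc, A.comp_inf, (idealSpace A W).opens.comp_inf, applyAt_inf',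
      ← Category.assoc, ← Category.assoc]
    obtain ⟨r, h⟩ := hr (A.inf (u ≫ a) (u ≫ b)) c
    obtain ⟨s, k⟩ := hr (u ≫ a) c
    obtain ⟨t, l⟩ := hr (u ≫ b) c
    rw [hη _ _ r h, hη _ _ s k, hη _ _ t l, ← truthMap_inf]
    congr 1
    refine eq_of_mem_iff fun S v x => ?_
    rw [mem_iff_holds, mem_iff_holds, (point E).opens.comp_inf, holds_inf, h, k, l, A.comp_inf,
      le_meet_iff]
  · refine eq_of_forall_le_iff fun y => ?_
    rw [join_le_iff, yoneda, yoneda, yoneda, key1, inf_eq_top_iff_and]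

/-- The projection from the space of ideals. -/
lemma nonempty_hom_fst : Nonempty (idealSpace A W ⟶ W) := by
  obtain ⟨h, hh⟩ := exists_holds_iff_eq (𝟙 A.obj) (A.bot A.obj)
  have hu : ∀ {T : E} (c : T ⟶ A.obj), Holds (c ≫ h) ↔ c = A.bot T := by
    intro T c
    rw [hh, Category.comp_id, A.comp_bot]
  -- An open `w` of `W` is pulled back to the ideal `c ↦ w ⊔ (c = 0)`: constant, except for the
  -- value `⊤` that an ideal must have at `0`.
  obtain ⟨ν, hν⟩ := exists_applyAt_eq (A := A) (W := W)
    (W.opens.sup (snd A.obj W.opens.obj) (fst A.obj W.opens.obj ≫ h ≫ truthMap W))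
    (fun T u => by
      rw [W.opens.comp_sup, lift_fst_assoc, ← Category.assoc,
        comp_truthMap_eq_top W ((hu _).2 rfl), sup_top]) (fun T u a b => by
      simp only [W.opens.comp_sup, lift_fst_assoc, lift_snd]
      rw [← InternalLattice.sup_inf_left, ← Category.assoc, ← Category.assoc, ← Category.assoc, ← truthMap_inf]
      congr 2
      refine eq_of_mem_iff fun S v x => ?_
      rw [mem_iff_holds, mem_iff_holds, (point E).opens.comp_inf, holds_inf, ← Category.assoc,
        ← Category.assoc, ← Category.assoc, hu, hu, hu, A.comp_sup, ← le_bot_iff_eq, join_le_iff,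
        le_bot_iff_eq, le_bot_iff_eq])
  have hν' : ∀ {T : E} (c : T ⟶ A.obj) (a : T ⟶ W.opens.obj),
      applyAt c (toFunction (a ≫ ν)) = W.opens.sup a (c ≫ h ≫ truthMap W) := by
    intro T c a
    rw [hν, W.opens.comp_sup, lift_fst_assoc, lift_snd]
  refine ⟨LocalicSpace.Map.ofAdjoint ν (fun I => ?_) (fun {I} a b => ?_) fun {I} y => ?_⟩
  · refine ext fun T u c => ?_
    rw [← Category.assoc, hν', W.opens.comp_top, top_sup, (idealSpace A W).opens.comp_top,
      applyAt_top']
  · refine ext fun T u c => ?_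
    rw [← Category.assoc, hν', (idealSpace A W).opens.comp_inf, applyAt_inf', W.opens.comp_inf,
      ← Category.assoc u, ← Category.assoc u, hν', hν', W.opens.sup_inf_distrib]
  -- The right adjoint evaluates an ideal at `1`, where its value is least.
  · refine ⟨applyAt (A.top I) (toFunction y), fun K u a => ?_⟩
    rw [le_iff, comp_applyAt, A.comp_top]
    constructor
    · intro k
      have k1 := k (𝟙 K) (A.top K)
      rw [Category.id_comp, Category.id_comp, hν', join_le_iff, toFunction_comp] at k1
      exact k1.1
    · intro k T v c
      rw [← Category.assoc, hν', join_le_iff, ← Category.assoc c, truthMap_le_iff]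
      constructor
      · have k1 := k.comp v
        rw [comp_applyAt, A.comp_top, ← toFunction_comp, ← toFunction_comp] at k1
        exact k1.trans ((isIdeal_toFunction _).antitone (le_top c))
      · intro S w hw
        rw [← Category.assoc, hu] at hw
        rw [comp_applyAt, hw, ← Category.assoc v, toFunction_comp,
          ← Category.assoc w, (isIdeal_toFunction y).apply_bot]

/-- Compactness of the spectrum: if the product of `W` with the spectrum of `A` is trivial, then
`0 = 1` holds in `A` over `W`. -/
lemma truthOpen_eq_top_of_isTrivial (h : (idealSpace A W).IsTrivial) :
    truthOpen W (equalizer (A.bot (𝟙_ E)) (A.top (𝟙_ E))) = W.opens.top (𝟙_ E) := by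
  obtain ⟨η, hη⟩ := exists_hom A W
  have e := hη (A.bot (𝟙_ E)) (A.top (𝟙_ E))
    (openOf (toUnit (equalizer (A.bot (𝟙_ E)) (A.top (𝟙_ E))))) (fun T u => by
      rw [holds_openOf, ← bot_eq_top_iff_nonempty, A.comp_top, A.comp_bot, top_le_iff_eq])
  -- By triviality the principal ideal of `0` is the top ideal, so its value at `1`, the truth value
  -- of `1 ≤ 0`, is `⊤`.
  rw [η.bot_map, h, applyAt_top'] at e
  exact e.symm

end idealSpace

/-- The exponential `0 ^ S` for the spectrum `S` of a lattice `A`. -/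
lemma isExponential_spec {A : InternalLattice E} {S : LocalicSpace E} (hS : IsSpec A S) :
    IsExponential S (emptySpace E)
      (discrete (equalizer (A.bot (𝟙_ E)) (A.top (𝟙_ E)))) := by
  obtain ⟨η, hη⟩ := hS
  rw [isExponential_emptySpace_iff]
  refine ⟨fun T x s => ?_, fun W hW => existsUnique_hom_discrete_of_eq_top ?_⟩
  · let ψ := equalizer (A.bot (𝟙_ E)) (A.top (𝟙_ E))
    have h1 : truthOpen T ψ = T.opens.top (𝟙_ E) := truthOpen_eq_top_of_hom (𝟙 ψ) x
    have h2 : truthOpen T ψ = T.opens.bot (𝟙_ E) := by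
      rw [truthOpen_eq_bot_iff, ← s.inv.bot_map, ← s.inv.top_map, ← η.bot_map, ← η.top_map,
        (A.bot_eq_top_iff_nonempty ψ).2 ⟨𝟙 ψ⟩]
    exact LocalicSpace.isTrivial_of_bot_eq_top (h2.symm.trans h1)
  · obtain ⟨k, -⟩ := idealSpace.exists_hom A W
    -- The universal property of `S` turns the homomorphism `k` into the second projection, to `S`.
    obtain ⟨g, -, -⟩ := hη _ k
    exact idealSpace.truthOpen_eq_top_of_isTrivial A W
      (hW _ (idealSpace.nonempty_hom_fst A W).some g)

end Stone

end PointFree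

/-! ### The theorem -/

theorem mainTheorem6 {E : Type u} [Category.{v} E] [CartesianMonoidalCategory E]
    [HasFiniteLimits E] [MonoidalClosed E] [HasSubobjectClassifier E] :
    -- the discrete space on a truth value is the open subspace of `1` that it gives
    (∀ (φ : E) [Mono (toUnit φ)], Nonempty (discrete φ ≅ (openOfTruth φ).space)) ∧
    -- for discrete `X`: `0 ^ X` is the closed complement of the image of `X` in `1`; it is Stone,
    -- with the Boolean algebra described; and `0 ^ (0 ^ X)` is the image of `X` in `1`
    (∀ X : E,
      IsExponential (discrete X) (emptySpace E) (closedOfTruth (support X)).space ∧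
      (∃ B : InternalLattice E, IsFreeOnRelations X B ∧ IsQuotientOfTwo (support X) B ∧
        IsSpec B (closedOfTruth (support X)).space) ∧
      IsExponential (closedOfTruth (support X)).space (emptySpace E) (discrete (support X))) ∧
    -- for Stone `S = Spec A`: `0 ^ S` is discrete, on the subobject of `1` where `0 = 1` in `A`
    (∀ (A : InternalLattice E) (S : LocalicSpace E), A.IsBoolean → IsSpec A S →
      IsExponential S (emptySpace E) (discrete (equalizer (A.bot (𝟙_ E)) (A.top (𝟙_ E))))) ∧
    -- double negation for truth values
    (∀ (φ : E) [Mono (toUnit φ)] (N M : LocalicSpace E),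
      IsExponential (discrete φ) (emptySpace E) N → IsExponential N (emptySpace E) M →
        Nonempty (M ≅ discrete φ)) ∧
    -- every open subspace is complemented by the corresponding closed subspace
    (∀ (L : LocalicSpace E) (U : 𝟙_ E ⟶ L.opens.obj),
      IsLUB {openSubspace L U, closedSubspace L U} (Subspace.whole L) ∧
      IsGLB {openSubspace L U, closedSubspace L U} (Subspace.empty L)) ∧
    -- excluded middle `φ ∨ 0 ^ φ = 1` for truth values, in the subspaces of `1`
    (∀ (φ : E) [Mono (toUnit φ)],
      IsExponential (discrete φ) (emptySpace E) (closedOfTruth φ).space ∧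
      IsLUB {openOfTruth φ, closedOfTruth φ} (Subspace.whole (point E))) := by
  -- Minimality of the image: this is the hypothesis `hφ` of the lemmas on discrete spaces, for `φ =
  -- support X`.
  have hsupp : ∀ (X ψ : E) [Mono (toUnit ψ)], (X ⟶ ψ) → Nonempty (support X ⟶ ψ) :=
    fun X ψ _ w => ⟨image.lift ⟨ψ, toUnit ψ, w, toUnit_unique _ _⟩⟩
  refine ⟨fun φ _ => nonempty_discrete_iso_openOfTruth φ, fun X => ⟨?_, ?_, ?_⟩,
    fun A S _ hS => isExponential_spec hS, fun φ _ N M => nonempty_iso_of_isExponential φ,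
    fun L U => ⟨isLUB_open_closed L U, isGLB_open_closed L U⟩,
    fun φ _ => ⟨isExponential_discrete (𝟙 φ) fun ψ _ w => ⟨w⟩, isLUB_open_closed _ _⟩⟩
  · exact isExponential_discrete (factorThruImage (toUnit X)) (fun ψ _ w => hsupp X ψ w)
  · exact exists_isFreeOnRelations (factorThruImage (toUnit X)) (fun ψ _ w => hsupp X ψ w)
  · exact isExponential_closedOfTruth (support X)
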